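/- **Setting.** Let $M$ be a compact smooth surface with smooth boundary $\partial M$. A branched immersion of $M$ into $\mathbb{R}^n$ is a $C^1$ map $u:M\to\mathbb{R}^n$ such that every $p\in M$ (including boundary points) is either a point where $du_p$ has rank $2$, or a branch point: there are an integer $m\ge 2$, a $C^1$ coordinate $z$ of $M$ near $p$ with values in $\mathbb{C}$ and $z(p)=0$, and a rigid motion of $\mathbb{R}^n\simeq\mathbb{C}\times\mathbb{R}^{n-2}$ taking $u(p)$ to $0$, after which $u=(z^m,f(z))$ near $p$ with $f(z)=o(|z|^m)$. Integrals over $M$ are taken with respect to the area measure $dA=Ju\,d\mathcal{H}^2$, $Ju=\sqrt{\det\big((du)^*du\big)}$. Put $r_0=\max_{x,y\in u(M)}|x-y|$. For $p\in(2,\infty]$ put $C(p)=1$, $\alpha=1$ if $p=\infty$, and $C(p)=\frac{2p}{p-2}\left(\frac2\pi\right)^{1/p}$, $\alpha=1-\frac2p$ if $p<\infty$. **Statement.** For every $\epsilon\in(0,2]$ there is a $\delta=\delta(\epsilon)\in(0,1)$, depending only on $\epsilon$, such that the following holds for all $n$ and all $p\in(2,\infty]$. Let $\Gamma\subset\mathbb{R}^n$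 be a simple closed regular $C^1$ curve whose total curvature (the total variation of its unit tangent) is at most $(4-\epsilon)\pi$. Let $u:M\to\mathbb{R}^n$ be a branched immersion that is one-to-one on $\partial M$ with $u(\partial M)=\Gamma$. Suppose that there is an integrable normal vector field $H:M\to\mathbb{R}^n$ (the mean curvature vector) such that $$\int_M \operatorname{div}_M X\,dA=\int_M X\cdot H\,dA+\int_\Gamma X\cdot\nu_M\,ds$$ for every $C^1$ vector field $X$ on $\mathbb{R}^n$, where $\nu_M$ is the outward unit normal to the boundary tangent to $M$. If $H\in L^p(M)$ and $$C(p)\,\|H\|_{L^p(M)}\,r_0^{\alpha}<\delta,$$ then the interior of $M$ is embedded: the restriction of $u$ to $M\setminus\partial M$ is an immersion (so there are no interior branch points) and a homeomorphism onto its image. -/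

import Mathlib

open Set MeasureTheory Topology Manifold
open scoped ENNReal ContDiff RealInnerProductSpace

noncomputable section

namespace BranchedSurface

/-- Euclidean space `ℝⁿ`. -/
abbrev Euc (n : ℕ) : Type := EuclideanSpace ℝ (Fin n)

variable {n : ℕ} {M : Type*} [TopologicalSpace M] [ChartedSpace (EuclideanHalfSpace 2) M]

/-- The differential of `u` at `p`, in the preferred chart at `p`; that chart identifies `T_pM` with
`ℝ²`, and if `p ∈ ∂M` then `T_p∂M` is `{v | v 0 = 0}` and the inward vectors are `{v | 0 < v 0}`. -/
def du (u : M → Euc n) (p : M) : Euc 2 →L[ℝ] Euc n :=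
  mfderiv (𝓡∂ 2) 𝓘(ℝ, Euc n) u p

/-- `u` has a branch point at `p`: for some `m ≥ 2`, in a `C¹` coordinate `ζ : U → ℂ` of `M`
centred at `p` (a half-disc-like coordinate if `p ∈ ∂M`) and after a rigid motion of `ℝⁿ`, `u` has
the form `(ζ^m, f(ζ)) ∈ ℂ × ℝⁿ⁻²`, where `ζ^m` is the leading term, that is `f(ζ) = o(|ζ|^m)`.
The factor `ℂ × 0` is the range of `L`, the factor `0 × ℝⁿ⁻²` is its orthogonal complement. -/
def IsBranchPoint (u : M → Euc n) (p : M) : Prop :=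
  ∃ (m : ℕ) (U : Set M) (ζ : M → ℂ) (L : ℂ →ₗᵢ[ℝ] Euc n) (f : ℂ → Euc n),
    2 ≤ m ∧ IsOpen U ∧ p ∈ U ∧
    ContMDiffOn (𝓡∂ 2) 𝓘(ℝ, ℂ) 1 ζ U ∧ InjOn ζ U ∧
    (∀ q ∈ U, Function.Bijective (mfderiv (𝓡∂ 2) 𝓘(ℝ, ℂ) ζ q)) ∧ ζ p = 0 ∧
    (∀ z w, ⟪L z, f w⟫ = 0) ∧
    (∀ q ∈ U, u q = u p + L (ζ q ^ m) + f (ζ q)) ∧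
    (fun q => f (ζ q)) =o[𝓝 p] (fun q => ζ q ^ m)

/-- A branched immersion of the surface `M` into `ℝⁿ`: a `C¹` map which, at every point up to and
including the boundary, is an immersion or has a branch point. -/
structure IsBranchedImmersion (u : M → Euc n) : Prop where
  contMDiff : ContMDiff (𝓡∂ 2) 𝓘(ℝ, Euc n) 1 u
  immersed_or_branch : ∀ p, Function.Injective (du u p) ∨ IsBranchPoint u p

/-- The Jacobian `√det(A* A)` of a linear map `A : ℝ² → ℝⁿ`. -/
def jacobian (A : Euc 2 →L[ℝ] Euc n) : ℝ :=
  Real.sqrt (LinearMap.det ((ContinuousLinearMap.adjoint A ∘L A : Euc 2 →L[ℝ] Euc 2) :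
    Euc 2 →ₗ[ℝ] Euc 2))

/-- The Jacobian of `u` read in the chart at `p`. -/
def chartJacobian (u : M → Euc n) (p : M) (y : Euc 2) : ℝ :=
  jacobian (fderivWithin ℝ (u ∘ (extChartAt (𝓡∂ 2) p).symm) (range (𝓡∂ 2)) y)

/-- The area `Ju dℋ²` of `u` on the domain of the chart at `p`, as a measure on `M`. -/
def chartArea [MeasurableSpace M] (u : M → Euc n) (p : M) : Measure M :=
  ((volume.restrict (extChartAt (𝓡∂ 2) p).target).withDensity
    (fun y => ENNReal.ofReal (chartJacobian u p y))).map (extChartAt (𝓡∂ 2) p).symm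

/-- The area measure `Ju dℋ²` on `M` induced by `u` (area counted with multiplicity in `ℝⁿ`).
By the change of variables formula the measures `chartArea u p` agree on overlaps of charts, so
their supremum is the measure that restricts to `chartArea u p` on every chart domain. -/
def area [MeasurableSpace M] (u : M → Euc n) : Measure M :=
  iSup (fun p : M => chartArea u p)

/-- The divergence `div_M X = ∑ᵢ ⟨τᵢ, D_{τᵢ} X⟩` at `p`, with `τ₁, τ₂` an orthonormal basis of the
tangent plane `du_p(T_pM)`; it is the trace of `P ∘ DX`, with `P` the orthogonal projection to that
plane. -/
def surfaceDiv (u : M → Euc n) (X : Euc n → Euc n) (p : M) : ℝ :=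
  LinearMap.trace ℝ (Euc n)
    (((LinearMap.range (du u p).toLinearMap).starProjection ∘L fderiv ℝ X (u p) :
      Euc n →L[ℝ] Euc n) : Euc n →ₗ[ℝ] Euc n)

/-- The outward unit conormal `ν_M` at a boundary point `p` at which `u` is an immersion: the unit
vector tangent to the surface, normal to the boundary, pointing out of the surface. (At the
finitely many boundary branch points the value is irrelevant.) -/
def conormal (u : M → Euc n) (p : M) : Euc n :=
  let a := du u p (EuclideanSpace.single 0 1);
  let b := du u p (EuclideanSpace.single 1 1);
  let w := (Submodule.span ℝ {b})ᗮ.starProjection a;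
  (-‖w‖⁻¹) • w

/-- The length measure on `∂M`: one-dimensional Hausdorff measure on `Γ = u(∂M)`, transported to
`∂M` by `u`, which is one-to-one on `∂M`. -/
def boundaryLength [MeasurableSpace M] (u : M → Euc n) :
    Measure ((𝓡∂ 2).boundary M) :=
  (μH[1] : Measure (Euc n)).comap (fun p => u p)

/-- `u` has mean curvature vector `H`, an integrable normal field, and
`∫_M div_M X dA = ∫_M X · H dA + ∫_Γ X · ν_M ds` for every `C¹` vector field `X` on `ℝⁿ`. -/
structure DivergenceIdentity [MeasurableSpace M] (u : M → Euc n) (H : M → Euc n) : Prop where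
  integrable : Integrable H (area u)
  normal : ∀ᵐ p ∂(area u), ∀ v, ⟪du u p v, H p⟫ = 0
  identity : ∀ X : Euc n → Euc n, ContDiff ℝ 1 X →
    (∫ p, surfaceDiv u X p ∂(area u)) =
      (∫ p, ⟪X (u p), H p⟫ ∂(area u)) +
      (∫ p : (𝓡∂ 2).boundary M, ⟪X (u p), conormal u p⟫ ∂(boundaryLength u))

/-- `γ`, restricted to a period `[0,1]`, is a regular parametrization of a simple closed `C¹`
curve. -/
structure IsC1ClosedCurve (γ : ℝ → Euc n) : Prop where
  contDiff : ContDiff ℝ 1 γ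
  periodic : Function.Periodic γ 1
  deriv_ne_zero : ∀ t, deriv γ t ≠ 0
  injOn : InjOn γ (Ico 0 1)

/-- The total curvature of a closed `C¹` curve: the total variation of its unit tangent over one
period. (The unit tangent is continuous, so its variation is the same for chordal and for angular
distance.) -/
def totalCurvature (γ : ℝ → Euc n) : ℝ≥0∞ :=
  eVariationOn (fun t => ‖deriv γ t‖⁻¹ • deriv γ t) (Icc 0 1)

/-- The extrinsic diameter `r₀` of the surface. -/
def extrinsicDiam (u : M → Euc n) : ℝ := Metric.diam (range u)

/-- The constant `C(p)`. -/
def constC (p : ℝ≥0∞) : ℝ :=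
  if p = ⊤ then 1 else 2 * p.toReal / (p.toReal - 2) * (2 / Real.pi) ^ (1 / p.toReal)

/-- The exponent `α`. -/
def expAlpha (p : ℝ≥0∞) : ℝ :=
  if p = ⊤ then 1 else 1 - 2 / p.toReal

/-- The interior of the surface is embedded: `u` restricted to `M ∖ ∂M` is an immersion (so there
are no interior branch points) and a homeomorphism onto its image. -/
structure InteriorEmbedded (u : M → Euc n) : Prop where
  immersion : ∀ p ∈ (𝓡∂ 2).interior M, Function.Injective (du u p)
  embedding : IsEmbedding (fun p : (𝓡∂ 2).interior M => u p)

end BranchedSurface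

end

/-! Monotonicity at a fixed scale. Fix a centre `x` and a scale `s > 0`, and test the divergence
identity with the smoothed radial field (y - x)/(|y - x|² + s²). Its surface divergence is twice
`poissonDensity` plus a nonnegative term in the normal part of y - x. The mean curvature sees only
that normal part, so completing a square absorbs this term at the cost of |H|²/8. Hence twice the
Poisson mass is at most (1/8)∫|H|² plus a boundary flux (`two_mul_integral_poissonDensity_le`).

The flux density on Γ is at most `fluxSpeed`, which is at most `coneSpeed`, the speed of the
projection of Γ to the unit sphere around (x, -s) in one dimension more. That projection is no
longer than the total curvature of Γ (`integral_coneSpeed_le`), so the flux is at most the total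
curvature minus the integral of `coneDefect`. If `x` lies on Γ, the integral of `coneDefect` is at
least π in the limit s → 0 (`eventually_le_integral_coneDefect`).

From below, a blow-up and Fatou's lemma show that as s → 0 the Poisson mass centred at `u p`,
carried by any neighbourhood of `p`, is at least π if `p` is interior, 2π if `p` is an interior
branch point and π/2 if `p` is on the boundary (`exists_interior_density`, `boundary_density`).

Taking `s` equal to the diameter bounds the area. Hölder's inequality and the smallness of H then
give (1/8)∫|H|² < επ (`energy_lt`), so twice the Poisson mass stays below some W < 4π. An interior
branch point or two interior points with the same image would force 4π. An interior point mapped to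
Γ would force 3π, while the defect lowers the bound to W - π < 3π. So `u` is an injective immersion
on the interior whose image misses Γ, and compactness makes it an embedding (`interiorEmbedded`). -/

noncomputable section

namespace BranchedSurface

/-! ### Gram determinants, Jacobians and tangential projections. -/

section LinearAlgebra

variable {E F : Type*} [NormedAddCommGroup E] [InnerProductSpace ℝ E]
  [NormedAddCommGroup F] [InnerProductSpace ℝ F]

/-- The Gram determinant of two vectors. -/
def gram (a b : E) : ℝ := ‖a‖ ^ 2 * ‖b‖ ^ 2 - ⟪a, b⟫ ^ 2

lemma gram_nonneg (a b : E) : 0 ≤ gram a b := by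
  have h := abs_real_inner_le_norm a b
  have h2 : |⟪a, b⟫| ^ 2 ≤ (‖a‖ * ‖b‖) ^ 2 := by gcongr
  rw [sq_abs, mul_pow] at h2
  unfold gram; linarith

lemma gram_sub_smul (a b : E) (t : ℝ) : gram a (b - t • a) = gram a b := by
  unfold gram
  rw [norm_sub_sq_real, inner_sub_right, inner_smul_right, norm_smul, real_inner_smul_right,
    real_inner_self_eq_norm_sq, real_inner_comm a b, mul_pow, Real.norm_eq_abs, sq_abs]
  ring

lemma gram_le (a b : E) : gram a b ≤ ‖a‖ ^ 2 * ‖b‖ ^ 2 := by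
  unfold gram; nlinarith [sq_nonneg ⟪a, b⟫]

/-- Subtracting from `b` its component along `a` changes neither determinant. For the resulting
orthogonal pair the determinant is the product of the squared norms, which `B` does not increase. -/
lemma gram_map_le (B : E →L[ℝ] F) (hB : ∀ x, ‖B x‖ ≤ ‖x‖) (a b : E) :
    gram (B a) (B b) ≤ gram a b := by
  by_cases ha : a = 0
  · simp [ha, gram]
  have ha' : ‖a‖ ^ 2 ≠ 0 := by simpa using ha
  set t := ⟪a, b⟫ / ‖a‖ ^ 2 with ht
  have key : gram a (b - t • a) = ‖a‖ ^ 2 * ‖b - t • a‖ ^ 2 := by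
    unfold gram
    rw [inner_sub_right, real_inner_smul_right, real_inner_self_eq_norm_sq, ht,
      div_mul_cancel₀ _ ha']
    ring
  calc gram (B a) (B b) = gram (B a) (B (b - t • a)) := by
        rw [map_sub, map_smul, gram_sub_smul]
    _ ≤ ‖B a‖ ^ 2 * ‖B (b - t • a)‖ ^ 2 := gram_le _ _
    _ ≤ ‖a‖ ^ 2 * ‖b - t • a‖ ^ 2 := by gcongr <;> exact hB _
    _ = gram a b := by rw [← key, gram_sub_smul]

lemma det_adjoint_comp_self {n : ℕ} (A : Euc 2 →L[ℝ] Euc n) :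
    LinearMap.det ((ContinuousLinearMap.adjoint A ∘L A : Euc 2 →L[ℝ] Euc 2) :
      Euc 2 →ₗ[ℝ] Euc 2) =
    gram (A (EuclideanSpace.single 0 1)) (A (EuclideanSpace.single 1 1)) := by
  let b := EuclideanSpace.basisFun (Fin 2) ℝ
  rw [← LinearMap.det_toMatrix b.toBasis, Matrix.det_fin_two]
  have h : ∀ i j, LinearMap.toMatrix b.toBasis b.toBasis
      ((ContinuousLinearMap.adjoint A ∘L A : Euc 2 →L[ℝ] Euc 2) : Euc 2 →ₗ[ℝ] Euc 2) i j =
      ⟪A (EuclideanSpace.single i 1), A (EuclideanSpace.single j 1)⟫ := by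
    intro i j
    rw [LinearMap.toMatrix_apply]
    have : b.toBasis.repr ((ContinuousLinearMap.adjoint A ∘L A : Euc 2 →L[ℝ] Euc 2)
        (b.toBasis j)) i = ⟪b i, (ContinuousLinearMap.adjoint A ∘L A : Euc 2 →L[ℝ] Euc 2)
        (b.toBasis j)⟫ := by
      rw [← OrthonormalBasis.repr_apply_apply]; simp
    erw [this]
    simp [b, ContinuousLinearMap.adjoint_inner_right]
  rw [h, h, h, h]
  unfold gram
  rw [real_inner_self_eq_norm_sq, real_inner_self_eq_norm_sq,
    real_inner_comm (A (EuclideanSpace.single 0 1))]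
  ring

lemma jacobian_eq_sqrt_gram {n : ℕ} (A : Euc 2 →L[ℝ] Euc n) :
    jacobian A =
      Real.sqrt (gram (A (EuclideanSpace.single 0 1)) (A (EuclideanSpace.single 1 1))) := by
  rw [jacobian, det_adjoint_comp_self]

lemma det_adjoint_eq (B : Euc 2 →L[ℝ] Euc 2) :
    LinearMap.det (ContinuousLinearMap.adjoint B : Euc 2 →ₗ[ℝ] Euc 2) =
      LinearMap.det (B : Euc 2 →ₗ[ℝ] Euc 2) := by
  let b := EuclideanSpace.basisFun (Fin 2) ℝ
  rw [← LinearMap.det_toMatrix b.toBasis, ← LinearMap.det_toMatrix b.toBasis,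
    Matrix.det_fin_two, Matrix.det_fin_two]
  have h : ∀ (C : Euc 2 →L[ℝ] Euc 2) i j, LinearMap.toMatrix b.toBasis b.toBasis
      (C : Euc 2 →ₗ[ℝ] Euc 2) i j =
      ⟪b i, C (b j)⟫ := by
    intro C i j
    rw [LinearMap.toMatrix_apply]
    have : b.toBasis.repr (C (b.toBasis j)) i = ⟪b i, C (b.toBasis j)⟫ := by
      rw [← OrthonormalBasis.repr_apply_apply]; simp
    erw [this]
    simp
  simp only [h, ContinuousLinearMap.adjoint_inner_right]
  rw [real_inner_comm (b 0) , real_inner_comm (b 1), real_inner_comm (b 1), real_inner_comm (b 0)]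
  ring

lemma jacobian_comp {n : ℕ} (A : Euc 2 →L[ℝ] Euc n) (B : Euc 2 →L[ℝ] Euc 2) :
    jacobian (A ∘L B) = jacobian A * |B.det| := by
  unfold jacobian
  have h : ((ContinuousLinearMap.adjoint (A ∘L B) ∘L (A ∘L B) : Euc 2 →L[ℝ] Euc 2) :
      Euc 2 →ₗ[ℝ] Euc 2) = (ContinuousLinearMap.adjoint B : Euc 2 →ₗ[ℝ] Euc 2) ∘ₗ
      (((ContinuousLinearMap.adjoint A ∘L A : Euc 2 →L[ℝ] Euc 2) : Euc 2 →ₗ[ℝ] Euc 2) ∘ₗ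
        (B : Euc 2 →ₗ[ℝ] Euc 2)) := by
    rw [ContinuousLinearMap.adjoint_comp]; rfl
  rw [h, LinearMap.det_comp, LinearMap.det_comp, det_adjoint_eq, det_adjoint_comp_self]
  rw [show ∀ x y : ℝ, x * (y * x) = y * x ^ 2 by intros; ring, Real.sqrt_mul (gram_nonneg _ _),
    Real.sqrt_sq_eq_abs]

lemma jacobian_eq_abs_det (B : Euc 2 →L[ℝ] Euc 2) : jacobian B = |B.det| := by
  have h := jacobian_comp (ContinuousLinearMap.id ℝ (Euc 2)) B
  rw [ContinuousLinearMap.id_comp] at h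
  rw [h]
  have : jacobian (ContinuousLinearMap.id ℝ (Euc 2)) = 1 := by
    rw [jacobian_eq_sqrt_gram]; simp [gram, EuclideanSpace.inner_single_left]
  rw [this, one_mul]

lemma jacobian_ne_zero_iff {n : ℕ} (A : Euc 2 →L[ℝ] Euc n) :
    jacobian A ≠ 0 ↔ Function.Injective A := by
  have hker : Function.Injective A ↔ Function.Injective
      ((ContinuousLinearMap.adjoint A ∘L A : Euc 2 →L[ℝ] Euc 2) : Euc 2 →ₗ[ℝ] Euc 2) := by
    rw [injective_iff_map_eq_zero, injective_iff_map_eq_zero]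
    refine forall_congr' fun x => imp_congr_left ⟨fun h => by simp [h], fun h => ?_⟩
    have h2 : ⟪(ContinuousLinearMap.adjoint A ∘L A : Euc 2 →L[ℝ] Euc 2) x, x⟫ = 0 := by
      have : (ContinuousLinearMap.adjoint A ∘L A : Euc 2 →L[ℝ] Euc 2) x = 0 := h
      rw [this, inner_zero_left]
    rw [ContinuousLinearMap.comp_apply, ContinuousLinearMap.adjoint_inner_left] at h2
    exact inner_self_eq_zero.1 h2
  rw [hker, jacobian, Real.sqrt_ne_zero (by rw [det_adjoint_comp_self]; exact gram_nonneg _ _)]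
  constructor
  · intro h
    by_contra hc
    rw [← LinearMap.ker_eq_bot] at hc
    exact h (LinearMap.det_eq_zero_iff_ker_ne_bot.2 hc)
  · intro h hd
    exact LinearMap.det_eq_zero_iff_ker_ne_bot.1 hd (LinearMap.ker_eq_bot.2 h)

lemma gram_pos_of_injective {n : ℕ} {A : Euc 2 →L[ℝ] Euc n} (h : Function.Injective A) :
    0 < gram (A (EuclideanSpace.single 0 1)) (A (EuclideanSpace.single 1 1)) := by
  have := (jacobian_ne_zero_iff A).2 h
  rw [jacobian_eq_sqrt_gram] at this
  exact lt_of_le_of_ne (gram_nonneg _ _) fun hc => this (by rw [← hc, Real.sqrt_zero])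

/-- Bounds the area density from below at a branch point, where only the component of `u` in the
leading plane has a known derivative. -/
lemma abs_det_comp_le_jacobian {n : ℕ} (A : Euc 2 →L[ℝ] Euc n) (B : Euc n →L[ℝ] Euc 2)
    (hB : ∀ x, ‖B x‖ ≤ ‖x‖) : |(B ∘L A).det| ≤ jacobian A := by
  rw [← jacobian_eq_abs_det, jacobian_eq_sqrt_gram, jacobian_eq_sqrt_gram]
  exact Real.sqrt_le_sqrt (gram_map_le B hB _ _)

lemma euc_two_eq (v : Euc 2) :
    v = v 0 • EuclideanSpace.single 0 (1 : ℝ) + v 1 • EuclideanSpace.single 1 (1 : ℝ) := by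
  ext i; fin_cases i <;> simp

/-- The squared norm of the orthogonal projection of `v` to the span of `a` and `b`, if these are
linearly independent. -/
def projSq (a b v : E) : ℝ :=
  (⟪v, a⟫ ^ 2 * ‖b‖ ^ 2 - 2 * ⟪v, a⟫ * ⟪v, b⟫ * ⟪a, b⟫ + ⟪v, b⟫ ^ 2 * ‖a‖ ^ 2) / gram a b

/-- An explicit formula in the two columns of `A`, from which continuity of the tangential part can
be read off. -/
lemma norm_sq_starProjection_range {n : ℕ} {A : Euc 2 →L[ℝ] Euc n} (h : Function.Injective A)
    (v : Euc n) :
    ‖(LinearMap.range A.toLinearMap).starProjection v‖ ^ 2 =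
      projSq (A (EuclideanSpace.single 0 1)) (A (EuclideanSpace.single 1 1)) v := by
  have hg := gram_pos_of_injective h
  set a := A (EuclideanSpace.single 0 1) with ha
  set b := A (EuclideanSpace.single 1 1) with hb
  set V := LinearMap.range A.toLinearMap
  obtain ⟨w, hw⟩ : V.starProjection v ∈ V := Submodule.starProjection_apply_mem _ _
  have hw' : V.starProjection v = w 0 • a + w 1 • b := by
    rw [← hw]; conv_lhs => rw [euc_two_eq w]
    simp [ha, hb]
  have h1 : ∀ c ∈ V, ⟪v, c⟫ = ⟪V.starProjection v, c⟫ := by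
    intro c hc
    have := Submodule.starProjection_inner_eq_zero v c hc
    rw [inner_sub_left, sub_eq_zero] at this
    exact this
  have e1 := h1 a ⟨_, rfl⟩
  have e2 := h1 b ⟨_, rfl⟩
  unfold projSq
  rw [eq_div_iff hg.ne', e1, e2, hw']
  unfold gram
  rw [norm_add_sq_real, norm_smul, norm_smul, inner_add_left, inner_add_left]
  simp only [real_inner_smul_left, real_inner_smul_right, real_inner_self_eq_norm_sq, mul_pow,
    Real.norm_eq_abs, sq_abs, real_inner_comm a b]
  ring

lemma trace_starProjection_range {n : ℕ} {A : Euc 2 →L[ℝ] Euc n} (h : Function.Injective A) :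
    LinearMap.trace ℝ (Euc n)
      ((LinearMap.range A.toLinearMap).starProjection : Euc n →ₗ[ℝ] Euc n) = 2 := by
  set V := LinearMap.range A.toLinearMap
  have hp : LinearMap.IsProj V (V.starProjection : Euc n →ₗ[ℝ] Euc n) :=
    ⟨fun x => Submodule.starProjection_apply_mem _ _,
      fun x hx => Submodule.starProjection_eq_self_iff.2 hx⟩
  rw [hp.trace]
  have : Module.finrank ℝ V = Module.finrank ℝ (Euc 2) := LinearMap.finrank_range_of_inj h
  rw [this]; simp

end LinearAlgebra

/-! ### Length of a radial projection versus total curvature. -/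

section RadialProjection

variable {E : Type*} [NormedAddCommGroup E] [InnerProductSpace ℝ E]

/-- The unit tangent of a curve. -/
def unitTangent (γ : ℝ → E) (t : ℝ) : E := ‖deriv γ t‖⁻¹ • deriv γ t

lemma norm_unitTangent {γ : ℝ → E} {t : ℝ} (h : deriv γ t ≠ 0) : ‖unitTangent γ t‖ = 1 := by
  rw [unitTangent, norm_smul, norm_inv, norm_norm, inv_mul_cancel₀ (norm_ne_zero_iff.2 h)]

lemma continuous_unitTangent {γ : ℝ → E} (hγ : ContDiff ℝ 1 γ) (h : ∀ t, deriv γ t ≠ 0) :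
    Continuous (unitTangent γ) := by
  have hc : Continuous (deriv γ) := hγ.continuous_deriv le_rfl
  exact (hc.norm.inv₀ fun t => norm_ne_zero_iff.2 (h t)).smul hc

lemma sq_inner_le_of_unit {T v : E} (hT : ‖T‖ = 1) : ⟪T, v⟫ ^ 2 ≤ ‖v‖ ^ 2 := by
  have h := abs_real_inner_le_norm T v
  rw [hT, one_mul] at h
  rw [← sq_abs]; gcongr

/-- The speed of the radial projection, to the unit sphere of `E × ℝ` around `(x, -s)`, of a curve
in `E × 0` through `y` with unit tangent `T` and unit speed. -/
def coneSpeed (s : ℝ) (x y T : E) : ℝ :=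
  Real.sqrt (‖y - x‖ ^ 2 + s ^ 2 - ⟪T, y - x⟫ ^ 2) / (‖y - x‖ ^ 2 + s ^ 2)

/-- The cosine of the angle between `(T, 0)` and `(v, s)`. -/
def coneCos (s : ℝ) (T v : E) : ℝ := ⟪T, v⟫ / Real.sqrt (‖v‖ ^ 2 + s ^ 2)

/-- The triangle inequality for angles in E × ℝ with its L² inner product, applied to (T', 0), (T,
0) and (v, s). -/
lemma arccos_coneCos_le (s : ℝ) {T T' : E} (hT : ‖T‖ = 1) (hT' : ‖T'‖ = 1) (v : E) :
    Real.arccos (coneCos s T' v) ≤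
      Real.arccos (coneCos s T v) + InnerProductGeometry.angle T' T := by
  have h := InnerProductGeometry.angle_le_angle_add_angle
    (WithLp.toLp 2 (T', (0 : ℝ))) (WithLp.toLp 2 (T, (0 : ℝ))) (WithLp.toLp 2 (v, s))
  have hn : ∀ (w : E) (a : ℝ), ‖WithLp.toLp 2 (w, a)‖ = Real.sqrt (‖w‖ ^ 2 + a ^ 2) := by
    intro w a
    rw [← Real.sqrt_sq (norm_nonneg (WithLp.toLp 2 (w, a))), WithLp.prod_norm_sq_eq_of_L2]
    simp
  simp only [InnerProductGeometry.angle, hn, WithLp.prod_inner_apply, hT, hT'] at h ⊢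
  simp only [coneCos]
  simp at h ⊢
  linarith

/-- `totalCurvature` adds up chords, whereas the telescoping argument below adds up angles; for
small steps the two agree up to a factor close to 1. -/
lemma one_sub_mul_angle_le {η : ℝ} (hη : 0 < η) : ∃ δ > 0, ∀ T T' : E, ‖T‖ = 1 → ‖T'‖ = 1 →
    ‖T' - T‖ < δ → (1 - η) * InnerProductGeometry.angle T' T ≤ ‖T' - T‖ := by
  refine ⟨min (1 / 2) (η / 2), by positivity, fun T T' hT hT' hd => ?_⟩
  set θ := InnerProductGeometry.angle T' T with hθ
  have h0 : 0 ≤ θ := InnerProductGeometry.angle_nonneg _ _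
  have hpi : θ ≤ Real.pi := InnerProductGeometry.angle_le_pi _ _
  have hs : 0 ≤ Real.sin (θ / 2) :=
    Real.sin_nonneg_of_nonneg_of_le_pi (by linarith) (by linarith [Real.pi_pos])
  have hchord : ‖T' - T‖ = 2 * Real.sin (θ / 2) := by
    have h1 := InnerProductGeometry.norm_sub_sq_eq_norm_sq_add_norm_sq_sub_two_mul_norm_mul_norm_mul_cos_angle T' T
    rw [hT, hT', ← hθ, show θ = 2 * (θ / 2) by ring, Real.cos_two_mul] at h1
    have h2 := Real.sin_sq_add_cos_sq (θ / 2)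
    have h3 : ‖T' - T‖ ^ 2 = (2 * Real.sin (θ / 2)) ^ 2 := by nlinarith
    exact (sq_eq_sq₀ (norm_nonneg _) (by linarith)).1 h3
  rcases h0.eq_or_lt with h0 | h0
  · rw [← h0]; simp
  -- Jordan's inequality shows that a small chord means a small angle; the cubic lower bound for
  -- sine then gives the sharp factor.
  have hj := Real.mul_le_sin (x := θ / 2) (by linarith) (by linarith)
  have hcub := Real.sin_gt_sub_cube (x := θ / 2) (by linarith)
  have hd1 : ‖T' - T‖ < 1 / 2 := hd.trans_le (min_le_left _ _)
  have hd2 : ‖T' - T‖ < η / 2 := hd.trans_le (min_le_right _ _)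
  have hpi2 : (1 : ℝ) / 2 ≤ 2 / Real.pi := by
    rw [div_le_div_iff₀ (by norm_num) Real.pi_pos]; linarith [Real.pi_le_four]
  have hθ1 : θ / 2 ≤ ‖T' - T‖ := by
    nlinarith [mul_le_mul_of_nonneg_right hpi2 (show 0 ≤ θ / 2 by linarith)]
  have hθη : θ ≤ η := by linarith
  have hθ2 : θ ≤ 1 := by linarith
  have : θ ^ 3 ≤ η * θ := by nlinarith [mul_pos h0 h0]
  rw [hchord]
  nlinarith

/-- The derivative of the angle between `(T, 0)` and `(v, s)` when `v` moves with velocity `w`. -/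
def coneAngleDeriv (s : ℝ) (T v w : E) : ℝ :=
  -(⟪T, w⟫ * (‖v‖ ^ 2 + s ^ 2) - ⟪T, v⟫ * ⟪v, w⟫) /
    (Real.sqrt (‖v‖ ^ 2 + s ^ 2 - ⟪T, v⟫ ^ 2) * (‖v‖ ^ 2 + s ^ 2))

lemma hasDerivAt_arccos_coneCos {s : ℝ} (hs : 0 < s) {T : E} (hT : ‖T‖ = 1) {v : ℝ → E} {w : E}
    {t : ℝ} (hv : HasDerivAt v w t) :
    HasDerivAt (fun τ => Real.arccos (coneCos s T (v τ))) (coneAngleDeriv s T (v t) w) t := by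
  -- Since s > 0, the vector (v, s) is never parallel to (T, 0), so the cosine avoids ±1 and
  -- `arccos` is differentiable there.
  have hlt : ⟪T, v t⟫ ^ 2 < ‖v t‖ ^ 2 + s ^ 2 := by
    nlinarith [sq_inner_le_of_unit (v := v t) hT, sq_pos_of_pos hs]
  have hd : 0 < ‖v t‖ ^ 2 + s ^ 2 := by positivity
  have hD := Real.sqrt_pos.2 hd
  have hDsq := Real.sq_sqrt hd.le
  have hS : 0 < ‖v t‖ ^ 2 + s ^ 2 - ⟪T, v t⟫ ^ 2 := by linarith
  have hSs := Real.sqrt_pos.2 hS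
  have hc : 1 - coneCos s T (v t) ^ 2 =
      (‖v t‖ ^ 2 + s ^ 2 - ⟪T, v t⟫ ^ 2) / (‖v t‖ ^ 2 + s ^ 2) := by
    rw [coneCos, div_pow, hDsq]; field_simp
  have hc1 : coneCos s T (v t) ^ 2 < 1 := by
    have : 0 < 1 - coneCos s T (v t) ^ 2 := by rw [hc]; positivity
    linarith
  have h1 : coneCos s T (v t) ≠ -1 := by rintro h; rw [h] at hc1; norm_num at hc1
  have h2 : coneCos s T (v t) ≠ 1 := by rintro h; rw [h] at hc1; norm_num at hc1
  have hn : HasDerivAt (fun τ => ‖v τ‖ ^ 2 + s ^ 2) (2 * ⟪v t, w⟫) t := by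
    simpa using (hv.norm_sq).add_const (s ^ 2)
  have hi : HasDerivAt (fun τ => ⟪T, v τ⟫) ⟪T, w⟫ t := by
    simpa using (hasDerivAt_const t T).inner ℝ hv
  have hq := hi.div (hn.sqrt hd.ne') hD.ne'
  have hfin := (Real.hasDerivAt_arccos h1 h2).comp t hq
  refine hfin.congr_deriv ?_
  rw [hc, Real.sqrt_div hS.le, coneAngleDeriv]
  set D := Real.sqrt (‖v t‖ ^ 2 + s ^ 2)
  rw [← hDsq] at *
  field_simp

/-- When the point moves in the direction T, the vector (v, s) stays in the plane that it spans with
(T, 0). All of its rotation therefore goes into decreasing the angle. -/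
lemma coneAngleDeriv_unitTangent {γ : ℝ → E} {t s : ℝ} (hs : 0 < s) (h : deriv γ t ≠ 0) (x : E) :
    coneAngleDeriv s (unitTangent γ t) (γ t - x) (deriv γ t) =
      -(coneSpeed s x (γ t) (unitTangent γ t) * ‖deriv γ t‖) := by
  have hT := norm_unitTangent h
  set T := unitTangent γ t with hTdef
  have hd : deriv γ t = ‖deriv γ t‖ • T := by
    rw [hTdef, unitTangent, smul_smul, mul_inv_cancel₀ (norm_ne_zero_iff.2 h), one_smul]
  set v := γ t - x with hv
  have hS : 0 < ‖v‖ ^ 2 + s ^ 2 - ⟪T, v⟫ ^ 2 := by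
    nlinarith [sq_inner_le_of_unit (v := v) hT, sq_pos_of_pos hs]
  have hd' : 0 < ‖v‖ ^ 2 + s ^ 2 := by positivity
  have hSs := Real.sqrt_pos.2 hS
  have hSq := Real.sq_sqrt hS.le
  rw [coneAngleDeriv, coneSpeed, ← hv]
  have e1 : ⟪T, deriv γ t⟫ = ‖deriv γ t‖ := by
    rw [hd, real_inner_smul_right, real_inner_self_eq_norm_sq, norm_smul, norm_norm, hT]; ring
  have e2 : ⟪v, deriv γ t⟫ = ‖deriv γ t‖ * ⟪T, v⟫ := by
    conv_lhs => rw [hd]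
    rw [real_inner_smul_right, real_inner_comm]
  rw [e1, e2]
  set S := Real.sqrt (‖v‖ ^ 2 + s ^ 2 - ⟪T, v⟫ ^ 2)
  rw [div_mul_eq_mul_div, ← neg_div, div_eq_div_iff (by positivity) hd'.ne']
  linear_combination -(‖deriv γ t‖ * (‖v‖ ^ 2 + s ^ 2)) * hSq * (-1)

lemma continuous_coneSpeed_mul {γ : ℝ → E} (hγ : ContDiff ℝ 1 γ) (h : ∀ t, deriv γ t ≠ 0) {s : ℝ}
    (hs : 0 < s) (x : E) :
    Continuous fun t => coneSpeed s x (γ t) (unitTangent γ t) * ‖deriv γ t‖ := by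
  have h1 := continuous_unitTangent hγ h
  have h2 := hγ.continuous
  have h3 : Continuous (deriv γ) := hγ.continuous_deriv le_rfl
  unfold coneSpeed
  refine Continuous.mul (Continuous.div ?_ ?_ fun t => by positivity) h3.norm
  · exact Real.continuous_sqrt.comp (by fun_prop)
  · fun_prop

lemma continuous_coneAngleDeriv {γ : ℝ → E} (hγ : ContDiff ℝ 1 γ) (h : ∀ t, deriv γ t ≠ 0) {s : ℝ}
    (hs : 0 < s) (x : E) :
    Continuous fun z : ℝ × ℝ =>
      coneAngleDeriv s (unitTangent γ z.1) (γ z.2 - x) (deriv γ z.2) := by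
  have h1 := continuous_unitTangent hγ h
  have h2 := hγ.continuous
  have h3 : Continuous (deriv γ) := hγ.continuous_deriv le_rfl
  unfold coneAngleDeriv
  refine Continuous.div (by fun_prop) ?_ fun z => ?_
  · exact (Real.continuous_sqrt.comp (by fun_prop)).mul (by fun_prop)
  · have hS : 0 < ‖γ z.2 - x‖ ^ 2 + s ^ 2 - ⟪unitTangent γ z.1, γ z.2 - x⟫ ^ 2 := by
      nlinarith [sq_inner_le_of_unit (v := γ z.2 - x) (norm_unitTangent (h z.1)),
        sq_pos_of_pos hs]
    have := Real.sqrt_pos.2 hS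
    positivity

/-- The length of the radial projection of a closed curve, from a point off the hyperplane
containing it, is at most its total curvature. -/
theorem integral_coneSpeed_le {γ : ℝ → E} (hγ : ContDiff ℝ 1 γ) (h : ∀ t, deriv γ t ≠ 0)
    (hper : Function.Periodic γ 1) {V : ℝ}
    (hV : ∀ N : ℕ, 0 < N → ∑ i ∈ Finset.range N,
      ‖unitTangent γ ((i + 1 : ℕ) / N) - unitTangent γ (i / N)‖ ≤ V)
    {s : ℝ} (hs : 0 < s) (x : E) :
    ∫ t in (0 : ℝ)..1, coneSpeed s x (γ t) (unitTangent γ t) * ‖deriv γ t‖ ≤ V := by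
  set K : ℝ → ℝ := fun t => coneSpeed s x (γ t) (unitTangent γ t) * ‖deriv γ t‖ with hK
  have hKc : Continuous K := continuous_coneSpeed_mul hγ h hs x
  set k : ℝ × ℝ → ℝ := fun z =>
    coneAngleDeriv s (unitTangent γ z.1) (γ z.2 - x) (deriv γ z.2) with hk
  have hkc : Continuous k := continuous_coneAngleDeriv hγ h hs x
  set θ : ℝ → ℝ := fun t => Real.arccos (coneCos s (unitTangent γ t) (γ t - x)) with hθ
  have hderivper : ∀ t, deriv γ (t + 1) = deriv γ t := by
    intro t
    rw [← deriv_comp_add_const]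
    congr 1
    funext y; exact hper y
  have hθper : θ 1 = θ 0 := by
    have h1 := hper 0
    have h2 := hderivper 0
    rw [zero_add] at h1 h2
    simp only [hθ, unitTangent, h1, h2]
  -- On a short step, with the tangent frozen at the left end, θ drops by nearly the projected
  -- length. Passing to the next tangent raises θ by at most the turning angle. Over a period the
  -- changes of θ cancel, so the projected length is at most the total turning, up to η.
  have main : ∀ η : ℝ, 0 < η → η < 1 → (1 - η) * ((∫ t in (0 : ℝ)..1, K t) - η) ≤ V := by
    intro η hη hη1
    obtain ⟨δ₁, hδ₁, hang⟩ := one_sub_mul_angle_le (E := E) hη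
    have huT := (isCompact_Icc (a := (0 : ℝ)) (b := 1)).uniformContinuousOn_of_continuous
      (continuous_unitTangent hγ h).continuousOn
    obtain ⟨δ₂, hδ₂, hT⟩ := Metric.uniformContinuousOn_iff.1 huT δ₁ hδ₁
    have huk := ((isCompact_Icc (a := (0 : ℝ)) (b := 1)).prod
      (isCompact_Icc (a := (0 : ℝ)) (b := 1))).uniformContinuousOn_of_continuous hkc.continuousOn
    obtain ⟨δ₃, hδ₃, hkk⟩ := Metric.uniformContinuousOn_iff.1 huk η hη
    obtain ⟨N, hN⟩ := exists_nat_one_div_lt (lt_min hδ₂ hδ₃)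
    set M := N + 1 with hM
    have hM0 : (0 : ℝ) < M := by rw [hM]; positivity
    have hMlt : (1 : ℝ) / M < min δ₂ δ₃ := by rw [hM]; push_cast; exact hN
    have hstep : ∀ i : ℕ, ((i + 1 : ℕ) : ℝ) / M - i / M = 1 / M := by
      intro i; push_cast; ring
    have hmem : ∀ i : ℕ, i ≤ M → (i : ℝ) / M ∈ Icc (0 : ℝ) 1 := by
      intro i hi
      exact ⟨by positivity, (div_le_one hM0).2 (by exact_mod_cast hi)⟩
    have hone : ∀ i ∈ Finset.range M, (1 - η) * (∫ t in ((i : ℝ) / M)..((i + 1 : ℕ) / M), K t) ≤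
        (1 - η) * (θ (i / M) - θ ((i + 1 : ℕ) / M)) +
        ‖unitTangent γ ((i + 1 : ℕ) / M) - unitTangent γ (i / M)‖ + (1 - η) * (η * (1 / M)) := by
      intro i hi
      have hi' := Finset.mem_range.1 hi
      set a : ℝ := (i : ℝ) / M
      set b : ℝ := ((i + 1 : ℕ) : ℝ) / M
      have hab : b - a = 1 / M := hstep i
      have ha : a ∈ Icc (0 : ℝ) 1 := hmem i hi'.le
      have hb : b ∈ Icc (0 : ℝ) 1 := hmem (i + 1) hi'
      have hM1 : 0 < (1 : ℝ) / M := by positivity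
      have hle : a ≤ b := by linarith
      have hka : Continuous fun t : ℝ => k (a, t) := hkc.comp (by fun_prop)
      have hKn : Continuous fun t => -K t := hKc.neg
      have hftc : ∫ t in a..b, k (a, t) =
          Real.arccos (coneCos s (unitTangent γ a) (γ b - x)) - θ a := by
        refine intervalIntegral.integral_eq_sub_of_hasDerivAt (f := fun t =>
          Real.arccos (coneCos s (unitTangent γ a) (γ t - x))) (fun t _ => ?_)
          (hka.intervalIntegrable _ _)
        exact hasDerivAt_arccos_coneCos hs (norm_unitTangent (h a))
          (((hγ.differentiable one_ne_zero).differentiableAt.hasDerivAt).sub_const x)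
      have hint : ∫ t in a..b, k (a, t) ≤ ∫ t in a..b, (-K t + η) := by
        refine intervalIntegral.integral_mono_on hle
          (hka.intervalIntegrable _ _)
          ((hKn.add continuous_const).intervalIntegrable _ _) fun t ht => ?_
        have htI : t ∈ Icc (0 : ℝ) 1 := ⟨ha.1.trans ht.1, ht.2.trans hb.2⟩
        have hd : dist ((a, t) : ℝ × ℝ) (t, t) < δ₃ := by
          rw [Prod.dist_eq, dist_self, max_eq_left dist_nonneg, Real.dist_eq, abs_sub_comm,
            abs_of_nonneg (by linarith [ht.1])]
          exact lt_of_le_of_lt (by linarith [ht.2]) (hMlt.trans_le (min_le_right _ _))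
        have := hkk (a, t) ⟨ha, htI⟩ (t, t) ⟨htI, htI⟩ hd
        rw [Real.dist_eq] at this
        have hkd : k (t, t) = -K t := coneAngleDeriv_unitTangent hs (h t) x
        rw [hkd] at this
        linarith [le_abs_self (k (a, t) - -K t)]
      rw [intervalIntegral.integral_add (hKn.intervalIntegrable _ _)
        (continuous_const.intervalIntegrable _ _), intervalIntegral.integral_neg,
        intervalIntegral.integral_const, hab, smul_eq_mul] at hint
      have hF := arccos_coneCos_le s (norm_unitTangent (h a)) (norm_unitTangent (h b)) (γ b - x)
      have hclose : ‖unitTangent γ b - unitTangent γ a‖ < δ₁ := by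
        rw [← dist_eq_norm]
        refine hT b hb a ha ?_
        rw [Real.dist_eq, hab, abs_of_pos hM1]
        exact hMlt.trans_le (min_le_left _ _)
      have hA := hang _ _ (norm_unitTangent (h a)) (norm_unitTangent (h b)) hclose
      have hθb : θ b = Real.arccos (coneCos s (unitTangent γ b) (γ b - x)) := rfl
      have : ∫ t in a..b, K t ≤ θ a - θ b +
          InnerProductGeometry.angle (unitTangent γ b) (unitTangent γ a) + η * (1 / M) := by
        linarith
      nlinarith [mul_le_mul_of_nonneg_left this (show 0 ≤ 1 - η by linarith)]
    have hsum := Finset.sum_le_sum hone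
    rw [← Finset.mul_sum, Finset.sum_add_distrib, Finset.sum_add_distrib, ← Finset.mul_sum,
      Finset.sum_range_sub' (fun i : ℕ => θ ((i : ℝ) / M)),
      intervalIntegral.sum_integral_adjacent_intervals (a := fun i : ℕ => (i : ℝ) / M)
        (fun i _ => hKc.intervalIntegrable _ _), Finset.sum_const, Finset.card_range] at hsum
    simp only [Nat.cast_zero, zero_div, div_self hM0.ne', hθper, sub_self, mul_zero, zero_add,
      nsmul_eq_mul] at hsum
    have hVM := hV M (by omega)
    have e : (M : ℝ) * ((1 - η) * (η * (1 / M))) = (1 - η) * η := by field_simp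
    rw [e] at hsum
    linarith
  have hlim : Filter.Tendsto (fun η : ℝ => (1 - η) * ((∫ t in (0 : ℝ)..1, K t) - η)) (𝓝[>] 0)
      (𝓝 ((1 - 0) * ((∫ t in (0 : ℝ)..1, K t) - 0))) := by
    apply tendsto_nhdsWithin_of_tendsto_nhds
    apply Continuous.tendsto (by fun_prop)
  rw [sub_zero, one_mul, sub_zero] at hlim
  refine le_of_tendsto hlim ?_
  filter_upwards [Ioo_mem_nhdsGT (show (0 : ℝ) < 1 by norm_num)] with η hη
  exact main η hη.1 hη.2

end RadialProjection

lemma sum_norm_unitTangent_sub_le {n : ℕ} {γ : ℝ → Euc n} {V : ℝ} (hV0 : 0 ≤ V)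
    (hV : totalCurvature γ ≤ ENNReal.ofReal V) (N : ℕ) (hN : 0 < N) :
    ∑ i ∈ Finset.range N, ‖unitTangent γ ((i + 1 : ℕ) / N) - unitTangent γ (i / N)‖ ≤ V := by
  have hN0 : (0 : ℝ) < N := by exact_mod_cast hN
  have h := eVariationOn.sum_le_of_monotoneOn_Iic (f := unitTangent γ) (s := Icc (0 : ℝ) 1) (n := N)
    (u := fun i : ℕ => (i : ℝ) / N)
    (fun i _ j _ hij => by
      have : (i : ℝ) ≤ j := by exact_mod_cast hij
      exact div_le_div_of_nonneg_right this hN0.le)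
    (fun i hi => ⟨by positivity, (div_le_one hN0).2 (by exact_mod_cast hi)⟩)
  have h2 := h.trans hV
  simp_rw [edist_eq_enorm_sub, ← ofReal_norm] at h2
  rw [← ENNReal.ofReal_sum_of_nonneg (fun i _ => norm_nonneg _)] at h2
  exact (ENNReal.ofReal_le_ofReal_iff hV0).1 h2

/-! ### Change of scale and Fatou's lemma. -/

section Rescaling

variable {E : Type*} [NormedAddCommGroup E] [NormedSpace ℝ E] [MeasurableSpace E] [BorelSpace E]
  [FiniteDimensional ℝ E]

lemma lintegral_eq_mul_lintegral_rescale (μ : Measure E) [μ.IsAddHaarMeasure] (f : E → ℝ≥0∞)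
    (y₀ : E) {c : ℝ} (hc : 0 < c) :
    ∫⁻ y, f y ∂μ = ENNReal.ofReal (c ^ Module.finrank ℝ E) * ∫⁻ w, f (y₀ + c • w) ∂μ := by
  have h1 := (measurableEmbedding_const_smul₀ (α := E) hc.ne').lintegral_map (μ := μ)
    (fun y => f (y₀ + y))
  rw [Measure.map_addHaar_smul μ hc.ne', lintegral_smul_measure, lintegral_add_left_eq_self,
    abs_of_pos (by positivity)] at h1
  rw [← h1, smul_eq_mul, ← mul_assoc, ← ENNReal.ofReal_mul (by positivity),
    mul_inv_cancel₀ (by positivity), ENNReal.ofReal_one, one_mul]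

/-- Fatou's lemma for integrands concentrating at a point. -/
lemma lintegral_le_liminf_of_rescaled (μ : Measure E) [μ.IsAddHaarMeasure] (y₀ : E)
    {f : ℝ → E → ℝ≥0∞} (hf : ∀ s, Measurable (f s)) {c : ℝ → ℝ} (hc : ∀ s, 0 < s → 0 < c s)
    {G : E → ℝ≥0∞} (hG : ∀ᵐ w ∂μ, G w ≤ Filter.liminf (fun s =>
      ENNReal.ofReal (c s ^ Module.finrank ℝ E) * f s (y₀ + c s • w)) (𝓝[>] (0 : ℝ))) :
    ∫⁻ w, G w ∂μ ≤ Filter.liminf (fun s => ∫⁻ y, f s y ∂μ) (𝓝[>] (0 : ℝ)) := by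
  refine (lintegral_mono_ae hG).trans ((lintegral_liminf_le fun s => ?_).trans ?_)
  · exact ((hf s).comp (by fun_prop)).const_mul _
  · refine Filter.liminf_le_liminf ?_
    filter_upwards [self_mem_nhdsWithin] with s hs
    rw [lintegral_eq_mul_lintegral_rescale μ (f s) y₀ (hc s hs), lintegral_const_mul]
    exact (hf s).comp (by fun_prop)

end Rescaling

/-! ### Length and tangent lines of a simple closed C¹ curve. -/

section ClosedCurve

variable {n : ℕ} {γ : ℝ → Euc n}

lemma deriv_periodic {γ : ℝ → Euc n} (h : Function.Periodic γ 1) :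
    Function.Periodic (deriv γ) 1 := by
  intro t
  rw [← deriv_comp_add_const]
  congr 1
  funext y; exact h y

lemma unitTangent_periodic {γ : ℝ → Euc n} (h : Function.Periodic γ 1) :
    Function.Periodic (unitTangent γ) 1 := by
  intro t
  rw [unitTangent, deriv_periodic h, ← unitTangent]

lemma IsC1ClosedCurve.continuous_deriv (hγ : IsC1ClosedCurve γ) : Continuous (deriv γ) :=
  hγ.contDiff.continuous_deriv le_rfl

lemma IsC1ClosedCurve.hasDerivAt (hγ : IsC1ClosedCurve γ) (t : ℝ) :
    HasDerivAt γ (deriv γ t) t :=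
  (hγ.contDiff.differentiable one_ne_zero).differentiableAt.hasDerivAt

/-- On a short parameter interval γ is Lipschitz with a constant close to its speed there; add over
a fine partition. This inequality is enough, since boundary integrals are only bounded from above.
-/
lemma IsC1ClosedCurve.hausdorffMeasure_image_le (hγ : IsC1ClosedCurve γ) {S : Set ℝ}
    (hS : S ⊆ Ico 0 1) (hSm : MeasurableSet S) :
    μH[1] (γ '' S) ≤ ∫⁻ t in S, ‖deriv γ t‖ₑ := by
  have hstep : ∀ η : ℝ, 0 < η → μH[1] (γ '' S) ≤
      ∫⁻ t in S, (‖deriv γ t‖ₑ + ENNReal.ofReal (2 * η)) := by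
    intro η hη
    have hu := (isCompact_Icc (a := (0 : ℝ)) (b := 1)).uniformContinuousOn_of_continuous
      hγ.continuous_deriv.continuousOn
    obtain ⟨δ, hδ, hd⟩ := Metric.uniformContinuousOn_iff.1 hu η hη
    obtain ⟨N, hN⟩ := exists_nat_one_div_lt hδ
    set M := N + 1 with hM
    have hM0 : (0 : ℝ) < M := by rw [hM]; positivity
    have hMlt : (1 : ℝ) / M < δ := by rw [hM]; push_cast; exact hN
    set I : ℕ → Set ℝ := fun i => S ∩ {t | ⌊(M : ℝ) * t⌋₊ = i} with hI
    have hIm : ∀ i, MeasurableSet (I i) := fun i =>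
      hSm.inter ((Nat.measurable_floor.comp (measurable_const_mul _)) (measurableSet_singleton i))
    have hcover : S = ⋃ i ∈ Finset.range M, I i := by
      ext t
      simp only [hI, mem_iUnion, mem_inter_iff, mem_ofPred_eq, Finset.mem_range, exists_prop]
      refine ⟨fun ht => ⟨⌊(M : ℝ) * t⌋₊, ?_, ht, rfl⟩, fun ⟨_, _, ht, _⟩ => ht⟩
      rw [Nat.floor_lt (mul_nonneg hM0.le (hS ht).1)]
      nlinarith [(hS ht).2]
    have hdisj : (↑(Finset.range M) : Set ℕ).PairwiseDisjoint I := by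
      intro i _ j _ hij
      refine Set.disjoint_left.2 fun t hti htj => hij ?_
      rw [← hti.2, ← htj.2]
    rw [hcover, image_iUnion₂, lintegral_biUnion_finset hdisj fun i _ => hIm i]
    refine (measure_biUnion_finset_le _ _).trans (Finset.sum_le_sum fun i hi => ?_)
    have hsub : ∀ t ∈ I i, t ∈ Icc (0 : ℝ) 1 ∧ (i : ℝ) / M ≤ t ∧ t < (i + 1) / M := by
      intro t ht
      have h0 := hS ht.1
      have h1 := (Nat.floor_eq_iff (mul_nonneg hM0.le h0.1)).1 ht.2
      refine ⟨⟨h0.1, h0.2.le⟩, ?_, ?_⟩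
      · rw [div_le_iff₀ hM0]; linarith [h1.1]
      · rw [lt_div_iff₀ hM0]; linarith [h1.2]
    set a : ℝ := (i : ℝ) / M with ha
    have haI : a ∈ Icc (0 : ℝ) 1 :=
      ⟨by positivity, (div_le_one hM0).2 (by exact_mod_cast (Finset.mem_range.1 hi).le)⟩
    set J : Set ℝ := Icc (0 : ℝ) 1 ∩ Ico a ((i + 1) / M)
    have hIJ : I i ⊆ J := fun t ht => ⟨(hsub t ht).1, (hsub t ht).2⟩
    have hJd : ∀ t ∈ J, ‖deriv γ t - deriv γ a‖ < η := by
      intro t ht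
      rw [← dist_eq_norm]
      refine hd t ht.1 a haI ?_
      rw [Real.dist_eq, abs_of_nonneg (by linarith [ht.2.1])]
      have h2 := ht.2.2
      have : ((i : ℝ) + 1) / M = a + 1 / M := by rw [ha]; ring
      linarith
    have hlip : LipschitzOnWith (‖deriv γ a‖₊ + ⟨η, hη.le⟩) γ J := by
      refine Convex.lipschitzOnWith_of_nnnorm_deriv_le
        (fun t _ => (hγ.hasDerivAt t).differentiableAt) (fun t ht => ?_)
        ((convex_Icc _ _).inter (convex_Ico _ _))
      rw [← NNReal.coe_le_coe]
      push_cast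
      have := norm_sub_norm_le (deriv γ t) (deriv γ a)
      have := hJd t ht
      show ‖deriv γ t‖ ≤ ‖deriv γ a‖ + η
      linarith
    have h1 := (hlip.mono hIJ).hausdorffMeasure_image_le (d := 1) zero_le_one
    rw [hausdorffMeasure_real, ENNReal.rpow_one] at h1
    refine h1.trans ?_
    rw [← setLIntegral_const]
    refine setLIntegral_mono' (hIm i) fun t ht => ?_
    have h2 := hJd t (hIJ ht)
    have h3 := norm_sub_norm_le (deriv γ a) (deriv γ t)
    rw [norm_sub_rev] at h3
    rw [← ofReal_norm, ← ENNReal.ofReal_add (norm_nonneg _) (by linarith),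
      ← ENNReal.ofReal_coe_nnreal]
    refine ENNReal.ofReal_le_ofReal ?_
    show ‖deriv γ a‖ + η ≤ _
    linarith
  have hvol : volume S ≤ 1 := (measure_mono hS).trans (by simp)
  have hlim : Filter.Tendsto (fun η : ℝ => ∫⁻ t in S, ‖deriv γ t‖ₑ + ENNReal.ofReal (2 * η))
      (𝓝[>] 0) (𝓝 (∫⁻ t in S, ‖deriv γ t‖ₑ)) := by
    have : ∀ η : ℝ, ∫⁻ t in S, (‖deriv γ t‖ₑ + ENNReal.ofReal (2 * η)) =
        (∫⁻ t in S, ‖deriv γ t‖ₑ) + ENNReal.ofReal (2 * η) * volume S := by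
      intro η
      rw [lintegral_add_right _ measurable_const, setLIntegral_const]
    simp_rw [this]
    have h0 : Filter.Tendsto (fun η : ℝ => ENNReal.ofReal (2 * η)) (𝓝[>] 0) (𝓝 0) := by
      have : Filter.Tendsto (fun η : ℝ => ENNReal.ofReal (2 * η)) (𝓝 0)
          (𝓝 (ENNReal.ofReal (2 * 0))) :=
        (ENNReal.continuous_ofReal.comp (continuous_const.mul continuous_id)).tendsto _
      rw [mul_zero, ENNReal.ofReal_zero] at this
      exact this.mono_left nhdsWithin_le_nhds
    have h1 := ENNReal.Tendsto.mul_const (b := volume S) h0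
      (Or.inr (ne_top_of_le_ne_top ENNReal.one_ne_top hvol))
    simpa using h1.const_add (∫⁻ t in S, ‖deriv γ t‖ₑ)
  refine ge_of_tendsto hlim ?_
  filter_upwards [self_mem_nhdsWithin] with η hη
  exact hstep η hη

lemma IsC1ClosedCurve.exists_mem_Ico (hγ : IsC1ClosedCurve γ) {y : Euc n} (hy : y ∈ range γ) :
    ∃ t ∈ Ico (0 : ℝ) 1, γ t = y := by
  obtain ⟨τ, rfl⟩ := hy
  obtain ⟨t, ht, h⟩ := hγ.periodic.exists_mem_Ico₀ one_pos τ
  exact ⟨t, ht, h.symm⟩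

/-- No measurability of `g` is assumed: every step is an inequality that holds without it. The `g`
of `integral_conormal_le` is a supremum over parameters. -/
lemma IsC1ClosedCurve.lintegral_range_le (hγ : IsC1ClosedCurve γ) (g : Euc n → ℝ≥0∞) :
    ∫⁻ y in range γ, g y ∂μH[1] ≤ ∫⁻ t in Ico (0 : ℝ) 1, ‖deriv γ t‖ₑ * g (γ t) := by
  have hγm : Measurable γ := hγ.contDiff.continuous.measurable
  set ρ : Measure ℝ := (volume.restrict (Ico (0 : ℝ) 1)).withDensity fun t => ‖deriv γ t‖ₑ
  have hle : (μH[1] : Measure (Euc n)).restrict (range γ) ≤ ρ.map γ := by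
    refine Measure.le_iff.2 fun A hA => ?_
    have hsub : A ∩ range γ ⊆ γ '' (γ ⁻¹' A ∩ Ico 0 1) := by
      rintro y ⟨hyA, hy⟩
      obtain ⟨t, ht, rfl⟩ := hγ.exists_mem_Ico hy
      exact ⟨t, ⟨hyA, ht⟩, rfl⟩
    rw [Measure.restrict_apply hA, Measure.map_apply hγm hA, withDensity_apply _ (hγm hA),
      Measure.restrict_restrict (hγm hA)]
    exact (measure_mono hsub).trans (hγ.hausdorffMeasure_image_le inter_subset_right
      ((hγm hA).inter measurableSet_Ico))
  refine (lintegral_mono' hle le_rfl).trans ((lintegral_map_le g γ).trans ?_)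
  exact lintegral_withDensity_le_lintegral_mul _ hγ.continuous_deriv.measurable.enorm _

/-- The component of `v` orthogonal to the unit vector `T`. -/
def rejection (T v : Euc n) : Euc n := v - ⟪T, v⟫ • T

lemma norm_rejection_sq {T v : Euc n} (hT : ‖T‖ = 1) :
    ‖rejection T v‖ ^ 2 = ‖v‖ ^ 2 - ⟪T, v⟫ ^ 2 := by
  rw [rejection, norm_sub_sq_real, real_inner_smul_right, norm_smul, hT, real_inner_comm,
    mul_one, Real.norm_eq_abs, sq_abs]
  ring

lemma norm_rejection {T v : Euc n} (hT : ‖T‖ = 1) :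
    ‖rejection T v‖ = Real.sqrt (‖v‖ ^ 2 - ⟪T, v⟫ ^ 2) := by
  rw [← norm_rejection_sq hT, Real.sqrt_sq (norm_nonneg _)]

lemma norm_rejection_le {T v : Euc n} (hT : ‖T‖ = 1) : ‖rejection T v‖ ≤ ‖v‖ := by
  have := norm_rejection_sq (v := v) hT
  nlinarith [sq_nonneg ⟪T, v⟫, norm_nonneg v, norm_nonneg (rejection T v)]

lemma rejection_add (T v w : Euc n) : rejection T (v + w) = rejection T v + rejection T w := by
  simp only [rejection, inner_add_right, add_smul]; abel

lemma rejection_smul (T v : Euc n) (c : ℝ) : rejection T (c • v) = c • rejection T v := by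
  simp only [rejection, real_inner_smul_right, smul_sub, smul_smul]

lemma rejection_unitTangent_deriv {t : ℝ} (h : deriv γ t ≠ 0) :
    rejection (unitTangent γ t) (deriv γ t) = 0 := by
  have hd : deriv γ t = ‖deriv γ t‖ • unitTangent γ t := by
    rw [unitTangent, smul_smul, mul_inv_cancel₀ (norm_ne_zero_iff.2 h), one_smul]
  have hT := norm_unitTangent h
  rw [hd, rejection_smul]
  simp [rejection, hT]

/-- `injOn` is tied to the period [0, 1); integer shifts move it to a window centred at `t₀`. -/
lemma IsC1ClosedCurve.eq_of_mem_Icc (hγ : IsC1ClosedCurve γ) {t₀ t : ℝ} (h : |t - t₀| ≤ 1 / 2)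
    (he : γ t = γ t₀) : t = t₀ := by
  have key : ∀ a b : ℝ, a ∈ Ico (0 : ℝ) 1 → |b - a| ≤ 1 / 2 → γ b = γ a → b = a := by
    intro a b ha hb hab
    rw [abs_le] at hb
    rcases lt_or_ge b 0 with h0 | h0
    · have := hγ.injOn (x₁ := b + 1) (x₂ := a) ⟨by linarith [ha.1], by linarith⟩ ha
        (by rw [hγ.periodic, hab])
      linarith
    rcases lt_or_ge b 1 with h1 | h1
    · exact hγ.injOn ⟨h0, h1⟩ ha hab
    · have := hγ.injOn (x₁ := b - 1) (x₂ := a) ⟨by linarith, by linarith [ha.2]⟩ ha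
        (by rw [hγ.periodic.sub_eq, hab])
      linarith
  have hfl := key (Int.fract t₀) (t - ⌊t₀⌋) ⟨Int.fract_nonneg _, Int.fract_lt_one _⟩
    (by rw [Int.fract, show t - ⌊t₀⌋ - (t₀ - ⌊t₀⌋) = t - t₀ by ring]; exact h)
    (by
      have hp : ∀ x : ℝ, γ (x - ⌊t₀⌋) = γ x := fun x => by
        simpa using hγ.periodic.sub_int_mul_eq (x := x) ⌊t₀⌋
      rw [Int.fract, hp, hp, he])
  rw [Int.fract] at hfl; linarith

/-- A simple closed `C¹` curve is tangent to its tangent line. -/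
lemma IsC1ClosedCurve.norm_rejection_sub_le (hγ : IsC1ClosedCurve γ) (t₀ : ℝ) {η : ℝ}
    (hη : 0 < η) : ∃ r > 0, ∀ y ∈ range γ, ‖y - γ t₀‖ < r →
      ‖rejection (unitTangent γ t₀) (y - γ t₀)‖ ≤ η * ‖y - γ t₀‖ := by
  set T := unitTangent γ t₀
  set v := deriv γ t₀ with hv
  have hv0 : 0 < ‖v‖ := norm_pos_iff.2 (hγ.deriv_ne_zero t₀)
  have hT : ‖T‖ = 1 := norm_unitTangent (hγ.deriv_ne_zero t₀)
  have ho := (hasDerivAt_iff_isLittleO.1 (hγ.hasDerivAt t₀)).def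
    (c := min (‖v‖ / 2) (η * (‖v‖ / 2))) (by positivity)
  obtain ⟨ρ, hρ, hρo⟩ := Metric.eventually_nhds_iff.1 ho
  -- By simplicity and compactness, parameters of this period that are not close to `t₀` give points
  -- at a positive distance from `γ t₀`. A nearby point of the curve thus has a nearby parameter,
  -- where the derivative estimate applies.
  set Kc : Set ℝ := Icc (t₀ - 1 / 2) (t₀ + 1 / 2) ∩ {t | ρ ≤ |t - t₀|}
  have hKc : IsCompact Kc := isCompact_Icc.inter_right (isClosed_le continuous_const (by fun_prop))
  have hpos : ∃ r > 0, ∀ t ∈ Kc, r ≤ ‖γ t - γ t₀‖ := by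
    rcases Kc.eq_empty_or_nonempty with he | hne
    · exact ⟨1, one_pos, by simp [he]⟩
    · obtain ⟨t₁, ht₁, hmin⟩ := hKc.exists_isMinOn hne
        (f := fun t => ‖γ t - γ t₀‖) (by
          have := hγ.contDiff.continuous
          fun_prop)
      refine ⟨‖γ t₁ - γ t₀‖, norm_pos_iff.2 (sub_ne_zero.2 fun he => ?_), fun t ht => hmin ht⟩
      have h1 := hγ.eq_of_mem_Icc (t₀ := t₀) (t := t₁)
        (abs_le.2 ⟨by linarith [ht₁.1.1], by linarith [ht₁.1.2]⟩) he
      have h2 : ρ ≤ |t₁ - t₀| := ht₁.2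
      rw [h1, sub_self, abs_zero] at h2
      linarith
  obtain ⟨r, hr, hrmin⟩ := hpos
  refine ⟨r, hr, fun y hy hyr => ?_⟩
  obtain ⟨τ, rfl⟩ := hy
  obtain ⟨t, ht, hτt⟩ := hγ.periodic.exists_mem_Ico one_pos τ (t₀ - 1 / 2)
  rw [hτt] at hyr ⊢
  have htρ : |t - t₀| < ρ := by
    by_contra hc
    have := hrmin t ⟨⟨ht.1, by linarith [ht.2]⟩, not_lt.1 hc⟩
    linarith
  have h1 := hρo (y := t) htρ
  set w := γ t - γ t₀ - (t - t₀) • v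
  have hw : γ t - γ t₀ = (t - t₀) • v + w := by simp [w]
  have hrej : rejection T (γ t - γ t₀) = rejection T w := by
    rw [hw, rejection_add, rejection_smul, hv, rejection_unitTangent_deriv (hγ.deriv_ne_zero t₀),
      smul_zero, zero_add]
  rw [Real.norm_eq_abs] at h1
  have h2 : ‖w‖ ≤ ‖v‖ / 2 * |t - t₀| :=
    h1.trans (mul_le_mul_of_nonneg_right (min_le_left _ _) (abs_nonneg _))
  have h3 : ‖w‖ ≤ η * (‖v‖ / 2) * |t - t₀| :=
    h1.trans (mul_le_mul_of_nonneg_right (min_le_right _ _) (abs_nonneg _))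
  have h4 : ‖v‖ / 2 * |t - t₀| ≤ ‖γ t - γ t₀‖ := by
    have := norm_sub_norm_le ((t - t₀) • v) (-w)
    rw [norm_neg, sub_neg_eq_add, ← hw, norm_smul, Real.norm_eq_abs] at this
    linarith
  rw [hrej]
  calc ‖rejection T w‖ ≤ ‖w‖ := norm_rejection_le hT
    _ ≤ η * (‖v‖ / 2 * |t - t₀|) := by linarith
    _ ≤ _ := by gcongr

/-- A velocity of a curve contained in `γ` is tangent to `γ`. -/
lemma IsC1ClosedCurve.rejection_eq_zero (hγ : IsC1ClosedCurve γ) {c : ℝ → Euc n} {b : Euc n}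
    {τ t₀ : ℝ} (hc : HasDerivAt c b τ) (hmem : ∀ᶠ t in 𝓝 τ, c t ∈ range γ) (h0 : c τ = γ t₀) :
    rejection (unitTangent γ t₀) b = 0 := by
  set T := unitTangent γ t₀
  have hT : ‖T‖ = 1 := norm_unitTangent (hγ.deriv_ne_zero t₀)
  have hslope := hasDerivAt_iff_tendsto_slope.1 hc
  have hrc : Continuous (rejection T) := by unfold rejection; fun_prop
  have hlim1 := ((hrc.tendsto b).comp hslope).norm
  have hlim2 := hslope.norm
  -- The difference quotients of `c` eventually lie in arbitrarily thin cones around the tangent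
  -- line, hence so does their limit `b`.
  have key : ∀ η : ℝ, 0 < η → ‖rejection T b‖ ≤ η * ‖b‖ := by
    intro η hη
    obtain ⟨r, hr, hrr⟩ := hγ.norm_rejection_sub_le t₀ hη
    have hnear : ∀ᶠ t in 𝓝 τ, ‖c t - γ t₀‖ < r := by
      have : Filter.Tendsto (fun t => ‖c t - γ t₀‖) (𝓝 τ) (𝓝 ‖c τ - γ t₀‖) :=
        ((hc.continuousAt.sub continuousAt_const).norm)
      rw [h0, sub_self, norm_zero] at this
      exact this.eventually_lt_const hr
    refine le_of_tendsto_of_tendsto hlim1 (hlim2.const_mul η) ?_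
    filter_upwards [nhdsWithin_le_nhds hnear, nhdsWithin_le_nhds hmem] with t h1 h2
    simp only [Function.comp, slope_def_module, h0, rejection_smul, norm_smul]
    have := hrr _ h2 h1
    calc _ ≤ ‖(t - τ)⁻¹‖ * (η * ‖c t - γ t₀‖) := by gcongr
      _ = _ := by ring
  have : ‖rejection T b‖ ≤ 0 := by
    refine ge_of_tendsto (f := fun η : ℝ => η * ‖b‖) (x := 𝓝[>] 0) ?_ ?_
    · have : Filter.Tendsto (fun η : ℝ => η * ‖b‖) (𝓝 0) (𝓝 (0 * ‖b‖)) :=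
        (continuous_id.mul continuous_const).tendsto _
      rw [zero_mul] at this
      exact this.mono_left nhdsWithin_le_nhds
    · filter_upwards [self_mem_nhdsWithin] with η hη
      exact key η hη
  simpa using this

end ClosedCurve

/-! ### The gap between projected length and flux at a point of the curve. -/

section BoundaryDefect

variable {n : ℕ} {γ : ℝ → Euc n}

/-- The density `|(y - x)^⊥| / (|y - x|² + s²)`, where `⊥` is the part orthogonal to `T`. -/
def fluxSpeed (s : ℝ) (x y T : Euc n) : ℝ :=
  ‖rejection T (y - x)‖ / (‖y - x‖ ^ 2 + s ^ 2)

lemma fluxSpeed_nonneg (s : ℝ) (x y T : Euc n) : 0 ≤ fluxSpeed s x y T := by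
  unfold fluxSpeed; positivity

lemma fluxSpeed_le_coneSpeed (s : ℝ) (x y : Euc n) {T : Euc n} (hT : ‖T‖ = 1) :
    fluxSpeed s x y T ≤ coneSpeed s x y T := by
  unfold fluxSpeed coneSpeed
  rw [norm_rejection hT]
  gcongr
  nlinarith [sq_nonneg s]

lemma IsC1ClosedCurve.continuous_fluxSpeed_mul (hγ : IsC1ClosedCurve γ) {s : ℝ} (hs : 0 < s)
    (x : Euc n) :
    Continuous fun t => fluxSpeed s x (γ t) (unitTangent γ t) * ‖deriv γ t‖ := by
  have h1 := continuous_unitTangent hγ.contDiff hγ.deriv_ne_zero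
  have h2 := hγ.contDiff.continuous
  have h3 := hγ.continuous_deriv
  unfold fluxSpeed rejection
  refine Continuous.mul (Continuous.div ?_ ?_ fun t => by positivity) h3.norm <;> fun_prop

/-- The part of the length of the radial projection that concentrates at a point of the curve when
the centre of projection tends to that point. -/
def coneDefect (γ : ℝ → Euc n) (s : ℝ) (x : Euc n) (t : ℝ) : ℝ :=
  coneSpeed s x (γ t) (unitTangent γ t) * ‖deriv γ t‖ -
    fluxSpeed s x (γ t) (unitTangent γ t) * ‖deriv γ t‖

lemma IsC1ClosedCurve.continuous_coneDefect (hγ : IsC1ClosedCurve γ) {s : ℝ} (hs : 0 < s)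
    (x : Euc n) : Continuous (coneDefect γ s x) :=
  (continuous_coneSpeed_mul hγ.contDiff hγ.deriv_ne_zero hs x).sub
    (hγ.continuous_fluxSpeed_mul hs x)

lemma IsC1ClosedCurve.coneDefect_nonneg (hγ : IsC1ClosedCurve γ) (s : ℝ) (x : Euc n) (t : ℝ) :
    0 ≤ coneDefect γ s x t := by
  unfold coneDefect
  rw [← sub_mul]
  exact mul_nonneg (sub_nonneg.2 (fluxSpeed_le_coneSpeed s x _
    (norm_unitTangent (hγ.deriv_ne_zero t)))) (norm_nonneg _)

/-- Both speeds are homogeneous of degree -1 in (γ t - x, s). The factor `s` is also the Jacobian of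
the substitution t = t₀ + sτ used next. -/
lemma mul_coneDefect_eq {s : ℝ} (hs : 0 < s) (x : Euc n) (t : ℝ) :
    s * coneDefect γ s x t =
      (Real.sqrt (‖s⁻¹ • (γ t - x)‖ ^ 2 + 1 - ⟪unitTangent γ t, s⁻¹ • (γ t - x)⟫ ^ 2) -
        ‖rejection (unitTangent γ t) (s⁻¹ • (γ t - x))‖) /
        (‖s⁻¹ • (γ t - x)‖ ^ 2 + 1) * ‖deriv γ t‖ := by
  set q := s⁻¹ • (γ t - x) with hq
  have hx : γ t - x = s • q := by rw [hq, smul_smul, mul_inv_cancel₀ hs.ne', one_smul]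
  unfold coneDefect coneSpeed fluxSpeed
  have n1 : ‖s • q‖ = s * ‖q‖ := by rw [norm_smul, Real.norm_of_nonneg hs.le]
  have n2 : ‖s • rejection (unitTangent γ t) q‖ = s * ‖rejection (unitTangent γ t) q‖ := by
    rw [norm_smul, Real.norm_of_nonneg hs.le]
  rw [hx, rejection_smul, n1, n2, real_inner_smul_right,
    show (s * ‖q‖) ^ 2 + s ^ 2 - (s * ⟪unitTangent γ t, q⟫) ^ 2 =
      s ^ 2 * (‖q‖ ^ 2 + 1 - ⟪unitTangent γ t, q⟫ ^ 2) by ring, Real.sqrt_mul (sq_nonneg s),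
    Real.sqrt_sq hs.le, show (s * ‖q‖) ^ 2 + s ^ 2 = s ^ 2 * (‖q‖ ^ 2 + 1) by ring]
  have : 0 < ‖q‖ ^ 2 + 1 := by positivity
  field_simp

lemma lintegral_inv_one_add_sq {a : ℝ} (ha : 0 < a) :
    ∫⁻ τ : ℝ, ENNReal.ofReal (a / ((τ * a) ^ 2 + 1)) = ENNReal.ofReal Real.pi := by
  have h1 := lintegral_eq_mul_lintegral_rescale (volume : Measure ℝ)
    (fun τ => ENNReal.ofReal ((1 + τ ^ 2)⁻¹)) 0 ha
  rw [← ofReal_integral_eq_lintegral_ofReal integrable_inv_one_add_sq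
    (Filter.Eventually.of_forall fun τ => by positivity), integral_univ_inv_one_add_sq] at h1
  rw [h1, ← lintegral_const_mul _ (by fun_prop)]
  refine lintegral_congr fun τ => ?_
  rw [← ENNReal.ofReal_mul (by positivity)]
  congr 1
  simp only [Module.finrank_self, pow_one, zero_add, smul_eq_mul]
  rw [div_eq_mul_inv]; congr 2; ring

/-- At scale `s` the curve looks like its tangent line through `x`. The flux of that line vanishes,
while its projection from height `s` is half a great circle, of length π. Fatou's lemma passes this
to the liminf. -/
lemma IsC1ClosedCurve.eventually_le_integral_coneDefect (hγ : IsC1ClosedCurve γ) (t₀ : ℝ) {c : ℝ}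
    (hc : c < Real.pi) :
    ∀ᶠ s in 𝓝[>] (0 : ℝ), c ≤ ∫ t in (0 : ℝ)..1, coneDefect γ s (γ t₀) t := by
  set a := ‖deriv γ t₀‖ with ha
  have ha0 : 0 < a := norm_pos_iff.2 (hγ.deriv_ne_zero t₀)
  set x := γ t₀
  set J : Set ℝ := Ioo (t₀ - 1 / 2) (t₀ + 1 / 2) with hJ
  -- Set to 0 for s ≤ 0, because the rescaled Fatou lemma asks for measurability at every `s`. The
  -- interval `J` is one period around `t₀`.
  set f : ℝ → ℝ → ℝ≥0∞ := fun s => if 0 < s then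
    J.indicator fun t => ENNReal.ofReal (coneDefect γ s x t) else 0 with hf
  have hfm : ∀ s, Measurable (f s) := by
    intro s
    by_cases hs : 0 < s
    · simp only [hf, hs, if_true]
      exact (ENNReal.measurable_ofReal.comp (hγ.continuous_coneDefect hs x).measurable).indicator
        measurableSet_Ioo
    · simp only [hf, hs, if_false]; exact measurable_const
  have hfatou := lintegral_le_liminf_of_rescaled (volume : Measure ℝ) t₀ hfm (c := fun s => s)
    (fun s hs => hs) (G := fun τ => ENNReal.ofReal (a / ((τ * a) ^ 2 + 1)))
    (Filter.Eventually.of_forall fun τ => ?_)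
  · rw [lintegral_inv_one_add_sq ha0] at hfatou
    have hlt : ENNReal.ofReal c < ENNReal.ofReal Real.pi :=
      (ENNReal.ofReal_lt_ofReal_iff Real.pi_pos).2 hc
    have hev := Filter.eventually_lt_of_lt_liminf (hlt.trans_le hfatou)
    filter_upwards [hev, self_mem_nhdsWithin] with s hs hs0
    have hs0' : 0 < s := hs0
    have hcont := hγ.continuous_coneDefect hs0' x
    have hper : Function.Periodic (coneDefect γ s x) 1 := by
      intro t
      unfold coneDefect
      rw [hγ.periodic, unitTangent_periodic hγ.periodic, deriv_periodic hγ.periodic]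
    have hshift := hper.intervalIntegral_add_eq 0 (t₀ - 1 / 2)
    rw [zero_add] at hshift
    rw [hshift]
    have hle : ∫⁻ t, f s t ≤
        ENNReal.ofReal (∫ t in (t₀ - 1 / 2)..(t₀ - 1 / 2 + 1), coneDefect γ s x t) := by
      rw [intervalIntegral.integral_of_le (by linarith), ofReal_integral_eq_lintegral_ofReal
        (hcont.integrableOn_Ioc)
        (Filter.Eventually.of_forall fun t => hγ.coneDefect_nonneg s x t)]
      simp only [hf, hs0', if_true]
      rw [lintegral_indicator measurableSet_Ioo]
      refine lintegral_mono_set fun t ht => ⟨ht.1, ?_⟩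
      have := ht.2; linarith
    have h3 := hs.le.trans hle
    refine (ENNReal.ofReal_le_ofReal_iff ?_).1 h3
    exact intervalIntegral.integral_nonneg (by linarith) fun t _ => hγ.coneDefect_nonneg s x t
  · -- pointwise limit of the rescaled integrand
    have hline : Filter.Tendsto (fun s : ℝ => t₀ + s * τ) (𝓝[>] 0) (𝓝 t₀) := by
      have : Filter.Tendsto (fun s : ℝ => t₀ + s * τ) (𝓝 0) (𝓝 (t₀ + 0 * τ)) :=
        Continuous.tendsto (by fun_prop) _
      rw [zero_mul, add_zero] at this
      exact this.mono_left nhdsWithin_le_nhds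
    have hq : Filter.Tendsto (fun s : ℝ => s⁻¹ • (γ (t₀ + s * τ) - x)) (𝓝[>] 0)
        (𝓝 (τ • deriv γ t₀)) := by
      have hd : HasDerivAt (fun s : ℝ => γ (t₀ + s * τ)) (τ • deriv γ t₀) 0 := by
        have h1 : HasDerivAt (fun s : ℝ => t₀ + s * τ) τ 0 := by
          simpa using ((hasDerivAt_id (0 : ℝ)).mul_const τ).const_add t₀
        have h2 : HasDerivAt γ (deriv γ t₀) (t₀ + 0 * τ) := by
          rw [zero_mul, add_zero]; exact hγ.hasDerivAt t₀
        exact h2.scomp 0 h1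
      have h2 := hasDerivAt_iff_tendsto_slope_zero.1 hd
      simp only [zero_add, zero_mul, add_zero] at h2
      exact h2.mono_left (nhdsWithin_mono _ fun s hs => ne_of_gt hs)
    have hT := ((continuous_unitTangent hγ.contDiff hγ.deriv_ne_zero).tendsto t₀).comp hline
    have hD := (hγ.continuous_deriv.tendsto t₀).comp hline
    have hTn : ‖unitTangent γ t₀‖ = 1 := norm_unitTangent (hγ.deriv_ne_zero t₀)
    have hda : deriv γ t₀ = a • unitTangent γ t₀ := by
      rw [unitTangent, smul_smul, mul_inv_cancel₀ ha0.ne', one_smul]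
    have hlim : Filter.Tendsto (fun s : ℝ => s * coneDefect γ s x (t₀ + s * τ)) (𝓝[>] 0)
        (𝓝 (a / ((τ * a) ^ 2 + 1))) := by
      have hrej : Filter.Tendsto (fun s : ℝ =>
          rejection (unitTangent γ (t₀ + s * τ)) (s⁻¹ • (γ (t₀ + s * τ) - x))) (𝓝[>] 0)
          (𝓝 (rejection (unitTangent γ t₀) (τ • deriv γ t₀))) := by
        unfold rejection
        exact hq.sub ((hT.inner hq).smul hT)
      have hmain := (((((hq.norm.pow 2).add_const 1).sub ((hT.inner hq).pow 2)).sqrt.sub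
        hrej.norm).div ((hq.norm.pow 2).add_const 1) (by positivity)).mul hD.norm
      -- The limit τγ'(t₀) is tangential: its rejection vanishes, and the first square root becomes
      -- √1.
      have hval : (Real.sqrt (‖τ • deriv γ t₀‖ ^ 2 + 1 - ⟪unitTangent γ t₀, τ • deriv γ t₀⟫ ^ 2) -
          ‖rejection (unitTangent γ t₀) (τ • deriv γ t₀)‖) / (‖τ • deriv γ t₀‖ ^ 2 + 1) *
          ‖deriv γ t₀‖ = a / ((τ * a) ^ 2 + 1) := by
        rw [rejection_smul, rejection_unitTangent_deriv (hγ.deriv_ne_zero t₀), smul_zero,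
          norm_zero, norm_smul, ← ha, real_inner_smul_right]
        have : ⟪unitTangent γ t₀, deriv γ t₀⟫ = a := by
          rw [hda, real_inner_smul_right, real_inner_self_eq_norm_sq, hTn]; ring
        rw [this, mul_pow, Real.norm_eq_abs, sq_abs, mul_pow,
          show τ ^ 2 * a ^ 2 + 1 - τ ^ 2 * a ^ 2 = 1 by ring, Real.sqrt_one]
        ring
      rw [hval] at hmain
      refine hmain.congr' ?_
      filter_upwards [self_mem_nhdsWithin] with s hs
      exact (mul_coneDefect_eq hs x _).symm
    have hlim' := (ENNReal.continuous_ofReal.tendsto _).comp hlim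
    refine le_of_eq ?_
    rw [← hlim'.liminf_eq]
    refine Filter.liminf_congr ?_
    have hJn : ∀ᶠ s in 𝓝[>] (0 : ℝ), t₀ + s * τ ∈ J :=
      hline.eventually (Ioo_mem_nhds (by linarith) (by linarith))
    filter_upwards [self_mem_nhdsWithin, hJn] with s hs hsJ
    have hs' : 0 < s := hs
    simp only [Function.comp, hf, hs', if_true, Module.finrank_self, pow_one, smul_eq_mul]
    rw [indicator_of_mem hsJ, ENNReal.ofReal_mul hs'.le]

end BoundaryDefect

/-! ### Total mass of the model branch point. -/

section ModelDensity

/-- The density of `z ↦ z ^ (k + 1)` weighted by `(|y|² + 1)⁻²`. -/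
def modelDensity (k : ℕ) (r : ℝ) : ℝ :=
  (k + 1) ^ 2 * r ^ (2 * k) / (r ^ (2 * k + 2) + 1) ^ 2

lemma modelDensity_nonneg (k : ℕ) (r : ℝ) : 0 ≤ modelDensity k r := by
  unfold modelDensity
  have : r ^ (2 * k) = (r ^ k) ^ 2 := by ring
  rw [this]; positivity

/-- The power map covers the plane k + 1 times, and each sheet has mass π. In polar coordinates `F`
is a primitive of the radial integrand, with F(0) = -(k + 1)/2 and limit 0 at infinity. -/
lemma lintegral_modelDensity (k : ℕ) :
    ∫⁻ v : Euc 2, ENNReal.ofReal (modelDensity k ‖v‖) = ENNReal.ofReal ((k + 1) * Real.pi) := by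
  set F : ℝ → ℝ := fun y => -((k + 1 : ℝ) / 2) * (y ^ (2 * k + 2) + 1)⁻¹ with hF
  have hder : ∀ y ∈ Ici (0 : ℝ), HasDerivAt F (y * modelDensity k y) y := by
    intro y hy
    have hy0 : 0 < y ^ (2 * k + 2) + 1 := by have : 0 ≤ y := hy; positivity
    have h1 := (((hasDerivAt_pow (2 * k + 2) y).add_const 1).inv hy0.ne').const_mul
      (-((k + 1 : ℝ) / 2))
    refine h1.congr_deriv ?_
    unfold modelDensity
    simp only [Nat.add_succ_sub_one]
    push_cast
    field_simp
    ring
  have hnn : ∀ y ∈ Ioi (0 : ℝ), 0 ≤ y * modelDensity k y := fun y hy =>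
    mul_nonneg (le_of_lt hy) (modelDensity_nonneg k y)
  have hlim : Filter.Tendsto F Filter.atTop (𝓝 0) := by
    have h1 : Filter.Tendsto (fun y : ℝ => y ^ (2 * k + 2) + 1) Filter.atTop Filter.atTop :=
      Filter.tendsto_atTop_add_const_right _ _ (Filter.tendsto_pow_atTop (by omega))
    have h2 := h1.inv_tendsto_atTop.const_mul (-((k + 1 : ℝ) / 2))
    rwa [mul_zero] at h2
  have hint := integrableOn_Ioi_deriv_of_nonneg' hder hnn hlim
  have hval := integral_Ioi_of_hasDerivAt_of_nonneg' hder hnn hlim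
  have hI : Integrable (fun v : Euc 2 => modelDensity k ‖v‖) := by
    rw [integrable_fun_norm_addHaar (volume : Measure (Euc 2)) (f := modelDensity k)]
    simpa using hint
  rw [← ofReal_integral_eq_lintegral_ofReal hI
    (Filter.Eventually.of_forall fun v => modelDensity_nonneg k _),
    integral_fun_norm_addHaar (volume : Measure (Euc 2)) (modelDensity k)]
  congr 1
  have hball : (volume : Measure (Euc 2)).real (Metric.ball 0 1) = Real.pi := by
    rw [Measure.real, EuclideanSpace.volume_ball_fin_two]
    simp [Real.pi_nonneg]
  rw [hball]
  simp only [finrank_euclideanSpace, Fintype.card_fin, Nat.add_one_sub_one, pow_one, smul_eq_mul,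
    nsmul_eq_mul]
  rw [hval]
  simp [hF]
  ring

lemma lintegral_modelDensity_comp (k : ℕ) (A : Euc 2 →L[ℝ] Euc 2) (hA : A.det ≠ 0) :
    ∫⁻ w : Euc 2, ENNReal.ofReal (modelDensity k ‖A w‖ * |A.det|) =
      ENNReal.ofReal ((k + 1) * Real.pi) := by
  have hinj : Function.Injective A := by
    have := (jacobian_ne_zero_iff A).1 (by rw [jacobian_eq_abs_det]; exact abs_ne_zero.2 hA)
    exact this
  have hsurj : Function.Surjective A := LinearMap.injective_iff_surjective.1
    (show Function.Injective (A : Euc 2 →ₗ[ℝ] Euc 2) from hinj)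
  have h := lintegral_image_eq_lintegral_abs_det_fderiv_mul (volume : Measure (Euc 2))
    MeasurableSet.univ (f := A) (f' := fun _ => A) (fun x _ => A.hasFDerivAt.hasFDerivWithinAt)
    hinj.injOn (fun v => ENNReal.ofReal (modelDensity k ‖v‖))
  rw [image_univ, hsurj.range_eq, Measure.restrict_univ, lintegral_modelDensity] at h
  rw [h]
  refine lintegral_congr fun w => ?_
  rw [mul_comm, ENNReal.ofReal_mul (abs_nonneg _)]

lemma volume_coord_eq_zero : volume {w : Euc 2 | w 0 = 0} = 0 := by
  let V : Submodule ℝ (Euc 2) := LinearMap.ker (EuclideanSpace.proj (0 : Fin 2) :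
    Euc 2 →L[ℝ] ℝ).toLinearMap
  have hV : V ≠ ⊤ := by
    intro h
    have : (EuclideanSpace.single 0 1 : Euc 2) ∈ V := by rw [h]; trivial
    simp [V] at this
  have := Measure.addHaar_submodule (volume : Measure (Euc 2)) V hV
  have he : {w : Euc 2 | w 0 = 0} = V := by
    ext w; simp [V]
  rw [he]; exact this

/-- The map w ↦ -w exchanges the two open half-planes, and the line between them is null. -/
lemma ofReal_le_two_mul_setLIntegral_half {G : Euc 2 → ℝ≥0∞} (heven : ∀ w, G (-w) = G w) :
    ∫⁻ w, G w ≤ 2 * ∫⁻ w in {w : Euc 2 | 0 < w 0}, G w := by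
  have hm : MeasurableSet {w : Euc 2 | 0 < w 0} :=
    measurableSet_lt measurable_const (by fun_prop)
  have hm' : MeasurableSet {w : Euc 2 | w 0 < 0} :=
    measurableSet_lt (by fun_prop) measurable_const
  have hneg : ∫⁻ w in {w : Euc 2 | w 0 < 0}, G w = ∫⁻ w in {w : Euc 2 | 0 < w 0}, G w := by
    rw [← lintegral_indicator hm, ← lintegral_indicator hm', ← lintegral_neg_eq_self]
    refine lintegral_congr fun w => ?_
    by_cases h : 0 < w 0
    · rw [indicator_of_mem (show -w ∈ {w : Euc 2 | w 0 < 0} by simpa using h),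
        indicator_of_mem (show w ∈ {w : Euc 2 | 0 < w 0} from h), heven]
    · rw [indicator_of_notMem (show -w ∉ {w : Euc 2 | w 0 < 0} by simpa using h),
        indicator_of_notMem (show w ∉ {w : Euc 2 | 0 < w 0} from h)]
  have hun : (univ : Set (Euc 2)) ⊆
      ({w | 0 < w 0} ∪ {w | w 0 < 0}) ∪ {w | w 0 = 0} := by
    intro w _
    rcases lt_trichotomy (w 0) 0 with h | h | h
    · exact Or.inl (Or.inr h)
    · exact Or.inr h
    · exact Or.inl (Or.inl h)
  calc ∫⁻ w, G w = ∫⁻ w in univ, G w := by rw [Measure.restrict_univ]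
    _ ≤ ∫⁻ w in ({w | 0 < w 0} ∪ {w | w 0 < 0}) ∪ {w | w 0 = 0}, G w := lintegral_mono_set hun
    _ ≤ _ := lintegral_union_le _ _ _
    _ ≤ (∫⁻ w in {w : Euc 2 | 0 < w 0}, G w) + (∫⁻ w in {w : Euc 2 | w 0 < 0}, G w) + 0 := by
        gcongr
        · exact lintegral_union_le _ _ _
        · rw [setLIntegral_measure_zero _ _ volume_coord_eq_zero]
    _ = _ := by rw [hneg, add_zero, two_mul]

end ModelDensity

/-! ### Derivatives of maps read in a fixed chart. -/

section Charts

lemma measurableSet_inter_preimage {X Y : Type*} [TopologicalSpace X] [MeasurableSpace X]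
    [BorelSpace X] [TopologicalSpace Y] [MeasurableSpace Y] [BorelSpace Y] {f : X → Y} {t : Set X}
    (hf : ContinuousOn f t) (ht : MeasurableSet t) {S : Set Y} (hS : MeasurableSet S) :
    MeasurableSet (t ∩ f ⁻¹' S) := by
  have h : MeasurableSet (t.domRestrict f ⁻¹' S) :=
    (continuousOn_iff_continuous_domRestrict.1 hf).measurable hS
  have he : t ∩ f ⁻¹' S = Subtype.val '' (t.domRestrict f ⁻¹' S) := by
    ext y
    constructor
    · rintro ⟨h1, h2⟩
      exact ⟨⟨y, h1⟩, h2, rfl⟩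
    · rintro ⟨⟨z, h1⟩, h2, rfl⟩
      exact ⟨h1, h2⟩
  rw [he]
  exact ht.subtype_image h

variable {n : ℕ} {M : Type*} [TopologicalSpace M] [ChartedSpace (EuclideanHalfSpace 2) M]

/-- The derivative of `u` read in the chart at `p`. -/
def chartDeriv (u : M → Euc n) (p : M) (y : Euc 2) : Euc 2 →L[ℝ] Euc n :=
  fderivWithin ℝ (u ∘ (extChartAt (𝓡∂ 2) p).symm) (range (𝓡∂ 2)) y

/-- The derivative of the inverse of the chart at `p`, read in the preferred charts of `M`. -/
def symmDeriv (p : M) (y : Euc 2) : Euc 2 →L[ℝ] Euc 2 :=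
  mfderivWithin 𝓘(ℝ, Euc 2) (𝓡∂ 2) (extChartAt (𝓡∂ 2) p).symm (range (𝓡∂ 2)) y

lemma mem_range_half_iff {y : Euc 2} : y ∈ range (𝓡∂ 2) ↔ 0 ≤ y 0 := by
  rw [range_modelWithCornersEuclideanHalfSpace]; rfl

lemma uniqueDiffOn_half : UniqueDiffOn ℝ (range (𝓡∂ 2)) := (𝓡∂ 2).uniqueDiffOn

lemma measurableSet_half : MeasurableSet (range (𝓡∂ 2)) := (𝓡∂ 2).isClosed_range.measurableSet

lemma measurableSet_extChartAt_target (p : M) : MeasurableSet (extChartAt (𝓡∂ 2) p).target := by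
  rw [extChartAt_target]
  exact (((chartAt _ p).open_target.preimage (𝓡∂ 2).continuous_symm).measurableSet).inter
    measurableSet_half

lemma aemeasurable_extChartAt_symm [MeasurableSpace M] [BorelSpace M] (p : M) :
    AEMeasurable (extChartAt (𝓡∂ 2) p).symm (volume.restrict (extChartAt (𝓡∂ 2) p).target) :=
  (continuousOn_extChartAt_symm p).aemeasurable (measurableSet_extChartAt_target p)

variable [IsManifold (𝓡∂ 2) ∞ M]

lemma isManifold_one : IsManifold (𝓡∂ 2) 1 M := IsManifold.of_le (n := ∞) (by simp)

lemma contDiffWithinAt_comp_symm {F : Type*} [NormedAddCommGroup F] [NormedSpace ℝ F]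
    {u : M → F} {p : M} {y : Euc 2} (hy : y ∈ (extChartAt (𝓡∂ 2) p).target)
    (hu : ContMDiffAt (𝓡∂ 2) 𝓘(ℝ, F) 1 u ((extChartAt (𝓡∂ 2) p).symm y)) :
    ContDiffWithinAt ℝ 1 (u ∘ (extChartAt (𝓡∂ 2) p).symm) (range (𝓡∂ 2)) y := by
  have : IsManifold (𝓡∂ 2) 1 M := isManifold_one
  have h1 : ContMDiffWithinAt 𝓘(ℝ, Euc 2) (𝓡∂ 2) 1 (extChartAt (𝓡∂ 2) p).symm (range (𝓡∂ 2)) y :=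
    contMDiffWithinAt_extChartAt_symm_range p hy
  exact contMDiffWithinAt_iff_contDiffWithinAt.1 (hu.comp_contMDiffWithinAt y h1)

lemma fderivWithin_comp_symm {F : Type*} [NormedAddCommGroup F] [NormedSpace ℝ F]
    {u : M → F} {p : M} {y : Euc 2} (hy : y ∈ (extChartAt (𝓡∂ 2) p).target)
    (hu : MDifferentiableAt (𝓡∂ 2) 𝓘(ℝ, F) u ((extChartAt (𝓡∂ 2) p).symm y)) :
    fderivWithin ℝ (u ∘ (extChartAt (𝓡∂ 2) p).symm) (range (𝓡∂ 2)) y =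
      (mfderiv (𝓡∂ 2) 𝓘(ℝ, F) u ((extChartAt (𝓡∂ 2) p).symm y) : Euc 2 →L[ℝ] F) ∘L
        symmDeriv p y := by
  have : IsManifold (𝓡∂ 2) 1 M := isManifold_one
  have hyr : y ∈ range (𝓡∂ 2) := extChartAt_target_subset_range p hy
  rw [← mfderivWithin_eq_fderivWithin]
  exact mfderiv_comp_mfderivWithin y hu (mdifferentiableWithinAt_extChartAt_symm hy)
    (uniqueDiffOn_half.uniqueMDiffOn y hyr)

lemma chartDeriv_eq {u : M → Euc n} (hu : ContMDiff (𝓡∂ 2) 𝓘(ℝ, Euc n) 1 u) {p : M} {y : Euc 2}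
    (hy : y ∈ (extChartAt (𝓡∂ 2) p).target) :
    chartDeriv u p y = du u ((extChartAt (𝓡∂ 2) p).symm y) ∘L symmDeriv p y :=
  fderivWithin_comp_symm hy ((hu.mdifferentiable one_ne_zero) _)

lemma symmDeriv_bijective {p : M} {y : Euc 2} (hy : y ∈ (extChartAt (𝓡∂ 2) p).target) :
    Function.Bijective (symmDeriv p y) := by
  have : IsManifold (𝓡∂ 2) 1 M := isManifold_one
  have h := isInvertible_mfderivWithin_extChartAt_symm (I := 𝓡∂ 2) hy
  exact h.bijective

lemma chartDeriv_injective_iff {u : M → Euc n} (hu : ContMDiff (𝓡∂ 2) 𝓘(ℝ, Euc n) 1 u) {p : M}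
    {y : Euc 2} (hy : y ∈ (extChartAt (𝓡∂ 2) p).target) :
    Function.Injective (chartDeriv u p y) ↔
      Function.Injective (du u ((extChartAt (𝓡∂ 2) p).symm y)) := by
  rw [chartDeriv_eq hu hy, ContinuousLinearMap.coe_comp]
  exact Function.Injective.of_comp_iff' _ (symmDeriv_bijective hy)

lemma range_chartDeriv {u : M → Euc n} (hu : ContMDiff (𝓡∂ 2) 𝓘(ℝ, Euc n) 1 u) {p : M}
    {y : Euc 2} (hy : y ∈ (extChartAt (𝓡∂ 2) p).target) :
    LinearMap.range (chartDeriv u p y).toLinearMap =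
      LinearMap.range (du u ((extChartAt (𝓡∂ 2) p).symm y)).toLinearMap := by
  rw [chartDeriv_eq hu hy]
  exact LinearMap.range_comp_of_range_eq_top _
    (LinearMap.range_eq_top.2 (symmDeriv_bijective hy).2)

lemma continuousWithinAt_fderivWithin_comp_symm {F : Type*} [NormedAddCommGroup F]
    [NormedSpace ℝ F] {u : M → F} {p : M} {y : Euc 2} (hy : y ∈ (extChartAt (𝓡∂ 2) p).target)
    (hu : ContMDiffAt (𝓡∂ 2) 𝓘(ℝ, F) 1 u ((extChartAt (𝓡∂ 2) p).symm y)) :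
    ContinuousWithinAt (fun y => fderivWithin ℝ (u ∘ (extChartAt (𝓡∂ 2) p).symm)
      (range (𝓡∂ 2)) y) (range (𝓡∂ 2)) y :=
  ((contDiffWithinAt_comp_symm hy hu).fderivWithin_right (m := 0) uniqueDiffOn_half (by simp)
    (extChartAt_target_subset_range p hy)).continuousWithinAt

lemma continuousWithinAt_chartDeriv {u : M → Euc n} (hu : ContMDiff (𝓡∂ 2) 𝓘(ℝ, Euc n) 1 u)
    {p : M} {y : Euc 2} (hy : y ∈ (extChartAt (𝓡∂ 2) p).target) :
    ContinuousWithinAt (chartDeriv u p) (range (𝓡∂ 2)) y :=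
  continuousWithinAt_fderivWithin_comp_symm hy (hu _)

lemma continuous_jacobian : Continuous (jacobian : (Euc 2 →L[ℝ] Euc n) → ℝ) := by
  have : (jacobian : (Euc 2 →L[ℝ] Euc n) → ℝ) = fun A => Real.sqrt
      (gram (A (EuclideanSpace.single 0 1)) (A (EuclideanSpace.single 1 1))) := by
    funext A; exact jacobian_eq_sqrt_gram A
  rw [this]
  unfold gram
  fun_prop

lemma continuousWithinAt_chartJacobian {u : M → Euc n} (hu : ContMDiff (𝓡∂ 2) 𝓘(ℝ, Euc n) 1 u)
    {p : M} {y : Euc 2} (hy : y ∈ (extChartAt (𝓡∂ 2) p).target) :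
    ContinuousWithinAt (chartJacobian u p) (range (𝓡∂ 2)) y :=
  continuous_jacobian.continuousAt.comp_continuousWithinAt (continuousWithinAt_chartDeriv hu hy)

lemma continuousOn_chartJacobian {u : M → Euc n} (hu : ContMDiff (𝓡∂ 2) 𝓘(ℝ, Euc n) 1 u) (p : M) :
    ContinuousOn (chartJacobian u p) (extChartAt (𝓡∂ 2) p).target := fun _ hy =>
  (continuousWithinAt_chartJacobian hu hy).mono (extChartAt_target_subset_range p)

lemma aemeasurable_chartJacobian {u : M → Euc n} (hu : ContMDiff (𝓡∂ 2) 𝓘(ℝ, Euc n) 1 u) (p : M) :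
    AEMeasurable (fun y => ENNReal.ofReal (chartJacobian u p y))
      (volume.restrict (extChartAt (𝓡∂ 2) p).target) :=
  ENNReal.measurable_ofReal.comp_aemeasurable
    ((continuousOn_chartJacobian hu p).aemeasurable (measurableSet_extChartAt_target p))

variable [MeasurableSpace M] [BorelSpace M]

/-- Integrals against `chartArea` in coordinates. -/
lemma setLIntegral_chartArea {u : M → Euc n} (hu : ContMDiff (𝓡∂ 2) 𝓘(ℝ, Euc n) 1 u) (p : M)
    {g : M → ℝ≥0∞} (hg : Measurable g) {S : Set M} (hS : MeasurableSet S) :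
    ∫⁻ q in S, g q ∂(chartArea u p) =
      ∫⁻ y in (extChartAt (𝓡∂ 2) p).target ∩ (extChartAt (𝓡∂ 2) p).symm ⁻¹' S,
        ENNReal.ofReal (chartJacobian u p y) * g ((extChartAt (𝓡∂ 2) p).symm y) := by
  have hsm := aemeasurable_extChartAt_symm p
  have hJ := aemeasurable_chartJacobian hu p
  set t := (extChartAt (𝓡∂ 2) p).target
  set φ := (extChartAt (𝓡∂ 2) p).symm
  have ht : MeasurableSet t := measurableSet_extChartAt_target p
  have hpre : MeasurableSet (t ∩ φ ⁻¹' S) :=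
    measurableSet_inter_preimage (continuousOn_extChartAt_symm p) ht hS
  rw [← lintegral_indicator hS, chartArea, lintegral_map' (hg.indicator hS).aemeasurable
    (hsm.mono_ac (withDensity_absolutelyContinuous _ _)),
    lintegral_withDensity_eq_lintegral_mul₀ hJ, ← lintegral_indicator ht,
    ← lintegral_indicator hpre]
  · refine lintegral_congr fun y => ?_
    by_cases h1 : y ∈ t
    · by_cases h2 : φ y ∈ S
      · rw [indicator_of_mem h1, indicator_of_mem (show y ∈ t ∩ φ ⁻¹' S from ⟨h1, h2⟩)]
        simp [indicator_of_mem h2]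
      · rw [indicator_of_mem h1, indicator_of_notMem (fun h => h2 h.2)]
        simp [indicator_of_notMem h2]
    · rw [indicator_of_notMem h1, indicator_of_notMem (fun h => h1 h.1)]
  · exact (hg.indicator hS).comp_aemeasurable hsm

end Charts

/-! ### The area measure: finiteness, null sets, measurability. -/

section Area

lemma starProjection_congr {n : ℕ} {U V : Submodule ℝ (Euc n)} (h : U = V) (v : Euc n) :
    U.starProjection v = V.starProjection v := by
  subst h; rfl

variable {n : ℕ} {M : Type*} [TopologicalSpace M] [ChartedSpace (EuclideanHalfSpace 2) M]
  [IsManifold (𝓡∂ 2) ∞ M] [MeasurableSpace M] [BorelSpace M] {u : M → Euc n}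

lemma chartArea_apply (hu : ContMDiff (𝓡∂ 2) 𝓘(ℝ, Euc n) 1 u) (p : M) {S : Set M}
    (hS : MeasurableSet S) :
    chartArea u p S = ∫⁻ y in (extChartAt (𝓡∂ 2) p).target ∩ (extChartAt (𝓡∂ 2) p).symm ⁻¹' S,
      ENNReal.ofReal (chartJacobian u p y) := by
  have h := setLIntegral_chartArea hu p (g := fun _ => 1) measurable_const hS
  simpa using h

lemma chartArea_compl_source (hu : ContMDiff (𝓡∂ 2) 𝓘(ℝ, Euc n) 1 u) (p : M) :
    chartArea u p (extChartAt (𝓡∂ 2) p).sourceᶜ = 0 := by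
  rw [chartArea_apply hu p (isOpen_extChartAt_source p).measurableSet.compl]
  have : (extChartAt (𝓡∂ 2) p).target ∩
      (extChartAt (𝓡∂ 2) p).symm ⁻¹' (extChartAt (𝓡∂ 2) p).sourceᶜ = ∅ := by
    ext y
    simp only [mem_inter_iff, mem_preimage, mem_compl_iff, mem_empty_iff_false, iff_false, not_and,
      not_not]
    exact fun hy => (extChartAt (𝓡∂ 2) p).map_target hy
  rw [this]; simp

/-- Change of variables under the transition map: by the chain rule the Jacobian of `u` is
multiplied by exactly the determinant of the transition. -/
lemma chartArea_eq_of_subset (hu : ContMDiff (𝓡∂ 2) 𝓘(ℝ, Euc n) 1 u) (p q : M) {S : Set M}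
    (hS : MeasurableSet S) (hp : S ⊆ (extChartAt (𝓡∂ 2) p).source)
    (hq : S ⊆ (extChartAt (𝓡∂ 2) q).source) : chartArea u p S = chartArea u q S := by
  have : IsManifold (𝓡∂ 2) 1 M := isManifold_one
  rw [chartArea_apply hu p hS, chartArea_apply hu q hS]
  set ep := extChartAt (𝓡∂ 2) p
  set eq := extChartAt (𝓡∂ 2) q
  set T := ep.target ∩ ep.symm ⁻¹' S with hT
  set f : Euc 2 → Euc 2 := eq ∘ ep.symm with hf
  have hTm : MeasurableSet T := measurableSet_inter_preimage (continuousOn_extChartAt_symm p)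
    (measurableSet_extChartAt_target p) hS
  have himg : f '' T = eq.target ∩ eq.symm ⁻¹' S := by
    ext z
    constructor
    · rintro ⟨y, ⟨hy1, hy2⟩, rfl⟩
      refine ⟨eq.map_source (hq hy2), ?_⟩
      simp only [hf, mem_preimage, Function.comp]
      rw [eq.left_inv (hq hy2)]; exact hy2
    · rintro ⟨hz1, hz2⟩
      refine ⟨ep (eq.symm z), ⟨ep.map_source (hp hz2), ?_⟩, ?_⟩
      · simp only [mem_preimage]
        rw [ep.left_inv (hp hz2)]; exact hz2
      · simp only [hf, Function.comp]
        rw [ep.left_inv (hp hz2), eq.right_inv hz1]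
  have hinj : InjOn f T := by
    intro y hy z hz h
    have h1 := eq.injOn (hq hy.2) (hq hz.2) h
    have h2 := congrArg ep h1
    rwa [ep.right_inv hy.1, ep.right_inv hz.1] at h2
  have hsmooth : ∀ y ∈ T, ContMDiffAt (𝓡∂ 2) 𝓘(ℝ, Euc 2) 1 eq (ep.symm y) := fun y hy =>
    contMDiffAt_extChartAt' (by rw [← extChartAt_source (𝓡∂ 2)]; exact hq hy.2)
  have hder : ∀ y ∈ T, HasFDerivWithinAt f (fderivWithin ℝ f (range (𝓡∂ 2)) y) T y := fun y hy =>
    (((contDiffWithinAt_comp_symm hy.1 (hsmooth y hy)).differentiableWithinAt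
      one_ne_zero).hasFDerivWithinAt).mono
      fun z hz => extChartAt_target_subset_range p hz.1
  rw [← himg, lintegral_image_eq_lintegral_abs_det_fderiv_mul volume hTm hder hinj]
  refine setLIntegral_congr_fun hTm fun y hy => ?_
  have hfy : f y ∈ eq.target := eq.map_source (hq hy.2)
  have hback : eq.symm (f y) = ep.symm y := eq.left_inv (hq hy.2)
  have hD : chartDeriv u p y = chartDeriv u q (f y) ∘L fderivWithin ℝ f (range (𝓡∂ 2)) y := by
    let B : Euc 2 →L[ℝ] Euc 2 := mfderiv (𝓡∂ 2) 𝓘(ℝ, Euc 2) eq (ep.symm y)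
    have h1 : fderivWithin ℝ f (range (𝓡∂ 2)) y = B ∘L symmDeriv p y :=
      fderivWithin_comp_symm hy.1 ((hsmooth y hy).mdifferentiableAt one_ne_zero)
    have h2 := mfderivWithin_extChartAt_symm_comp_mfderiv_extChartAt' (I := 𝓡∂ 2) (x := q)
      (hq hy.2)
    rw [chartDeriv_eq hu hy.1, chartDeriv_eq hu hfy, hback, h1]
    refine ContinuousLinearMap.ext fun v => ?_
    have h5 : symmDeriv q (f y) (B (symmDeriv p y v)) = symmDeriv p y v :=
      congrArg (fun A : Euc 2 →L[ℝ] Euc 2 => A (symmDeriv p y v)) h2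
    show du u (ep.symm y) (symmDeriv p y v) =
      du u (ep.symm y) (symmDeriv q (f y) (B (symmDeriv p y v)))
    rw [h5]
  show ENNReal.ofReal (jacobian (chartDeriv u p y)) =
    ENNReal.ofReal _ * ENNReal.ofReal (jacobian (chartDeriv u q (f y)))
  rw [← ENNReal.ofReal_mul (abs_nonneg _), hD, jacobian_comp, mul_comm]

lemma exists_isOpen_chartArea_lt_top (hu : ContMDiff (𝓡∂ 2) 𝓘(ℝ, Euc n) 1 u) (p : M) :
    ∃ W : Set M, IsOpen W ∧ p ∈ W ∧ W ⊆ (extChartAt (𝓡∂ 2) p).source ∧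
      chartArea u p W < ⊤ := by
  set e := extChartAt (𝓡∂ 2) p with he
  have hcont := continuousWithinAt_chartJacobian hu (mem_extChartAt_target (I := 𝓡∂ 2) p)
  set C := chartJacobian u p (e p) + 1
  have hev : ∀ᶠ y in 𝓝[range (𝓡∂ 2)] (e p), chartJacobian u p y < C :=
    hcont.eventually_lt_const (lt_add_one _)
  obtain ⟨V, hV, hpV, hVC⟩ := mem_nhdsWithin.1 hev
  set V' := V ∩ Metric.ball (e p) 1
  have hV' : IsOpen V' := hV.inter Metric.isOpen_ball
  refine ⟨e.source ∩ e ⁻¹' V', isOpen_extChartAt_preimage' p hV',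
    ⟨mem_extChartAt_source p, hpV, Metric.mem_ball_self one_pos⟩, inter_subset_left, ?_⟩
  rw [chartArea_apply hu p (isOpen_extChartAt_preimage' p hV').measurableSet]
  set T := e.target ∩ e.symm ⁻¹' (e.source ∩ e ⁻¹' V')
  have hTV : ∀ y ∈ T, y ∈ V' := by
    rintro y ⟨h1, -, h3⟩
    rw [mem_preimage, e.right_inv h1] at h3
    exact h3
  calc ∫⁻ y in T, ENNReal.ofReal (chartJacobian u p y)
      ≤ ∫⁻ y in T, ENNReal.ofReal C := by
        refine setLIntegral_mono measurable_const fun y hy => ?_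
        refine ENNReal.ofReal_le_ofReal (le_of_lt ?_)
        exact hVC ⟨(hTV y hy).1, extChartAt_target_subset_range p hy.1⟩
    _ = ENNReal.ofReal C * volume T := setLIntegral_const _ _
    _ < ⊤ := by
        refine ENNReal.mul_lt_top ENNReal.ofReal_lt_top ?_
        exact (measure_mono fun y hy => (hTV y hy).2).trans_lt measure_ball_lt_top

/-- Finiteness and null sets of the supremum `area` are read off from this finite sum; lower bounds
come from `chartArea_le_area`. -/
lemma exists_area_le (hu : ContMDiff (𝓡∂ 2) 𝓘(ℝ, Euc n) 1 u) [CompactSpace M] :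
    ∃ (F : Finset M) (W : M → Set M), (∀ p, chartArea u p (W p) < ⊤) ∧
      area u ≤ ∑ p ∈ F, (chartArea u p).restrict (W p) := by
  choose W hWo hpW hWs hWlt using exists_isOpen_chartArea_lt_top hu
  obtain ⟨F, -, hF⟩ := isCompact_univ.elim_nhds_subcover W fun p _ => (hWo p).mem_nhds (hpW p)
  refine ⟨F, W, hWlt, iSup_le fun p => Measure.le_iff.2 fun S hS => ?_⟩
  have hcov : S ⊆ ⋃ q ∈ F, S ∩ W q := by
    intro x hx
    obtain ⟨q, hq, hxq⟩ := mem_iUnion₂.1 (hF (mem_univ x))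
    exact mem_iUnion₂.2 ⟨q, hq, hx, hxq⟩
  rw [Measure.finsetSum_apply]
  refine (measure_mono hcov).trans ((measure_biUnion_finset_le _ _).trans
    (Finset.sum_le_sum fun q _ => ?_))
  rw [Measure.restrict_apply hS]
  set s := (extChartAt (𝓡∂ 2) p).source
  have hsm : MeasurableSet s := (isOpen_extChartAt_source p).measurableSet
  have hAm : MeasurableSet (S ∩ W q ∩ s) := (hS.inter (hWo q).measurableSet).inter hsm
  calc chartArea u p (S ∩ W q)
      ≤ chartArea u p (S ∩ W q ∩ s) + chartArea u p sᶜ := by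
        refine (measure_mono ?_).trans (measure_union_le _ _)
        intro x hx
        by_cases h : x ∈ s
        · exact Or.inl ⟨hx, h⟩
        · exact Or.inr h
    _ = chartArea u q (S ∩ W q ∩ s) := by
        rw [chartArea_compl_source hu p, add_zero]
        exact chartArea_eq_of_subset hu p q hAm inter_subset_right fun x hx => hWs q hx.1.2
    _ ≤ chartArea u q (S ∩ W q) := measure_mono inter_subset_left

lemma isFiniteMeasure_area (hu : ContMDiff (𝓡∂ 2) 𝓘(ℝ, Euc n) 1 u) [CompactSpace M] :
    IsFiniteMeasure (area u) := by
  obtain ⟨F, W, hW, hle⟩ := exists_area_le hu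
  refine ⟨(hle univ).trans_lt ?_⟩
  rw [Measure.finsetSum_apply]
  refine ENNReal.sum_lt_top.2 fun p _ => ?_
  rw [Measure.restrict_apply_univ]
  exact hW p

lemma area_eq_zero (hu : ContMDiff (𝓡∂ 2) 𝓘(ℝ, Euc n) 1 u) [CompactSpace M] {N : Set M}
    (hN : ∀ p, chartArea u p N = 0) : area u N = 0 := by
  obtain ⟨F, W, -, hle⟩ := exists_area_le hu
  refine le_antisymm ((hle N).trans ?_) bot_le
  rw [Measure.finsetSum_apply]
  refine (Finset.sum_eq_zero fun p _ => ?_).le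
  exact Measure.absolutelyContinuous_of_le Measure.restrict_le_self (hN p)

omit [IsManifold (𝓡∂ 2) ∞ M] [BorelSpace M] in
lemma chartArea_le_area (u : M → Euc n) (p : M) : chartArea u p ≤ area u :=
  le_iSup (fun p => chartArea u p) p

/-- The set of points at which `u` is an immersion. -/
def immersedSet (u : M → Euc n) : Set M := {q | Function.Injective (du u q)}

omit [MeasurableSpace M] [BorelSpace M] in
lemma continuousAt_chartDeriv_comp (hu : ContMDiff (𝓡∂ 2) 𝓘(ℝ, Euc n) 1 u) (p : M) :
    ContinuousAt (fun q => chartDeriv u p (extChartAt (𝓡∂ 2) p q)) p := by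
  have h1 := continuousWithinAt_chartDeriv hu (mem_extChartAt_target (I := 𝓡∂ 2) p)
  have h2 : Filter.Tendsto (extChartAt (𝓡∂ 2) p) (𝓝 p)
      (𝓝[range (𝓡∂ 2)] (extChartAt (𝓡∂ 2) p p)) := by
    refine tendsto_nhdsWithin_iff.2 ⟨continuousAt_extChartAt p, ?_⟩
    exact Filter.Eventually.of_forall fun q => mem_range_self _
  exact h1.tendsto.comp h2

omit [MeasurableSpace M] [BorelSpace M] in
lemma isOpen_immersedSet (hu : ContMDiff (𝓡∂ 2) 𝓘(ℝ, Euc n) 1 u) : IsOpen (immersedSet u) := by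
  refine isOpen_iff_mem_nhds.2 fun p hp => ?_
  set e := extChartAt (𝓡∂ 2) p
  have hiff : ∀ q ∈ e.source, (jacobian (chartDeriv u p (e q)) ≠ 0 ↔ q ∈ immersedSet u) := by
    intro q hq
    rw [jacobian_ne_zero_iff, chartDeriv_injective_iff hu (e.map_source hq), e.left_inv hq]
    rfl
  have hc : ContinuousAt (fun q => jacobian (chartDeriv u p (e q))) p :=
    continuous_jacobian.continuousAt.comp (continuousAt_chartDeriv_comp hu p)
  have hne := hc.eventually_ne ((hiff p (mem_extChartAt_source p)).2 hp)
  filter_upwards [hne, extChartAt_source_mem_nhds (I := 𝓡∂ 2) p] with q h1 h2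
  exact (hiff q h2).1 h1

/-- The area density vanishes where the differential is not injective, so identities on the immersed
set suffice for integrals over the surface. -/
lemma area_compl_immersedSet (hu : ContMDiff (𝓡∂ 2) 𝓘(ℝ, Euc n) 1 u) [CompactSpace M] :
    area u (immersedSet u)ᶜ = 0 := by
  refine area_eq_zero hu fun p => ?_
  rw [chartArea_apply hu p (isOpen_immersedSet hu).measurableSet.compl]
  refine setLIntegral_eq_zero (measurableSet_inter_preimage (continuousOn_extChartAt_symm p)
    (measurableSet_extChartAt_target p) (isOpen_immersedSet hu).measurableSet.compl) ?_
  rintro y ⟨h1, h2⟩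
  have h3 : ¬ Function.Injective (chartDeriv u p y) := by
    rw [chartDeriv_injective_iff hu h1]; exact h2
  rw [← jacobian_ne_zero_iff, not_not] at h3
  show ENNReal.ofReal (jacobian (chartDeriv u p y)) = 0
  rw [h3, ENNReal.ofReal_zero]

/-- The squared norm of the tangential part of a vector at an immersed point. -/
def tangentSq (u : M → Euc n) (q : M) (v : Euc n) : ℝ :=
  ‖(LinearMap.range (du u q).toLinearMap).starProjection v‖ ^ 2

-- The differential `du u q` is read in the preferred chart at `q` and may jump with it, but its
-- range does not depend on the chart. Near `p` the chart at `p` can be used throughout, and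
-- `projSq` is continuous where the Gram determinant is nonzero.
omit [MeasurableSpace M] [BorelSpace M] in
lemma continuousOn_tangentSq (hu : ContMDiff (𝓡∂ 2) 𝓘(ℝ, Euc n) 1 u) {v : M → Euc n}
    (hv : Continuous v) : ContinuousOn (fun q => tangentSq u q (v q)) (immersedSet u) := by
  intro p hp
  refine ContinuousAt.continuousWithinAt ?_
  set e := extChartAt (𝓡∂ 2) p
  have hinj : ∀ q ∈ e.source, q ∈ immersedSet u → Function.Injective (chartDeriv u p (e q)) := by
    intro q hq h
    rw [chartDeriv_injective_iff hu (e.map_source hq), e.left_inv hq]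
    exact h
  have heq : (fun q => tangentSq u q (v q)) =ᶠ[𝓝 p] fun q =>
      projSq (chartDeriv u p (e q) (EuclideanSpace.single 0 1))
        (chartDeriv u p (e q) (EuclideanSpace.single 1 1)) (v q) := by
    filter_upwards [extChartAt_source_mem_nhds (I := 𝓡∂ 2) p,
      (isOpen_immersedSet hu).mem_nhds hp] with q h1 h2
    have h3 := range_chartDeriv hu (e.map_source h1)
    rw [e.left_inv h1] at h3
    rw [← norm_sq_starProjection_range (hinj q h1 h2), tangentSq, starProjection_congr h3]
  refine ContinuousAt.congr ?_ heq.symm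
  have hD := continuousAt_chartDeriv_comp hu p
  have ha := hD.clm_apply (continuousAt_const (y := (EuclideanSpace.single 0 1 : Euc 2)))
  have hb := hD.clm_apply (continuousAt_const (y := (EuclideanSpace.single 1 1 : Euc 2)))
  have hvp := hv.continuousAt (x := p)
  have hg := (gram_pos_of_injective (hinj p (mem_extChartAt_source p) hp)).ne'
  unfold projSq
  refine ContinuousAt.div ?_ ?_ hg
  · fun_prop
  · unfold gram; fun_prop

lemma aestronglyMeasurable_tangentSq (hu : ContMDiff (𝓡∂ 2) 𝓘(ℝ, Euc n) 1 u) [CompactSpace M]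
    {v : M → Euc n} (hv : Continuous v) :
    AEStronglyMeasurable (fun q => tangentSq u q (v q)) (area u) := by
  have h := (continuousOn_tangentSq hu hv).aemeasurable (μ := area u)
    (isOpen_immersedSet hu).measurableSet
  rw [Measure.restrict_eq_self_of_ae_mem] at h
  · exact h.aestronglyMeasurable
  · exact mem_ae_iff.2 (area_compl_immersedSet hu)

end Area

/-! ### The test field and its divergence along the surface. -/

section RadialField

variable {n : ℕ}

/-- A smoothing of the radial field `(y - x) / |y - x|²`. -/
def radialField (s : ℝ) (x y : Euc n) : Euc n := (‖y - x‖ ^ 2 + s ^ 2)⁻¹ • (y - x)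

lemma contDiff_radialField {s : ℝ} (hs : 0 < s) (x : Euc n) : ContDiff ℝ 1 (radialField s x) := by
  have hw : ContDiff ℝ 1 fun y : Euc n => y - x := contDiff_id.sub contDiff_const
  have hd : ContDiff ℝ 1 fun y : Euc n => ‖y - x‖ ^ 2 + s ^ 2 := (hw.norm_sq ℝ).add contDiff_const
  exact (hd.inv fun y => by positivity).smul hw

lemma hasFDerivAt_radialField {s : ℝ} (hs : 0 < s) (x y : Euc n) :
    HasFDerivAt (radialField s x)
      ((‖y - x‖ ^ 2 + s ^ 2)⁻¹ • ContinuousLinearMap.id ℝ (Euc n) +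
        (innerSL ℝ (y - x)).smulRight ((-(2 / (‖y - x‖ ^ 2 + s ^ 2) ^ 2)) • (y - x))) y := by
  have hw : HasFDerivAt (fun y : Euc n => y - x) (ContinuousLinearMap.id ℝ (Euc n)) y :=
    (hasFDerivAt_id y).sub_const x
  have hn := (hw.norm_sq).add_const (s ^ 2)
  have hne : ‖y - x‖ ^ 2 + s ^ 2 ≠ 0 := by positivity
  have hinv := (hasDerivAt_inv hne).comp_hasFDerivAt y hn
  have h := hinv.smul hw
  refine h.congr_fderiv ?_
  refine ContinuousLinearMap.ext fun v => ?_
  simp [smul_smul]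
  congr 1
  field_simp

/-- With d = |w|² + s², the trace is 2/d - 2|wᵀ|²/d², wᵀ being the tangential part of w. Writing 2/d
as 2d/d² separates the Poisson term from the nonnegative normal term that will absorb H. -/
lemma surfaceDiv_radialField {M : Type*} [TopologicalSpace M]
    [ChartedSpace (EuclideanHalfSpace 2) M] {u : M → Euc n} {q : M} (hq : q ∈ immersedSet u)
    {s : ℝ} (hs : 0 < s) (x : Euc n) :
    surfaceDiv u (radialField s x) q =
      2 * (s ^ 2 / (‖u q - x‖ ^ 2 + s ^ 2) ^ 2) +
      2 * ((‖u q - x‖ ^ 2 - tangentSq u q (u q - x)) / (‖u q - x‖ ^ 2 + s ^ 2) ^ 2) := by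
  have hA : Function.Injective (du u q) := hq
  set w := u q - x
  set V := LinearMap.range (du u q).toLinearMap
  have hd : 0 < ‖w‖ ^ 2 + s ^ 2 := by positivity
  have htr := trace_starProjection_range hA
  have hmap : ((V.starProjection ∘L fderiv ℝ (radialField s x) (u q) : Euc n →L[ℝ] Euc n) :
      Euc n →ₗ[ℝ] Euc n) = (‖w‖ ^ 2 + s ^ 2)⁻¹ • (V.starProjection : Euc n →ₗ[ℝ] Euc n) +
      ((innerSL ℝ w : Euc n →L[ℝ] ℝ) : Euc n →ₗ[ℝ] ℝ).smulRight
        ((-(2 / (‖w‖ ^ 2 + s ^ 2) ^ 2)) • V.starProjection w) := by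
    rw [(hasFDerivAt_radialField hs x (u q)).fderiv]
    refine LinearMap.ext fun v => ?_
    simp [w]
  rw [surfaceDiv, hmap, map_add, map_smul, htr, LinearMap.trace_smulRight]
  have hin : ⟪w, V.starProjection w⟫ = tangentSq u q w := by
    have h0 := Submodule.starProjection_inner_eq_zero w (V.starProjection w)
      (Submodule.starProjection_apply_mem _ _)
    rw [inner_sub_left, sub_eq_zero, real_inner_self_eq_norm_sq] at h0
    exact h0
  have : ((innerSL ℝ w : Euc n →L[ℝ] ℝ) : Euc n →ₗ[ℝ] ℝ)
      ((-(2 / (‖w‖ ^ 2 + s ^ 2) ^ 2)) • V.starProjection w) =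
      -(2 / (‖w‖ ^ 2 + s ^ 2) ^ 2) * tangentSq u q w := by
    rw [← hin]
    show ⟪w, _⟫ = _
    rw [real_inner_smul_right]
  rw [this, smul_eq_mul]
  field_simp
  ring

end RadialField

/-! ### The divergence identity turned into a bound for the Poisson mass. -/

section BulkInequality

variable {n : ℕ} {M : Type*} [TopologicalSpace M] [ChartedSpace (EuclideanHalfSpace 2) M]
  {u : M → Euc n}

lemma norm_sq_sub_tangentSq (q : M) (w : Euc n) :
    ‖w‖ ^ 2 - tangentSq u q w =
      ‖w - (LinearMap.range (du u q).toLinearMap).starProjection w‖ ^ 2 := by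
  set V := LinearMap.range (du u q).toLinearMap
  have h0 := Submodule.starProjection_inner_eq_zero w (V.starProjection w)
    (Submodule.starProjection_apply_mem _ _)
  rw [inner_sub_left, sub_eq_zero, real_inner_self_eq_norm_sq] at h0
  rw [norm_sub_sq_real, h0, tangentSq]
  ring

/-- H is normal, so it pairs only with the normal part of w. The weights in ab ≤ 2a² + b²/8 are
chosen so that the first term is exactly the normal term of `surfaceDiv_radialField`. -/
lemma inner_radialField_le {H : M → Euc n} {q : M} (hH : ∀ v, ⟪du u q v, H q⟫ = 0) {s : ℝ}
    (hs : 0 < s) (x : Euc n) :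
    ⟪radialField s x (u q), H q⟫ ≤
      2 * ((‖u q - x‖ ^ 2 - tangentSq u q (u q - x)) / (‖u q - x‖ ^ 2 + s ^ 2) ^ 2) +
      (1 / 8) * ‖H q‖ ^ 2 := by
  rw [norm_sq_sub_tangentSq]
  set w := u q - x with hw
  set V := LinearMap.range (du u q).toLinearMap
  have hd : 0 < ‖w‖ ^ 2 + s ^ 2 := by positivity
  obtain ⟨v, hv⟩ : V.starProjection w ∈ V := Submodule.starProjection_apply_mem _ _
  have h1 : ⟪V.starProjection w, H q⟫ = 0 := by rw [← hv]; exact hH v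
  have h2 : ⟪w, H q⟫ = ⟪w - V.starProjection w, H q⟫ := by
    rw [inner_sub_left w, h1, sub_zero]
  rw [radialField, ← hw, real_inner_smul_left, h2]
  have h3 := real_inner_le_norm (w - V.starProjection w) (H q)
  set a := ‖w - V.starProjection w‖
  set d := ‖w‖ ^ 2 + s ^ 2
  calc d⁻¹ * ⟪w - V.starProjection w, H q⟫ ≤ d⁻¹ * (a * ‖H q‖) := by gcongr
    _ = (a / d) * ‖H q‖ := by ring
    _ ≤ 2 * (a / d) ^ 2 + 1 / 8 * ‖H q‖ ^ 2 := by nlinarith [sq_nonneg (4 * (a / d) - ‖H q‖)]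
    _ = _ := by rw [div_pow]

variable [IsManifold (𝓡∂ 2) ∞ M] [MeasurableSpace M] [BorelSpace M] [CompactSpace M]

lemma integrable_of_bounded (hu : ContMDiff (𝓡∂ 2) 𝓘(ℝ, Euc n) 1 u) {g : M → ℝ}
    (hg : AEStronglyMeasurable g (area u)) {C : ℝ} (hC : ∀ q, |g q| ≤ C) :
    Integrable g (area u) := by
  have := isFiniteMeasure_area hu
  exact Integrable.of_bound hg C (Filter.Eventually.of_forall hC)

/-- The energy density of `u` at scale `s` around `x`. -/
def poissonDensity (u : M → Euc n) (s : ℝ) (x : Euc n) (q : M) : ℝ :=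
  s ^ 2 / (‖u q - x‖ ^ 2 + s ^ 2) ^ 2

omit [IsManifold (𝓡∂ 2) ∞ M] [MeasurableSpace M] [BorelSpace M] [CompactSpace M]
  [ChartedSpace (EuclideanHalfSpace 2) M] in
lemma continuous_poissonDensity (hu : Continuous u) {s : ℝ} (hs : 0 < s) (x : Euc n) :
    Continuous (poissonDensity u s x) := by
  unfold poissonDensity
  refine Continuous.div (by fun_prop) (by fun_prop) fun q => by positivity

omit [IsManifold (𝓡∂ 2) ∞ M] [MeasurableSpace M] [BorelSpace M] [CompactSpace M]
  [ChartedSpace (EuclideanHalfSpace 2) M] [TopologicalSpace M] in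
lemma poissonDensity_nonneg (u : M → Euc n) (s : ℝ) (x : Euc n) (q : M) :
    0 ≤ poissonDensity u s x q := by
  unfold poissonDensity; positivity

lemma integrable_poissonDensity (hu : ContMDiff (𝓡∂ 2) 𝓘(ℝ, Euc n) 1 u) {s : ℝ} (hs : 0 < s)
    (x : Euc n) : Integrable (poissonDensity u s x) (area u) := by
  refine integrable_of_bounded hu (continuous_poissonDensity hu.continuous hs x
    ).measurable.aestronglyMeasurable (C := 1 / s ^ 2) fun q => ?_
  rw [abs_of_nonneg (poissonDensity_nonneg _ _ _ _), poissonDensity,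
    div_le_div_iff₀ (by positivity) (by positivity)]
  nlinarith [mul_nonneg (sq_nonneg ‖u q - x‖) (sq_nonneg ‖u q - x‖),
    mul_nonneg (sq_nonneg ‖u q - x‖) (sq_nonneg s)]

lemma two_mul_integral_poissonDensity_le (hu : ContMDiff (𝓡∂ 2) 𝓘(ℝ, Euc n) 1 u)
    {H : M → Euc n} (hdiv : DivergenceIdentity u H) (hH2 : MemLp H 2 (area u)) {s : ℝ}
    (hs : 0 < s) (x : Euc n) {B : ℝ}
    (hB : (∫ p : (𝓡∂ 2).boundary M, ⟪radialField s x (u p), conormal u p⟫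
      ∂(boundaryLength u)) ≤ B) :
    2 * ∫ q, poissonDensity u s x q ∂(area u) ≤ (1 / 8) * (∫ q, ‖H q‖ ^ 2 ∂(area u)) + B := by
  have hcont := hu.continuous
  set g2 : M → ℝ := fun q =>
    (‖u q - x‖ ^ 2 - tangentSq u q (u q - x)) / (‖u q - x‖ ^ 2 + s ^ 2) ^ 2 with hg2
  have hw : Continuous fun q => u q - x := hcont.sub continuous_const
  have hg2i : Integrable g2 (area u) := by
    refine integrable_of_bounded hu ?_ (C := 1 / s ^ 2) fun q => ?_
    · have h1 := ((hw.norm.pow 2).measurable.aestronglyMeasurable (μ := area u)).sub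
        (aestronglyMeasurable_tangentSq hu hw)
      have hc : Continuous fun q => ((‖u q - x‖ ^ 2 + s ^ 2) ^ 2)⁻¹ :=
        Continuous.inv₀ (by fun_prop) fun q => by positivity
      have h2 := h1.mul (hc.measurable.aestronglyMeasurable (μ := area u))
      exact h2.congr (Filter.Eventually.of_forall fun q => by simp [hg2, div_eq_mul_inv])
    · have h0 : 0 ≤ ‖u q - x‖ ^ 2 - tangentSq u q (u q - x) := by
        rw [norm_sq_sub_tangentSq]; positivity
      have h1 : 0 ≤ tangentSq u q (u q - x) := sq_nonneg _
      simp only [hg2]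
      rw [abs_of_nonneg (by positivity), div_le_div_iff₀ (by positivity) (by positivity)]
      nlinarith [mul_nonneg (sq_nonneg ‖u q - x‖) (sq_nonneg ‖u q - x‖),
        mul_nonneg (sq_nonneg ‖u q - x‖) (sq_nonneg s), mul_nonneg h1 (sq_nonneg s),
        mul_nonneg (sq_nonneg s) (sq_nonneg s)]
  have hg1i := integrable_poissonDensity hu hs x
  have hdivint : ∫ q, surfaceDiv u (radialField s x) q ∂(area u) =
      2 * (∫ q, poissonDensity u s x q ∂(area u)) + 2 * ∫ q, g2 q ∂(area u) := by
    rw [← integral_const_mul, ← integral_const_mul, ← integral_add (hg1i.const_mul 2)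
      (hg2i.const_mul 2)]
    refine integral_congr_ae ?_
    filter_upwards [mem_ae_iff.2 (area_compl_immersedSet hu)] with q hq
    exact surfaceDiv_radialField hq hs x
  have hXc : Continuous fun q => radialField s x (u q) :=
    (contDiff_radialField hs x).continuous.comp hcont
  have hsq : Integrable (fun q => ‖H q‖ ^ 2) (area u) := hH2.integrable_norm_pow (by norm_num)
  have hXb : ∀ q, ‖radialField s x (u q)‖ ≤ 1 / s := by
    intro q
    have hd : 0 < ‖u q - x‖ ^ 2 + s ^ 2 := by positivity
    rw [radialField, norm_smul, Real.norm_of_nonneg (by positivity), inv_mul_eq_div,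
      div_le_div_iff₀ hd hs]
    nlinarith [sq_nonneg (‖u q - x‖ - s), sq_nonneg (‖u q - x‖)]
  have hXH : Integrable (fun q => ⟪radialField s x (u q), H q⟫) (area u) := by
    refine (hdiv.integrable.norm.const_mul (1 / s)).mono' ?_ (Filter.Eventually.of_forall ?_)
    · exact (hXc.measurable.aestronglyMeasurable).inner hdiv.integrable.aestronglyMeasurable
    · intro q
      refine (norm_inner_le_norm _ _).trans ?_
      exact mul_le_mul_of_nonneg_right (hXb q) (norm_nonneg _)
  have hXHle : ∫ q, ⟪radialField s x (u q), H q⟫ ∂(area u) ≤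
      2 * (∫ q, g2 q ∂(area u)) + (1 / 8) * ∫ q, ‖H q‖ ^ 2 ∂(area u) := by
    rw [← integral_const_mul, ← integral_const_mul, ← integral_add (hg2i.const_mul 2)
      (hsq.const_mul _)]
    refine integral_mono_ae hXH ((hg2i.const_mul 2).add (hsq.const_mul _)) ?_
    filter_upwards [hdiv.normal] with q hq
    exact inner_radialField_le hq hs x
  have hid := hdiv.identity _ (contDiff_radialField hs x)
  rw [hdivint] at hid
  linarith

end BulkInequality

/-! ### The normal form at a branch point, in a chart. -/

section BranchPoints

variable {n : ℕ} {M : Type*} [TopologicalSpace M] [ChartedSpace (EuclideanHalfSpace 2) M]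
  [IsManifold (𝓡∂ 2) ∞ M] {u : M → Euc n}

omit [IsManifold (𝓡∂ 2) ∞ M] in
lemma du_eq_chartDeriv (hu : ContMDiff (𝓡∂ 2) 𝓘(ℝ, Euc n) 1 u) (p : M) :
    du u p = chartDeriv u p (extChartAt (𝓡∂ 2) p p) := by
  have h := (hu.mdifferentiable one_ne_zero) p
  have h2 : HasFDerivWithinAt (u ∘ (extChartAt (𝓡∂ 2) p).symm) (du u p) (range (𝓡∂ 2))
      (extChartAt (𝓡∂ 2) p p) := h.hasMFDerivAt.2
  exact (h2.fderivWithin (uniqueDiffOn_half _ (mem_range_self _))).symm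

/-- The normal form of a branched immersion at a branch point, in the chart at that point. -/
lemma IsBranchPoint.exists_chart_form {p : M} (h : IsBranchPoint u p) :
    ∃ (k : ℕ) (g : Euc 2 → ℂ) (L : ℂ →ₗᵢ[ℝ] Euc n), 1 ≤ k ∧ g (extChartAt (𝓡∂ 2) p p) = 0 ∧
      (∀ᶠ y in 𝓝[range (𝓡∂ 2)] (extChartAt (𝓡∂ 2) p p),
        ContDiffWithinAt ℝ 1 g (range (𝓡∂ 2)) y ∧
        ContinuousWithinAt (fderivWithin ℝ g (range (𝓡∂ 2))) (range (𝓡∂ 2)) y ∧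
        (ContinuousLinearMap.adjoint L.toContinuousLinearMap)
          (u ((extChartAt (𝓡∂ 2) p).symm y) - u p) = g y ^ (k + 1)) ∧
      Function.Injective (fderivWithin ℝ g (range (𝓡∂ 2)) (extChartAt (𝓡∂ 2) p p)) ∧
      (fun y => u ((extChartAt (𝓡∂ 2) p).symm y) - u p - L (g y ^ (k + 1)))
        =o[𝓝[range (𝓡∂ 2)] (extChartAt (𝓡∂ 2) p p)] (fun y => g y ^ (k + 1)) := by
  obtain ⟨m, U, ζ, L, f, hm, hU, hpU, hζ, -, hbij, hζp, horth, hform, hf⟩ := h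
  obtain ⟨k, rfl⟩ : ∃ k, m = k + 1 := ⟨m - 1, by omega⟩
  set e := extChartAt (𝓡∂ 2) p
  have hep : e.symm (e p) = p := e.left_inv (mem_extChartAt_source p)
  have hsymm : Filter.Tendsto e.symm (𝓝[range (𝓡∂ 2)] (e p)) (𝓝 p) := by
    have h1 : ContinuousAt e.symm (e p) := continuousAt_extChartAt_symm p
    have h2 : Filter.Tendsto e.symm (𝓝 (e p)) (𝓝 (e.symm (e p))) := h1
    rw [hep] at h2
    exact h2.mono_left nhdsWithin_le_nhds
  have hUev : ∀ᶠ y in 𝓝[range (𝓡∂ 2)] (e p), e.symm y ∈ U := hsymm.eventually (hU.mem_nhds hpU)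
  have htev : ∀ᶠ y in 𝓝[range (𝓡∂ 2)] (e p), y ∈ e.target := extChartAt_target_mem_nhdsWithin p
  have hζat : ∀ q ∈ U, ContMDiffAt (𝓡∂ 2) 𝓘(ℝ, ℂ) 1 ζ q := fun q hq =>
    (hζ q hq).contMDiffAt (hU.mem_nhds hq)
  refine ⟨k, ζ ∘ e.symm, L, by omega, by simp [hep, hζp], ?_, ?_, ?_⟩
  · filter_upwards [hUev, htev] with y hyU hyt
    refine ⟨contDiffWithinAt_comp_symm hyt (hζat _ hyU),
      continuousWithinAt_fderivWithin_comp_symm hyt (hζat _ hyU), ?_⟩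
    rw [hform _ hyU]
    -- The values of f are orthogonal to the range of L, so the adjoint of L kills them and the
    -- planar component of u is a pure power.
    refine ext_inner_left ℝ fun z => ?_
    rw [ContinuousLinearMap.adjoint_inner_right, add_sub_right_comm, add_sub_cancel_left,
      inner_add_right]
    show ⟪L z, L _⟫ + ⟪L z, f _⟫ = _
    rw [horth, add_zero, L.inner_map_map]
    rfl
  · have h1 := fderivWithin_comp_symm (u := ζ) (mem_extChartAt_target (I := 𝓡∂ 2) p)
      (by rw [hep]; exact (hζat p hpU).mdifferentiableAt one_ne_zero)
    rw [h1]
    refine Function.Injective.comp (g := (mfderiv (𝓡∂ 2) 𝓘(ℝ, ℂ) ζ (e.symm (e p)) :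
      Euc 2 →L[ℝ] ℂ)) ?_ (symmDeriv_bijective (mem_extChartAt_target p)).1
    rw [hep]
    exact (hbij p hpU).1
  · have h1 := hf.comp_tendsto hsymm
    refine h1.congr' ?_ (Filter.Eventually.of_forall fun y => rfl)
    filter_upwards [hUev] with y hyU
    rw [hform _ hyU]
    simp only [Function.comp]
    abel

/-- A power of exponent at least 2 is o(|y - y₀|), and f is smaller still. -/
lemma IsBranchPoint.du_eq_zero (hu : ContMDiff (𝓡∂ 2) 𝓘(ℝ, Euc n) 1 u) {p : M}
    (h : IsBranchPoint u p) : du u p = 0 := by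
  obtain ⟨k, g, L, hk, hg0, hev, -, ho⟩ := h.exists_chart_form
  set e := extChartAt (𝓡∂ 2) p with he
  have hep : e.symm (e p) = p := e.left_inv (mem_extChartAt_source p)
  have hmem : e p ∈ range (𝓡∂ 2) := mem_range_self _
  have hgd : DifferentiableWithinAt ℝ g (range (𝓡∂ 2)) (e p) :=
    (hev.self_of_nhdsWithin hmem).1.differentiableWithinAt one_ne_zero
  have hgO : g =O[𝓝[range (𝓡∂ 2)] (e p)] fun y => y - e p := by
    have := hgd.hasFDerivWithinAt.isBigO_sub
    simpa [hg0] using this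
  have hgc : Filter.Tendsto g (𝓝[range (𝓡∂ 2)] (e p)) (𝓝 0) := by
    have := hgd.continuousWithinAt.tendsto
    rwa [hg0] at this
  have hgk : (fun y => g y ^ k) =o[𝓝[range (𝓡∂ 2)] (e p)] fun _ => (1 : ℝ) := by
    rw [Asymptotics.isLittleO_one_iff]
    have := hgc.pow k
    rwa [zero_pow (by omega)] at this
  have hpow : (fun y => g y ^ (k + 1)) =o[𝓝[range (𝓡∂ 2)] (e p)] fun y => y - e p := by
    have h1 := hgk.mul_isBigO hgO.norm_right
    refine (h1.congr (fun y => (pow_succ _ _).symm) fun y => one_mul _).of_norm_right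
  have hmain : (fun y => u (e.symm y) - u p) =o[𝓝[range (𝓡∂ 2)] (e p)] fun y => y - e p := by
    have h1 := ho.trans hpow
    have h2 : (fun y => L (g y ^ (k + 1))) =o[𝓝[range (𝓡∂ 2)] (e p)] fun y => y - e p :=
      (L.toContinuousLinearMap.isBigO_comp _ _).trans_isLittleO hpow
    exact (h1.add h2).congr_left fun y => by abel
  have hder : HasFDerivWithinAt (u ∘ e.symm) (0 : Euc 2 →L[ℝ] Euc n) (range (𝓡∂ 2)) (e p) := by
    rw [hasFDerivWithinAt_iff_isLittleO]
    simpa [hep] using hmain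
  rw [du_eq_chartDeriv hu]
  exact hder.fderivWithin (uniqueDiffOn_half _ hmem)

end BranchPoints

/-! ### The boundary flux. -/

section Boundary

variable {n : ℕ} {M : Type*} [TopologicalSpace M] [ChartedSpace (EuclideanHalfSpace 2) M]
  [IsManifold (𝓡∂ 2) ∞ M] {u : M → Euc n}

omit [IsManifold (𝓡∂ 2) ∞ M] in
lemma coord_pos_of_isInteriorPoint {p : M} (h : (𝓡∂ 2).IsInteriorPoint p) :
    0 < (extChartAt (𝓡∂ 2) p p) 0 := by
  rw [ModelWithCorners.isInteriorPoint_iff] at h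
  have h2 := interior_mono (extChartAt_target_subset_range p) h
  rw [interior_range_modelWithCornersEuclideanHalfSpace] at h2
  exact h2

lemma isBoundaryPoint_of_coord_eq_zero {p : M} {y : Euc 2}
    (hy : y ∈ (extChartAt (𝓡∂ 2) p).target) (h0 : y 0 = 0) :
    (𝓡∂ 2).IsBoundaryPoint ((extChartAt (𝓡∂ 2) p).symm y) := by
  have : IsManifold (𝓡∂ 2) 1 M := isManifold_one
  have hs := (extChartAt (𝓡∂ 2) p).map_target hy
  rw [extChartAt_source] at hs
  rw [ModelWithCorners.isBoundaryPoint_iff_not_isInteriorPoint,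
    (𝓡∂ 2).isInteriorPoint_iff_of_mem_atlas (one_ne_zero) (chart_mem_atlas _ p) hs]
  intro hint
  have h2 : (extChartAt (𝓡∂ 2) p) ((extChartAt (𝓡∂ 2) p).symm y) ∈
      interior (extChartAt (𝓡∂ 2) p).target := hint
  rw [(extChartAt (𝓡∂ 2) p).right_inv hy] at h2
  have h3 := interior_mono (extChartAt_target_subset_range p) h2
  rw [interior_range_modelWithCornersEuclideanHalfSpace] at h3
  have h4 : 0 < y 0 := h3
  linarith

omit [IsManifold (𝓡∂ 2) ∞ M] in
lemma coord_eq_zero_of_isBoundaryPoint {p : M} (h : (𝓡∂ 2).IsBoundaryPoint p) :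
    (extChartAt (𝓡∂ 2) p p) 0 = 0 := by
  have h1 : extChartAt (𝓡∂ 2) p p ∈ frontier (range (𝓡∂ 2)) := h
  rw [frontier_range_modelWithCornersEuclideanHalfSpace] at h1
  exact h1.symm

/-- The tangent of `u` along the boundary is tangent to `γ`. -/
lemma rejection_du_eq_zero (hu : ContMDiff (𝓡∂ 2) 𝓘(ℝ, Euc n) 1 u) {γ : ℝ → Euc n}
    (hγ : IsC1ClosedCurve γ) (himg : u '' ((𝓡∂ 2).boundary M) = range γ) {p : M}
    (hp : (𝓡∂ 2).IsBoundaryPoint p) {t : ℝ} (ht : γ t = u p) :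
    rejection (unitTangent γ t) (du u p (EuclideanSpace.single 1 1)) = 0 := by
  set e := extChartAt (𝓡∂ 2) p
  have hep : e.symm (e p) = p := e.left_inv (mem_extChartAt_source p)
  have h0 : (e p) 0 = 0 := coord_eq_zero_of_isBoundaryPoint hp
  -- The boundary line of the half-plane chart: `u` maps it into Γ, so its velocity there is tangent
  -- to Γ.
  set ℓ : ℝ → Euc 2 := fun τ => e p + τ • EuclideanSpace.single 1 1 with hℓ
  have hℓ0 : ∀ τ, (ℓ τ) 0 = 0 := fun τ => by simp [hℓ, h0]
  have hℓr : ∀ τ, ℓ τ ∈ range (𝓡∂ 2) := fun τ => mem_range_half_iff.2 (hℓ0 τ).ge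
  have hℓz : ℓ 0 = e p := by simp [hℓ]
  have hℓd : HasDerivAt ℓ (EuclideanSpace.single 1 1) 0 := by
    exact (((hasDerivAt_id (0 : ℝ)).smul_const
      (EuclideanSpace.single 1 1 : Euc 2)).const_add (e p)).congr_deriv (one_smul _ _)
  have hℓt : Filter.Tendsto ℓ (𝓝 0) (𝓝[range (𝓡∂ 2)] (e p)) := by
    refine tendsto_nhdsWithin_iff.2 ⟨?_, Filter.Eventually.of_forall hℓr⟩
    have := hℓd.continuousAt.tendsto
    rwa [hℓz] at this
  have hD : HasFDerivWithinAt (u ∘ e.symm) (chartDeriv u p (e p)) (range (𝓡∂ 2)) (ℓ 0) := by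
    rw [hℓz]
    exact ((contDiffWithinAt_comp_symm (mem_extChartAt_target p) (hu _)).differentiableWithinAt
      one_ne_zero).hasFDerivWithinAt
  have hc : HasDerivAt ((u ∘ e.symm) ∘ ℓ) (chartDeriv u p (e p) (EuclideanSpace.single 1 1)) 0 :=
    hD.comp_hasDerivAt 0 hℓd (Filter.Eventually.of_forall hℓr)
  rw [du_eq_chartDeriv hu]
  refine hγ.rejection_eq_zero hc ?_ ?_
  · filter_upwards [hℓt.eventually (extChartAt_target_mem_nhdsWithin p)] with τ hτ
    rw [← himg]
    exact ⟨_, isBoundaryPoint_of_coord_eq_zero hτ (hℓ0 τ), rfl⟩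
  · simp only [Function.comp, hℓz, hep, ht]

/-- The conormal has norm at most 1 and is orthogonal to the boundary tangent, so it sees only the
part of u p - x orthogonal to T. -/
lemma abs_inner_radialField_conormal_le (hu : IsBranchedImmersion u) {γ : ℝ → Euc n}
    (hγ : IsC1ClosedCurve γ) (himg : u '' ((𝓡∂ 2).boundary M) = range γ) {p : M}
    (hp : (𝓡∂ 2).IsBoundaryPoint p) {t : ℝ} (ht : γ t = u p) {s : ℝ} (hs : 0 < s) (x : Euc n) :
    |⟪radialField s x (u p), conormal u p⟫| ≤ fluxSpeed s x (γ t) (unitTangent γ t) := by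
  by_cases hinj : Function.Injective (du u p)
  · have hrej := rejection_du_eq_zero hu.contMDiff hγ himg hp ht
    set T := unitTangent γ t
    set a := du u p (EuclideanSpace.single 0 1) with ha
    set b := du u p (EuclideanSpace.single 1 1) with hb
    set w := (Submodule.span ℝ {b})ᗮ.starProjection a with hw
    have hν : conormal u p = (-‖w‖⁻¹) • w := rfl
    have hb0 : b ≠ 0 := by
      intro h
      have : (EuclideanSpace.single 1 1 : Euc 2) = 0 := hinj (by rw [← hb, h, map_zero])
      simp at this
    have hbT : b = ⟪T, b⟫ • T := by
      rw [rejection, sub_eq_zero] at hrej; exact hrej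
    have hTb : ⟪T, b⟫ ≠ 0 := fun h => hb0 (by rw [hbT, h, zero_smul])
    have hwb : ⟪b, w⟫ = 0 :=
      (Submodule.mem_orthogonal_singleton_iff_inner_right).1
        (Submodule.starProjection_apply_mem (Submodule.span ℝ {b})ᗮ a)
    have hTw : ⟪T, w⟫ = 0 := by
      rw [hbT, real_inner_smul_left] at hwb
      exact (mul_eq_zero.1 hwb).resolve_left hTb
    have hTν : ⟪T, conormal u p⟫ = 0 := by rw [hν, real_inner_smul_right, hTw, mul_zero]
    have hν1 : ‖conormal u p‖ ≤ 1 := by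
      rw [hν, norm_smul, norm_neg, norm_inv, norm_norm]
      exact inv_mul_le_one
    have h1 : ⟪u p - x, conormal u p⟫ = ⟪rejection T (u p - x), conormal u p⟫ := by
      rw [rejection, inner_sub_left (u p - x), real_inner_smul_left, hTν, mul_zero, sub_zero]
    rw [radialField, real_inner_smul_left, h1, abs_mul, abs_of_nonneg (by positivity), fluxSpeed,
      ht, inv_mul_eq_div]
    gcongr
    calc _ ≤ ‖rejection T (u p - x)‖ * ‖conormal u p‖ := abs_real_inner_le_norm _ _
      _ ≤ ‖rejection T (u p - x)‖ * 1 := by gcongr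
      _ = _ := mul_one _
  -- At a branch point `du` vanishes, and the formula for `conormal` then gives 0.
  · have hbr := (hu.immersed_or_branch p).resolve_left hinj
    have h0 := hbr.du_eq_zero hu.contMDiff
    have : conormal u p = 0 := by simp [conormal, h0]
    rw [this, inner_zero_right, abs_zero]
    exact fluxSpeed_nonneg _ _ _ _

lemma integral_conormal_le [CompactSpace M] [MeasurableSpace M] [BorelSpace M]
    (hu : IsBranchedImmersion u) {γ : ℝ → Euc n}
    (hγ : IsC1ClosedCurve γ) (hinj : InjOn u ((𝓡∂ 2).boundary M))
    (himg : u '' ((𝓡∂ 2).boundary M) = range γ) {s : ℝ} (hs : 0 < s) (x : Euc n) :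
    (∫ p : (𝓡∂ 2).boundary M, ⟪radialField s x (u p), conormal u p⟫ ∂(boundaryLength u)) ≤
      ∫ t in (0 : ℝ)..1, fluxSpeed s x (γ t) (unitTangent γ t) * ‖deriv γ t‖ := by
  have : IsManifold (𝓡∂ 2) 1 M := isManifold_one
  have hclosed : IsClosed ((𝓡∂ 2).boundary M) := (𝓡∂ 2).isClosed_boundary (n := 1) one_ne_zero
  have hcs : CompactSpace ((𝓡∂ 2).boundary M) := isCompact_iff_compactSpace.1 hclosed.isCompact
  set ub : (𝓡∂ 2).boundary M → Euc n := fun p => u p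
  have hubc : Continuous ub := hu.contMDiff.continuous.comp continuous_subtype_val
  have hube : MeasurableEmbedding ub :=
    (hubc.isClosedEmbedding fun a b h => Subtype.ext (hinj a.2 b.2 h)).measurableEmbedding
  -- The flux bound as a function of the point of Γ; by simplicity the supremum has a single term at
  -- each point of Γ. Its measurability is never needed, since `ub` is a measurable embedding.
  set g : Euc n → ℝ≥0∞ := fun y => ⨆ (t : ℝ) (_ : t ∈ Ico (0 : ℝ) 1 ∧ γ t = y),
    ENNReal.ofReal (fluxSpeed s x (γ t) (unitTangent γ t)) with hg
  have hgγ : ∀ t ∈ Ico (0 : ℝ) 1,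
      g (γ t) ≤ ENNReal.ofReal (fluxSpeed s x (γ t) (unitTangent γ t)) := by
    intro t ht
    refine iSup₂_le fun t' ht' => ?_
    rw [hγ.injOn ht'.1 ht ht'.2]
  have hrange : range ub = range γ := by
    rw [← himg]; ext y; simp [ub]
  have hpt : ∀ p : (𝓡∂ 2).boundary M,
      ENNReal.ofReal ‖⟪radialField s x (u p), conormal u p⟫‖ ≤ g (ub p) := by
    intro p
    obtain ⟨t, ht, htp⟩ := hγ.exists_mem_Ico (y := u p) (by rw [← himg]; exact ⟨p, p.2, rfl⟩)
    refine le_trans ?_ (le_iSup₂_of_le t ⟨ht, htp⟩ le_rfl)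
    exact ENNReal.ofReal_le_ofReal
      (abs_inner_radialField_conormal_le hu hγ himg p.2 htp hs x)
  have hcont := hγ.continuous_fluxSpeed_mul hs x
  have hnn : ∀ t, 0 ≤ fluxSpeed s x (γ t) (unitTangent γ t) * ‖deriv γ t‖ := fun t =>
    mul_nonneg (fluxSpeed_nonneg _ _ _ _) (norm_nonneg _)
  have hmain : ∫⁻ p : (𝓡∂ 2).boundary M,
      ENNReal.ofReal ‖⟪radialField s x (u p), conormal u p⟫‖ ∂(boundaryLength u) ≤
      ENNReal.ofReal (∫ t in (0 : ℝ)..1, fluxSpeed s x (γ t) (unitTangent γ t) * ‖deriv γ t‖) := by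
    calc _ ≤ ∫⁻ p, g (ub p) ∂(boundaryLength u) := lintegral_mono hpt
      _ = ∫⁻ y in range γ, g y ∂μH[1] := by
        rw [← hube.lintegral_map, boundaryLength, hube.map_comap, hrange]
      _ ≤ ∫⁻ t in Ico (0 : ℝ) 1, ‖deriv γ t‖ₑ * g (γ t) := hγ.lintegral_range_le g
      _ ≤ ∫⁻ t in Ico (0 : ℝ) 1,
          ENNReal.ofReal (fluxSpeed s x (γ t) (unitTangent γ t) * ‖deriv γ t‖) := by
        refine setLIntegral_mono' measurableSet_Ico fun t ht => ?_
        rw [mul_comm, ENNReal.ofReal_mul (fluxSpeed_nonneg _ _ _ _), ofReal_norm]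
        gcongr
        exact hgγ t ht
      _ = _ := by
        rw [intervalIntegral.integral_of_le zero_le_one, ofReal_integral_eq_lintegral_ofReal
          hcont.integrableOn_Ioc (Filter.Eventually.of_forall hnn)]
        exact setLIntegral_congr Ico_ae_eq_Ioc
  refine (Real.le_norm_self _).trans ((norm_integral_le_lintegral_norm _).trans ?_)
  refine ENNReal.toReal_le_of_le_ofReal ?_ hmain
  exact intervalIntegral.integral_nonneg zero_le_one fun t _ => hnn t

end Boundary

/-! ### Leading-order behaviour of u at a point. -/

section LocalModel

/-- Identifies the tangent plane isometrically with ℝ², so that an immersed point fits the model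
with k = 0. -/
lemma exists_isometric_model {n : ℕ} {D : Euc 2 →L[ℝ] Euc n} (hD : Function.Injective D) :
    ∃ A : Euc 2 →L[ℝ] Euc 2, (∀ w, ‖A w‖ = ‖D w‖) ∧ |A.det| = jacobian D := by
  set V := LinearMap.range D.toLinearMap
  have hfin : Module.finrank ℝ V = 2 := by
    have : Module.finrank ℝ V = Module.finrank ℝ (Euc 2) := LinearMap.finrank_range_of_inj hD
    simpa using this
  let b : OrthonormalBasis (Fin 2) ℝ V := (stdOrthonormalBasis ℝ V).reindex (finCongr hfin)
  let A : Euc 2 →L[ℝ] Euc 2 := LinearMap.toContinuousLinearMap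
    (b.repr.toLinearEquiv.toLinearMap ∘ₗ D.toLinearMap.rangeRestrict)
  have hA : ∀ w, A w = b.repr (D.toLinearMap.rangeRestrict w) := fun w => rfl
  have hin : ∀ v w, ⟪A v, A w⟫ = ⟪D v, D w⟫ := by
    intro v w
    rw [hA, hA, LinearIsometryEquiv.inner_map_map]
    rfl
  have hn : ∀ w, ‖A w‖ = ‖D w‖ := by
    intro w
    rw [hA, LinearIsometryEquiv.norm_map]
    rfl
  refine ⟨A, hn, ?_⟩
  rw [← jacobian_eq_abs_det, jacobian_eq_sqrt_gram, jacobian_eq_sqrt_gram]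
  simp only [gram, hn, hin]

lemma gram_complex_mul (c z w : ℂ) : gram (z * c) (w * c) = ‖c‖ ^ 4 * gram z w := by
  have h : ⟪z * c, w * c⟫ = ‖c‖ ^ 2 * ⟪z, w⟫ := by
    rw [Complex.inner, Complex.inner, ← Complex.normSq_eq_norm_sq, Complex.normSq_apply]
    simp
    ring
  unfold gram
  rw [h, norm_mul, norm_mul]
  ring

/-- The standard identification of `ℂ` with the Euclidean plane. -/
def complexIso : ℂ ≃ₗᵢ[ℝ] Euc 2 := Complex.orthonormalBasisOneI.repr

lemma abs_det_complexIso_comp (A : Euc 2 →L[ℝ] ℂ) :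
    |((complexIso.toContinuousLinearEquiv : ℂ →L[ℝ] Euc 2) ∘L A).det| = Real.sqrt
      (gram (A (EuclideanSpace.single 0 1)) (A (EuclideanSpace.single 1 1))) := by
  rw [← jacobian_eq_abs_det, jacobian_eq_sqrt_gram]
  congr 1
  simp only [gram]
  show ‖complexIso _‖ ^ 2 * ‖complexIso _‖ ^ 2 - ⟪complexIso _, complexIso _⟫ ^ 2 = _
  rw [LinearIsometryEquiv.norm_map, LinearIsometryEquiv.norm_map,
    LinearIsometryEquiv.inner_map_map]
  rfl

variable {n : ℕ} {M : Type*} [TopologicalSpace M] [ChartedSpace (EuclideanHalfSpace 2) M]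
  [IsManifold (𝓡∂ 2) ∞ M] {u : M → Euc n}

lemma tendsto_line {E : Type*} [NormedAddCommGroup E] [NormedSpace ℝ E] {R : Set E} {y₀ w : E}
    (h : ∀ᶠ c in 𝓝[>] (0 : ℝ), y₀ + c • w ∈ R) :
    Filter.Tendsto (fun c : ℝ => y₀ + c • w) (𝓝[>] 0) (𝓝[R] y₀) := by
  refine tendsto_nhdsWithin_iff.2 ⟨?_, h⟩
  have : Filter.Tendsto (fun c : ℝ => y₀ + c • w) (𝓝 0) (𝓝 (y₀ + (0 : ℝ) • w)) :=
    Continuous.tendsto (by fun_prop) _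
  rw [zero_smul, add_zero] at this
  exact this.mono_left nhdsWithin_le_nhds

lemma tendsto_inv_smul_line {E F : Type*} [NormedAddCommGroup E] [NormedSpace ℝ E]
    [NormedAddCommGroup F] [NormedSpace ℝ F] {R : Set E} {y₀ w : E} {g : E → F} {A : E →L[ℝ] F}
    (hg : HasFDerivWithinAt g A R y₀) (h : ∀ᶠ c in 𝓝[>] (0 : ℝ), y₀ + c • w ∈ R) :
    Filter.Tendsto (fun c : ℝ => c⁻¹ • (g (y₀ + c • w) - g y₀)) (𝓝[>] 0) (𝓝 (A w)) := by
  have hd : Filter.Tendsto (fun c : ℝ => c • w) (𝓝[>] 0) (𝓝 0) := by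
    have : Filter.Tendsto (fun c : ℝ => c • w) (𝓝 0) (𝓝 ((0 : ℝ) • w)) :=
      Continuous.tendsto (by fun_prop) _
    rw [zero_smul] at this
    exact this.mono_left nhdsWithin_le_nhds
  refine hg.lim (c := fun c => c⁻¹) (d := fun c => c • w) hd h ?_
  refine tendsto_const_nhds.congr' ?_
  filter_upwards [self_mem_nhdsWithin] with c hc
  rw [smul_smul, inv_mul_cancel₀ (ne_of_gt hc), one_smul]

/-- At a branch point f is o(|ζ|^m) with no control of its derivative, so the area density is only
bounded below, by the Jacobian of the planar component g^(k+1). This suffices for lower density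
bounds. The limits are taken along rays that stay in the half-plane: all rays at an interior point,
half of them at a boundary point. -/
lemma IsBranchedImmersion.exists_local_model (hu : IsBranchedImmersion u) (p : M) :
    ∃ (k : ℕ) (A : Euc 2 →L[ℝ] Euc 2) (j : Euc 2 → ℝ), A.det ≠ 0 ∧
      (¬ Function.Injective (du u p) → 1 ≤ k) ∧
      (∀ᶠ y in 𝓝[range (𝓡∂ 2)] (extChartAt (𝓡∂ 2) p p), j y ≤ chartJacobian u p y) ∧
      ∀ w, (∀ᶠ c in 𝓝[>] (0 : ℝ), extChartAt (𝓡∂ 2) p p + c • w ∈ range (𝓡∂ 2)) →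
        Filter.Tendsto (fun c : ℝ => j (extChartAt (𝓡∂ 2) p p + c • w) / c ^ (2 * k)) (𝓝[>] 0)
          (𝓝 ((k + 1) ^ 2 * ‖A w‖ ^ (2 * k) * |A.det|)) ∧
        Filter.Tendsto (fun c : ℝ => ‖u ((extChartAt (𝓡∂ 2) p).symm
          (extChartAt (𝓡∂ 2) p p + c • w)) - u p‖ / c ^ (k + 1)) (𝓝[>] 0)
          (𝓝 (‖A w‖ ^ (k + 1))) := by
  set e := extChartAt (𝓡∂ 2) p with he
  have hep : e.symm (e p) = p := e.left_inv (mem_extChartAt_source p)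
  have hmem : e p ∈ range (𝓡∂ 2) := mem_range_self _
  have hct := hu.contMDiff
  have hD : ∀ y ∈ e.target,
      HasFDerivWithinAt (u ∘ e.symm) (chartDeriv u p y) (range (𝓡∂ 2)) y := fun y hy =>
    ((contDiffWithinAt_comp_symm hy (hct _)).differentiableWithinAt one_ne_zero).hasFDerivWithinAt
  by_cases hinj : Function.Injective (du u p)
  · have hinj' : Function.Injective (chartDeriv u p (e p)) := by
      rw [← du_eq_chartDeriv hct]; exact hinj
    obtain ⟨A, hA, hdet⟩ := exists_isometric_model hinj'
    refine ⟨0, A, chartJacobian u p, ?_, fun h => absurd hinj h,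
      Filter.Eventually.of_forall fun y => le_rfl, fun w hw => ⟨?_, ?_⟩⟩
    · rw [← abs_ne_zero, hdet]; exact (jacobian_ne_zero_iff _).2 hinj'
    · have h := (continuousWithinAt_chartJacobian hct (mem_extChartAt_target p)).tendsto.comp
        (tendsto_line hw)
      simp only [mul_zero, pow_zero, div_one, Nat.cast_zero, zero_add, one_pow, one_mul, hdet]
      exact h
    · have h := (tendsto_inv_smul_line (hD _ (mem_extChartAt_target p)) hw).norm
      simp only [zero_add, pow_one, hA]
      refine h.congr' ?_
      filter_upwards [self_mem_nhdsWithin] with c hc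
      have hc' : 0 < c := hc
      rw [norm_smul, norm_inv, Real.norm_of_nonneg hc'.le, inv_mul_eq_div, Function.comp,
        Function.comp, hep]
  · obtain ⟨k, g, L, hk, hg0, hev, hAinj, ho⟩ :=
      ((hu.immersed_or_branch p).resolve_left hinj).exists_chart_form
    set A₀ := fderivWithin ℝ g (range (𝓡∂ 2)) (e p)
    set B : Euc n →L[ℝ] ℂ := ContinuousLinearMap.adjoint L.toContinuousLinearMap
    set J : ℂ →L[ℝ] Euc 2 := (complexIso.toContinuousLinearEquiv : ℂ →L[ℝ] Euc 2)
    have hJ : ∀ z, ‖J z‖ = ‖z‖ := fun z => complexIso.norm_map z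
    have hB : ∀ x, ‖B x‖ ≤ ‖x‖ := by
      intro x
      refine (B.le_opNorm x).trans ?_
      have : ‖B‖ ≤ 1 := by
        rw [LinearIsometryEquiv.norm_map]
        exact L.norm_toContinuousLinearMap_le
      exact mul_le_of_le_one_left (norm_nonneg _) this
    have hgD : HasFDerivWithinAt g A₀ (range (𝓡∂ 2)) (e p) :=
      ((hev.self_of_nhdsWithin hmem).1.differentiableWithinAt one_ne_zero).hasFDerivWithinAt
    refine ⟨k, J ∘L A₀, fun y => ((k + 1) * ‖g y‖ ^ k) ^ 2 *
      |(J ∘L fderivWithin ℝ g (range (𝓡∂ 2)) y).det|, ?_, fun _ => hk, ?_, fun w hw => ?_⟩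
    · rw [← abs_ne_zero, ← jacobian_eq_abs_det, jacobian_ne_zero_iff]
      exact complexIso.injective.comp hAinj
    · filter_upwards [eventually_eventually_nhdsWithin.2 hev, hev, self_mem_nhdsWithin,
        extChartAt_target_mem_nhdsWithin p] with y h1 h2 hyr hyt
      set G := fderivWithin ℝ g (range (𝓡∂ 2)) y
      set c : ℂ := ((k + 1 : ℕ) : ℂ) * g y ^ k with hc
      have hgy : HasFDerivWithinAt g G (range (𝓡∂ 2)) y :=
        (h2.1.differentiableWithinAt one_ne_zero).hasFDerivWithinAt
      have hpow := ((hasDerivAt_pow (k + 1) (g y)).hasFDerivAt.restrictScalars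
        ℝ).comp_hasFDerivWithinAt y hgy
      have hBu := B.hasFDerivAt.comp_hasFDerivWithinAt y ((hD y hyt).sub_const (u p))
      have heq : (fun y => B ((u ∘ e.symm) y - u p)) =ᶠ[𝓝[range (𝓡∂ 2)] y]
          fun y => g y ^ (k + 1) := by
        filter_upwards [h1] with z hz using hz.2.2
      have hBu' := hBu.congr_of_eventuallyEq heq.symm (h2.2.2).symm
      have huniq := (uniqueDiffOn_half y hyr).eq hBu' hpow
      -- Differentiating the planar component: multiplication by the complex number `c` scales areas
      -- by |c|².
      have hv : ∀ v, B (chartDeriv u p y v) = G v * c := by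
        intro v
        have := congrArg (fun T : Euc 2 →L[ℝ] ℂ => T v) huniq
        simpa [hc] using this
      have hle := abs_det_comp_le_jacobian (chartDeriv u p y) (J ∘L B) fun x =>
        (hJ _).trans_le (hB x)
      refine le_trans (le_of_eq ?_) hle
      rw [ContinuousLinearMap.comp_assoc, abs_det_complexIso_comp, abs_det_complexIso_comp]
      simp only [ContinuousLinearMap.comp_apply, hv]
      rw [gram_complex_mul, Real.sqrt_mul (by positivity),
        show ‖c‖ ^ 4 = (‖c‖ ^ 2) ^ 2 by ring, Real.sqrt_sq (by positivity)]
      congr 2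
      rw [hc, norm_mul, norm_pow, Complex.norm_natCast]
      push_cast; rfl
    · have hline := tendsto_line hw
      have hglim : Filter.Tendsto (fun c : ℝ => c⁻¹ • g (e p + c • w)) (𝓝[>] 0) (𝓝 (A₀ w)) := by
        have := tendsto_inv_smul_line hgD hw
        have hg0' : g (e p) = 0 := hg0
        simpa only [hg0', sub_zero] using this
      constructor
      · have hGc : Filter.Tendsto (fun c : ℝ =>
            |(J ∘L fderivWithin ℝ g (range (𝓡∂ 2)) (e p + c • w)).det|) (𝓝[>] 0)
            (𝓝 |(J ∘L A₀).det|) := by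
          have h1 := (hev.self_of_nhdsWithin hmem).2.1.tendsto.comp hline
          have h2 : Continuous fun G : Euc 2 →L[ℝ] ℂ => |(J ∘L G).det| := by
            simp only [J, abs_det_complexIso_comp]
            unfold gram
            fun_prop
          exact (h2.tendsto _).comp h1
        have hlim := ((hglim.norm.pow (2 * k)).const_mul ((k + 1 : ℝ) ^ 2)).mul hGc
        have hval : ‖(J ∘L A₀) w‖ = ‖A₀ w‖ := hJ _
        rw [hval]
        refine hlim.congr' ?_
        filter_upwards [self_mem_nhdsWithin] with c hc
        have hc' : 0 < c := hc
        rw [norm_smul, norm_inv, Real.norm_of_nonneg hc'.le, inv_mul_eq_div, div_pow]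
        field_simp
        ring
      · have hval : ‖(J ∘L A₀) w‖ = ‖A₀ w‖ := hJ _
        have hLlim : Filter.Tendsto (fun c : ℝ => L ((c⁻¹ • g (e p + c • w)) ^ (k + 1))) (𝓝[>] 0)
            (𝓝 (L (A₀ w ^ (k + 1)))) :=
          (L.continuous.tendsto _).comp (hglim.pow (k + 1))
        have ho1 := ho.comp_tendsto hline
        have hgO : (fun c : ℝ => g (e p + c • w) ^ (k + 1)) =O[𝓝[>] 0]
            fun c : ℝ => c ^ (k + 1) := by
          have h1 : (fun c : ℝ => c⁻¹ • g (e p + c • w)) =O[𝓝[>] 0] fun _ => (1 : ℝ) :=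
            hglim.isBigO_one ℝ
          have h2 : (fun c : ℝ => g (e p + c • w)) =O[𝓝[>] 0] fun c : ℝ => c := by
            have h3 := (Asymptotics.isBigO_refl (fun c : ℝ => c) (𝓝[>] 0)).smul h1
            refine (h3.congr' ?_ ?_)
            · filter_upwards [self_mem_nhdsWithin] with c hc
              rw [smul_smul, mul_inv_cancel₀ (ne_of_gt hc), one_smul]
            · exact Filter.Eventually.of_forall fun c => by simp
          exact h2.pow (k + 1)
        have ho2 := (ho1.trans_isBigO hgO).norm_left.tendsto_div_nhds_zero
        have herr : Filter.Tendsto (fun c : ℝ => (c ^ (k + 1))⁻¹ •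
            (u (e.symm (e p + c • w)) - u p - L (g (e p + c • w) ^ (k + 1)))) (𝓝[>] 0) (𝓝 0) := by
          rw [tendsto_zero_iff_norm_tendsto_zero]
          refine ho2.congr' ?_
          filter_upwards [self_mem_nhdsWithin] with c hc
          have hc' : 0 < c := hc
          rw [norm_smul, norm_inv, Real.norm_of_nonneg (by positivity), inv_mul_eq_div]
          rfl
        have hsum := (herr.add hLlim).norm
        rw [zero_add, L.norm_map, norm_pow] at hsum
        rw [hval]
        refine hsum.congr' ?_
        filter_upwards [self_mem_nhdsWithin] with c hc
        have hc' : 0 < c := hc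
        have e1 : (c⁻¹ • g (e p + c • w)) ^ (k + 1) =
            (c ^ (k + 1))⁻¹ • g (e p + c • w) ^ (k + 1) := by
          rw [smul_pow, inv_pow]
        rw [e1, L.map_smul, ← smul_add, sub_add_cancel, norm_smul, norm_inv,
          Real.norm_of_nonneg (by positivity), inv_mul_eq_div]

end LocalModel

/-! ### Lower bounds for the Poisson mass near a point. -/

section LocalDensity

variable {n : ℕ} {M : Type*} [TopologicalSpace M] [ChartedSpace (EuclideanHalfSpace 2) M]
  [IsManifold (𝓡∂ 2) ∞ M] [MeasurableSpace M] [BorelSpace M] {u : M → Euc n}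

lemma measurable_indicator_of_continuousOn {X Y : Type*} [TopologicalSpace X] [MeasurableSpace X]
    [OpensMeasurableSpace X] [TopologicalSpace Y] [MeasurableSpace Y] [BorelSpace Y] [Zero Y]
    {f : X → Y} {T : Set X} (hf : ContinuousOn f T) (hT : MeasurableSet T) :
    Measurable (T.indicator f) := by
  classical
  rw [← Set.piecewise_eq_indicator]
  exact hf.measurable_piecewise continuousOn_const hT

lemma tendsto_rpow_inv_nhdsGT (k : ℕ) :
    Filter.Tendsto (fun s : ℝ => s ^ ((k + 1 : ℝ)⁻¹)) (𝓝[>] 0) (𝓝[>] 0) := by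
  have hk : (0 : ℝ) < (k + 1 : ℝ)⁻¹ := by positivity
  refine tendsto_nhdsWithin_iff.2 ⟨?_, ?_⟩
  · have h := (Real.continuousAt_rpow_const 0 ((k + 1 : ℝ)⁻¹) (Or.inr hk.le)).tendsto
    rw [Real.zero_rpow hk.ne'] at h
    exact h.mono_left nhdsWithin_le_nhds
  · filter_upwards [self_mem_nhdsWithin] with s hs
    exact Real.rpow_pos_of_pos hs _

/-- Since |u - u p| grows like the power k + 1 of the distance in the chart, scale `s` in the target
matches scale s^(1/(k+1)) in the chart. After this rescaling the integrand has a liminf at least the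
model density, and Fatou's lemma applies. -/
lemma IsBranchedImmersion.exists_lintegral_le_liminf (hu : IsBranchedImmersion u) (p : M)
    {V : Set M} (hV : IsOpen V) (hpV : p ∈ V) :
    ∃ (k : ℕ) (A : Euc 2 →L[ℝ] Euc 2), A.det ≠ 0 ∧ (¬ Function.Injective (du u p) → 1 ≤ k) ∧
      ∀ Ω : Set (Euc 2), MeasurableSet Ω →
        (∀ w ∈ Ω, ∀ᶠ c in 𝓝[>] (0 : ℝ), extChartAt (𝓡∂ 2) p p + c • w ∈ range (𝓡∂ 2)) →
        ∫⁻ w in Ω, ENNReal.ofReal (modelDensity k ‖A w‖ * |A.det|) ≤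
          Filter.liminf (fun s => ∫⁻ q in V, ENNReal.ofReal (poissonDensity u s (u p) q)
            ∂(area u)) (𝓝[>] (0 : ℝ)) := by
  obtain ⟨k, A, j, hA, hk, hj, hlim⟩ := hu.exists_local_model p
  refine ⟨k, A, hA, hk, fun Ω hΩm hΩ => ?_⟩
  set e := extChartAt (𝓡∂ 2) p
  have hep : e.symm (e p) = p := e.left_inv (mem_extChartAt_source p)
  have hct := hu.contMDiff
  set T := e.target ∩ e.symm ⁻¹' V with hT
  have hTm : MeasurableSet T := measurableSet_inter_preimage (continuousOn_extChartAt_symm p)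
    (measurableSet_extChartAt_target p) hV.measurableSet
  set F : ℝ → Euc 2 → ℝ≥0∞ := fun s y =>
    ENNReal.ofReal (chartJacobian u p y) *
      ENNReal.ofReal (poissonDensity u s (u p) (e.symm y)) with hF
  set f : ℝ → Euc 2 → ℝ≥0∞ := fun s => if 0 < s then T.indicator (F s) else 0 with hf
  have hfm : ∀ s, Measurable (f s) := by
    intro s
    by_cases hs : 0 < s
    · simp only [hf, hs, if_true]
      have hc1 : ContinuousOn (fun y => ENNReal.ofReal (chartJacobian u p y)) e.target :=
        ENNReal.continuous_ofReal.comp_continuousOn (continuousOn_chartJacobian hct p)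
      have hc2 : ContinuousOn (fun y => ENNReal.ofReal (poissonDensity u s (u p) (e.symm y)))
          e.target := (ENNReal.continuous_ofReal.comp
            (continuous_poissonDensity hct.continuous hs (u p))).comp_continuousOn
              (continuousOn_extChartAt_symm p)
      have m1 := measurable_indicator_of_continuousOn (hc1.mono inter_subset_left) hTm
      have m2 := measurable_indicator_of_continuousOn (hc2.mono inter_subset_left) hTm
      simp only [hF]
      rw [Set.indicator_mul]
      exact m1.mul m2
    · simp only [hf, hs, if_false]; exact measurable_const
  have hTev : ∀ᶠ y in 𝓝[range (𝓡∂ 2)] (e p), y ∈ T := by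
    have hsymm : Filter.Tendsto e.symm (𝓝[range (𝓡∂ 2)] (e p)) (𝓝 p) := by
      have h1 : ContinuousAt e.symm (e p) := continuousAt_extChartAt_symm p
      have h2 : Filter.Tendsto e.symm (𝓝 (e p)) (𝓝 (e.symm (e p))) := h1
      rw [hep] at h2
      exact h2.mono_left nhdsWithin_le_nhds
    filter_upwards [extChartAt_target_mem_nhdsWithin p, hsymm.eventually (hV.mem_nhds hpV)]
      with y h1 h2 using ⟨h1, h2⟩
  rw [← lintegral_indicator hΩm]
  refine (lintegral_le_liminf_of_rescaled (volume : Measure (Euc 2)) (e p) hfm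
    (c := fun s => s ^ ((k + 1 : ℝ)⁻¹)) (fun s hs => Real.rpow_pos_of_pos hs _)
    (Filter.Eventually.of_forall fun w => ?_)).trans (Filter.liminf_le_liminf ?_)
  · by_cases hw : w ∈ Ω
    swap
    · rw [indicator_of_notMem hw]; exact bot_le
    rw [indicator_of_mem hw]
    obtain ⟨h1, h2⟩ := hlim w (hΩ w hw)
    have hline := tendsto_line (hΩ w hw)
    have hmain : Filter.Tendsto (fun c : ℝ => j (e p + c • w) / c ^ (2 * k) /
        ((‖u (e.symm (e p + c • w)) - u p‖ / c ^ (k + 1)) ^ 2 + 1) ^ 2) (𝓝[>] 0)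
        (𝓝 (modelDensity k ‖A w‖ * |A.det|)) := by
      have h3 := h1.div (((h2.pow 2).add_const 1).pow 2) (by positivity)
      have hval : modelDensity k ‖A w‖ * |A.det| = (k + 1) ^ 2 * ‖A w‖ ^ (2 * k) * |A.det| /
          ((‖A w‖ ^ (k + 1)) ^ 2 + 1) ^ 2 := by
        unfold modelDensity
        rw [show ‖A w‖ ^ (2 * k + 2) = (‖A w‖ ^ (k + 1)) ^ 2 by ring]
        ring
      rw [hval]
      exact h3
    have hmain' := ((ENNReal.continuous_ofReal.tendsto _).comp hmain).comp
      (tendsto_rpow_inv_nhdsGT k)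
    rw [← hmain'.liminf_eq]
    refine Filter.liminf_le_liminf ?_
    have hevs := (tendsto_rpow_inv_nhdsGT k).eventually
      ((hline.eventually hTev).and (hline.eventually hj))
    filter_upwards [hevs, self_mem_nhdsWithin] with s hs hs0
    have hs0' : 0 < s := hs0
    set c := s ^ ((k + 1 : ℝ)⁻¹) with hc
    have hc0 : 0 < c := Real.rpow_pos_of_pos hs0' _
    have hcs : c ^ (k + 1) = s := by
      rw [hc, ← Real.rpow_natCast, ← Real.rpow_mul hs0'.le]
      push_cast
      rw [inv_mul_cancel₀ (by positivity), Real.rpow_one]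
    simp only [hf, hs0', if_true, Function.comp, finrank_euclideanSpace, Fintype.card_fin]
    rw [indicator_of_mem hs.1]
    simp only [hF]
    set y := e p + c • w
    set P := poissonDensity u s (u p) (e.symm y) with hP
    have hP0 : 0 ≤ P := poissonDensity_nonneg _ _ _ _
    have heq : j y / c ^ (2 * k) / ((‖u (e.symm y) - u p‖ / c ^ (k + 1)) ^ 2 + 1) ^ 2 =
        c ^ 2 * (j y * P) := by
      rw [hP, poissonDensity, ← hcs]
      field_simp
      ring
    rw [← hc, heq, ENNReal.ofReal_mul (by positivity), ENNReal.ofReal_mul' hP0]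
    gcongr
    exact hs.2
  · filter_upwards [self_mem_nhdsWithin] with s hs
    have hs' : 0 < s := hs
    simp only [hf, hs', if_true]
    rw [lintegral_indicator hTm]
    have h1 := setLIntegral_chartArea hct p (g := fun q =>
      ENNReal.ofReal (poissonDensity u s (u p) q)) (ENNReal.measurable_ofReal.comp
        (continuous_poissonDensity hct.continuous hs' (u p)).measurable) hV.measurableSet
    rw [← h1]
    exact lintegral_mono' (Measure.restrict_mono le_rfl (chartArea_le_area u p)) le_rfl

/-- The density of `u` at an interior point is at least `1`, and at least `2` at a branch point. -/
lemma IsBranchedImmersion.exists_interior_density (hu : IsBranchedImmersion u) {p : M}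
    (hp : (𝓡∂ 2).IsInteriorPoint p) {V : Set M} (hV : IsOpen V) (hpV : p ∈ V) :
    ∃ k : ℕ, (¬ Function.Injective (du u p) → 1 ≤ k) ∧
      ENNReal.ofReal ((k + 1) * Real.pi) ≤
        Filter.liminf (fun s => ∫⁻ q in V, ENNReal.ofReal (poissonDensity u s (u p) q)
          ∂(area u)) (𝓝[>] (0 : ℝ)) := by
  obtain ⟨k, A, hA, hk, h⟩ := hu.exists_lintegral_le_liminf p hV hpV
  refine ⟨k, hk, ?_⟩
  have h1 := h univ MeasurableSet.univ fun w _ => ?_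
  · rwa [Measure.restrict_univ, lintegral_modelDensity_comp k A hA] at h1
  · have hpos := coord_pos_of_isInteriorPoint hp
    have ht : Filter.Tendsto (fun c : ℝ => (extChartAt (𝓡∂ 2) p p + c • w) 0) (𝓝[>] 0)
        (𝓝 ((extChartAt (𝓡∂ 2) p p) 0)) := by
      have : Filter.Tendsto (fun c : ℝ => (extChartAt (𝓡∂ 2) p p + c • w) 0) (𝓝 0)
          (𝓝 ((extChartAt (𝓡∂ 2) p p + (0 : ℝ) • w) 0)) := Continuous.tendsto (by fun_prop) _
      rw [zero_smul, add_zero] at this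
      exact this.mono_left nhdsWithin_le_nhds
    filter_upwards [ht.eventually_const_lt hpos] with c hc
    exact mem_range_half_iff.2 hc.le

/-- The density of `u` at a boundary point is at least `1/2`. -/
lemma IsBranchedImmersion.boundary_density (hu : IsBranchedImmersion u) {p : M}
    (hp : (𝓡∂ 2).IsBoundaryPoint p) {V : Set M} (hV : IsOpen V) (hpV : p ∈ V) :
    ENNReal.ofReal Real.pi ≤
      2 * Filter.liminf (fun s => ∫⁻ q in V, ENNReal.ofReal (poissonDensity u s (u p) q)
          ∂(area u)) (𝓝[>] (0 : ℝ)) := by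
  obtain ⟨k, A, hA, hk, h⟩ := hu.exists_lintegral_le_liminf p hV hpV
  have h1 := h {w | 0 < w 0} (measurableSet_lt measurable_const (by fun_prop)) fun w hw => ?_
  · have h2 := ofReal_le_two_mul_setLIntegral_half
      (G := fun w => ENNReal.ofReal (modelDensity k ‖A w‖ * |A.det|))
      (fun w => by rw [map_neg, norm_neg])
    rw [lintegral_modelDensity_comp k A hA] at h2
    calc ENNReal.ofReal Real.pi ≤ ENNReal.ofReal ((k + 1) * Real.pi) := by
          refine ENNReal.ofReal_le_ofReal ?_
          nlinarith [Real.pi_pos, (Nat.cast_nonneg k : (0 : ℝ) ≤ k)]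
      _ ≤ _ := h2
      _ ≤ _ := by gcongr
  · have h0 := coord_eq_zero_of_isBoundaryPoint hp
    filter_upwards [self_mem_nhdsWithin] with c hc
    refine mem_range_half_iff.2 ?_
    have hc' : 0 < c := hc
    have hw' : 0 < w 0 := hw
    have : (extChartAt (𝓡∂ 2) p p + c • w) 0 = c * w 0 := by
      rw [PiLp.add_apply, PiLp.smul_apply, h0, smul_eq_mul, zero_add]
    rw [this]; positivity

end LocalDensity

/-! ### The flux bounded by total curvature minus defect. -/

section Curve

variable {n : ℕ} {γ : ℝ → Euc n}

lemma IsC1ClosedCurve.integral_fluxSpeed_le (hγ : IsC1ClosedCurve γ) {V : ℝ} (hV0 : 0 ≤ V)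
    (hV : totalCurvature γ ≤ ENNReal.ofReal V) {s : ℝ} (hs : 0 < s) (x : Euc n) :
    (∫ t in (0 : ℝ)..1, fluxSpeed s x (γ t) (unitTangent γ t) * ‖deriv γ t‖) ≤
      V - ∫ t in (0 : ℝ)..1, coneDefect γ s x t := by
  have h1 := integral_coneSpeed_le hγ.contDiff hγ.deriv_ne_zero hγ.periodic
    (sum_norm_unitTangent_sub_le hV0 hV) hs x
  have h2 : (∫ t in (0 : ℝ)..1, coneDefect γ s x t) =
      (∫ t in (0 : ℝ)..1, coneSpeed s x (γ t) (unitTangent γ t) * ‖deriv γ t‖) -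
      ∫ t in (0 : ℝ)..1, fluxSpeed s x (γ t) (unitTangent γ t) * ‖deriv γ t‖ :=
    intervalIntegral.integral_sub
      ((continuous_coneSpeed_mul hγ.contDiff hγ.deriv_ne_zero hs x).intervalIntegrable _ _)
      ((hγ.continuous_fluxSpeed_mul hs x).intervalIntegrable _ _)
  linarith

lemma IsC1ClosedCurve.integral_coneDefect_nonneg (hγ : IsC1ClosedCurve γ) (s : ℝ) (x : Euc n) :
    0 ≤ ∫ t in (0 : ℝ)..1, coneDefect γ s x t :=
  intervalIntegral.integral_nonneg zero_le_one fun t _ => hγ.coneDefect_nonneg s x t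

end Curve

/-! ### The constants C(p) and α, and Hölder's inequality. -/

section Exponents

/-- The only property of C(p) that is used: it lets the factor be dropped from the smallness
condition. -/
lemma one_le_constC {p : ℝ≥0∞} (hp : 2 < p) : 1 ≤ constC p := by
  unfold constC
  split_ifs with h
  · exact le_rfl
  have hp2 : 2 < p.toReal := by
    have := (ENNReal.toReal_lt_toReal (by simp) h).2 hp
    simpa using this
  have h1 : 2 ≤ 2 * p.toReal / (p.toReal - 2) := by
    rw [le_div_iff₀ (by linarith)]; linarith
  have hpi := Real.pi_pos
  have hpi4 := Real.pi_le_four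
  have h2 : (2 / Real.pi) ^ (1 : ℝ) ≤ (2 / Real.pi) ^ (1 / p.toReal) := by
    refine Real.rpow_le_rpow_of_exponent_ge (by positivity) ?_ ?_
    · rw [div_le_one hpi]; exact Real.two_le_pi
    · rw [div_le_one (by linarith)]; linarith
  have h3 : 1 / 2 ≤ (2 / Real.pi) ^ (1 / p.toReal) := by
    refine le_trans ?_ h2
    rw [Real.rpow_one, div_le_div_iff₀ (by norm_num) hpi]; linarith
  nlinarith

/-- For p = ⊤ one has `p.toReal = 0` and 1/0 = 0, so the same formula gives 1. -/
lemma expAlpha_eq (p : ℝ≥0∞) : expAlpha p = 2 * (1 / 2 - 1 / p.toReal) := by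
  unfold expAlpha
  split_ifs with h
  · simp [h]
  · ring

lemma expAlpha_mem_Icc {p : ℝ≥0∞} (hp : 2 < p) : expAlpha p ∈ Icc (0 : ℝ) 1 := by
  unfold expAlpha
  split_ifs with h
  · simp
  have hp2 : 2 < p.toReal := by
    have := (ENNReal.toReal_lt_toReal (by simp) h).2 hp
    simpa using this
  constructor
  · rw [sub_nonneg, div_le_one (by linarith)]; exact hp2.le
  · have : 0 ≤ 2 / p.toReal := by positivity
    linarith

/-- Hölder's inequality for the energy of a field in `L^p`, `p > 2`. -/
lemma integral_norm_sq_le {α E : Type*} [MeasurableSpace α] [NormedAddCommGroup E]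
    {μ : Measure α} [IsFiniteMeasure μ] {H : α → E} {p : ℝ≥0∞} (hp : 2 < p) (hH : MemLp H p μ) :
    ∫ q, ‖H q‖ ^ 2 ∂μ ≤ (eLpNorm H p μ).toReal ^ 2 * μ.real univ ^ expAlpha p := by
  have h2 : MemLp H 2 μ := hH.mono_exponent hp.le
  have h := eLpNorm_le_eLpNorm_mul_rpow_measure_univ hp.le hH.1
  rw [h2.eLpNorm_eq_integral_rpow_norm (by norm_num) (by norm_num)] at h
  have hnn : 0 ≤ ∫ q, ‖H q‖ ^ 2 ∂μ := integral_nonneg fun q => by positivity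
  have hexp : 0 ≤ 1 / (2 : ℝ≥0∞).toReal - 1 / p.toReal := by
    have := (expAlpha_mem_Icc hp).1
    rw [expAlpha_eq] at this
    simp only [ENNReal.toReal_ofNat]
    linarith
  have h' := ENNReal.toReal_mono (ENNReal.mul_ne_top hH.2.ne
    (ENNReal.rpow_ne_top_of_nonneg hexp (measure_ne_top μ univ))) h
  rw [ENNReal.toReal_mul, ← ENNReal.toReal_rpow, ENNReal.toReal_ofReal (by positivity)] at h'
  simp only [ENNReal.toReal_ofNat, Real.rpow_ofNat] at h'
  have h3 : ((∫ q, ‖H q‖ ^ 2 ∂μ) ^ ((2 : ℝ)⁻¹)) ^ 2 = ∫ q, ‖H q‖ ^ 2 ∂μ := by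
    rw [← Real.rpow_natCast, ← Real.rpow_mul hnn]; norm_num
  have h4 : ((μ univ).toReal ^ (1 / 2 - 1 / p.toReal)) ^ 2 = μ.real univ ^ expAlpha p := by
    rw [← Real.rpow_natCast, ← Real.rpow_mul ENNReal.toReal_nonneg, expAlpha_eq, mul_comm]
    rfl
  rw [← h3, ← h4, ← mul_pow]
  exact pow_le_pow_left₀ (by positivity) h' 2

end Exponents

/-! ### Bounds for the area and for the energy of H. -/

section Surface

variable {n : ℕ} {M : Type*} [TopologicalSpace M] [ChartedSpace (EuclideanHalfSpace 2) M]
  [IsManifold (𝓡∂ 2) ∞ M] [MeasurableSpace M] [BorelSpace M] [CompactSpace M]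
  {γ : ℝ → Euc n} {u H : M → Euc n}

/-- The area is controlled by the boundary curve and the energy of the mean curvature. -/
lemma area_le_of_integral_poissonDensity_le (hu : ContMDiff (𝓡∂ 2) 𝓘(ℝ, Euc n) 1 u)
    (hr : 0 < extrinsicDiam u) (q₀ : M) {W : ℝ}
    (hW : 2 * ∫ q, poissonDensity u (extrinsicDiam u) (u q₀) q ∂(area u) ≤ W) :
    (area u).real univ / extrinsicDiam u ^ 2 ≤ 2 * W := by
  have : IsFiniteMeasure (area u) := isFiniteMeasure_area hu
  set r := extrinsicDiam u with hr_def
  have hb : Bornology.IsBounded (range u) := (isCompact_range hu.continuous).isBounded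
  -- At scale r every point of the surface is within r of the centre, so the density is at least
  -- r²/(2r²)².
  have h1 : ∀ q, 1 / (4 * r ^ 2) ≤ poissonDensity u r (u q₀) q := by
    intro q
    have hd : ‖u q - u q₀‖ ≤ r := by
      rw [← dist_eq_norm]
      exact Metric.dist_le_diam_of_mem hb (mem_range_self q) (mem_range_self q₀)
    unfold poissonDensity
    rw [div_le_div_iff₀ (by positivity) (by positivity)]
    have h2 : ‖u q - u q₀‖ ^ 2 + r ^ 2 ≤ 2 * r ^ 2 := by
      nlinarith [norm_nonneg (u q - u q₀)]
    have h3 := pow_le_pow_left₀ (by positivity) h2 2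
    nlinarith
  have h2 := integral_mono (μ := area u) (integrable_const (1 / (4 * r ^ 2)))
    (integrable_poissonDensity hu hr (u q₀)) h1
  rw [integral_const, smul_eq_mul] at h2
  have h3 : (area u).real univ / r ^ 2 = 4 * ((area u).real univ * (1 / (4 * r ^ 2))) := by
    field_simp
  linarith

/-- A field that is small in `L^p` has small energy. -/
lemma integral_norm_sq_le_of_small (hu : ContMDiff (𝓡∂ 2) 𝓘(ℝ, Euc n) 1 u)
    (hr : 0 < extrinsicDiam u) {p : ℝ≥0∞} (hp : 2 < p) (hH : MemLp H p (area u)) {δ : ℝ}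
    (hδ : constC p * (eLpNorm H p (area u)).toReal * extrinsicDiam u ^ expAlpha p < δ) :
    ∫ q, ‖H q‖ ^ 2 ∂(area u) ≤
      δ ^ 2 * max 1 ((area u).real univ / extrinsicDiam u ^ 2) := by
  have : IsFiniteMeasure (area u) := isFiniteMeasure_area hu
  set r := extrinsicDiam u with hr_def
  set L := (eLpNorm H p (area u)).toReal with hL
  set A := (area u).real univ with hA
  set α := expAlpha p with hα
  obtain ⟨hα0, hα1⟩ := expAlpha_mem_Icc hp
  have hL0 : 0 ≤ L := ENNReal.toReal_nonneg
  have hA0 : 0 ≤ A := measureReal_nonneg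
  have h1 : L * r ^ α ≤ δ := by
    have h0 : 0 ≤ L * r ^ α := by positivity
    have := mul_le_mul_of_nonneg_right (one_le_constC hp) h0
    nlinarith
  have h2 := integral_norm_sq_le hp hH
  -- Splits Hölder's bound into the scale-invariant quantities L·r^α and A/r².
  have h3 : A ^ α = (A / r ^ 2) ^ α * (r ^ α) ^ 2 := by
    rw [← Real.rpow_natCast (r ^ α), ← Real.rpow_mul hr.le, mul_comm α, Real.rpow_mul hr.le,
      Real.rpow_natCast, ← Real.mul_rpow (by positivity) (by positivity),
      div_mul_cancel₀ _ (by positivity)]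
  have h4 : (A / r ^ 2) ^ α ≤ max 1 (A / r ^ 2) := by
    calc (A / r ^ 2) ^ α ≤ (max 1 (A / r ^ 2)) ^ α :=
          Real.rpow_le_rpow (by positivity) (le_max_right _ _) hα0
      _ ≤ (max 1 (A / r ^ 2)) ^ (1 : ℝ) :=
          Real.rpow_le_rpow_of_exponent_le (le_max_left _ _) hα1
      _ = _ := Real.rpow_one _
  calc _ ≤ L ^ 2 * A ^ α := h2
    _ = (L * r ^ α) ^ 2 * (A / r ^ 2) ^ α := by rw [h3]; ring
    _ ≤ _ := by gcongr

omit [MeasurableSpace M] [BorelSpace M] [IsManifold (𝓡∂ 2) ∞ M] in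
lemma extrinsicDiam_pos (hu : Continuous u) (hγ : IsC1ClosedCurve γ)
    (himg : u '' ((𝓡∂ 2).boundary M) = range γ) : 0 < extrinsicDiam u := by
  have hb : Bornology.IsBounded (range u) := (isCompact_range hu).isBounded
  have hsub : range γ ⊆ range u := himg ▸ image_subset_range _ _
  have hne : γ 0 ≠ γ (1 / 2) := fun h => by
    have := hγ.injOn (by norm_num) (by norm_num) h
    norm_num at this
  exact (dist_pos.2 hne).trans_le (Metric.dist_le_diam_of_mem hb (hsub (mem_range_self _))
    (hsub (mem_range_self _)))

/-- Monotonicity: for every centre `x` the Poisson mass of the surface is controlled by the total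
curvature of the boundary, the energy of the mean curvature, and the defect of the boundary. -/
lemma IsBranchedImmersion.two_mul_integral_poissonDensity_le (hu : IsBranchedImmersion u)
    (hγ : IsC1ClosedCurve γ) (hinj : InjOn u ((𝓡∂ 2).boundary M))
    (himg : u '' ((𝓡∂ 2).boundary M) = range γ) (hdiv : DivergenceIdentity u H)
    (hH : MemLp H 2 (area u)) {V : ℝ} (hV0 : 0 ≤ V)
    (hV : totalCurvature γ ≤ ENNReal.ofReal V) {s : ℝ} (hs : 0 < s) (x : Euc n) :
    2 * ∫ q, poissonDensity u s x q ∂(area u) ≤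
      (1 / 8) * (∫ q, ‖H q‖ ^ 2 ∂(area u)) + V - ∫ t in (0 : ℝ)..1, coneDefect γ s x t := by
  have h := BranchedSurface.two_mul_integral_poissonDensity_le hu.contMDiff hdiv hH hs x
    ((integral_conormal_le hu hγ hinj himg hs x).trans (hγ.integral_fluxSpeed_le hV0 hV hs x))
  linarith

/-- The area bound involves the energy Q, and Hölder bounds Q by δ² times the normalized area a. As
δ² ≤ 1/4 the loop closes: a is bounded by an absolute constant, and Q is then of order ε². -/
lemma IsBranchedImmersion.energy_lt (hu : IsBranchedImmersion u)
    (hγ : IsC1ClosedCurve γ) (hinj : InjOn u ((𝓡∂ 2).boundary M))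
    (himg : u '' ((𝓡∂ 2).boundary M) = range γ) (hdiv : DivergenceIdentity u H)
    {ε : ℝ} (hε₀ : 0 < ε) (hε₂ : ε ≤ 2)
    (hV : totalCurvature γ ≤ ENNReal.ofReal ((4 - ε) * Real.pi))
    {p : ℝ≥0∞} (hp : 2 < p) (hH : MemLp H p (area u))
    (hδ : constC p * (eLpNorm H p (area u)).toReal * extrinsicDiam u ^ expAlpha p < ε / 4) :
    (1 / 8) * ∫ q, ‖H q‖ ^ 2 ∂(area u) < ε * Real.pi := by
  have hpi := Real.pi_gt_three
  have hpi4 := Real.pi_le_four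
  have : IsFiniteMeasure (area u) := isFiniteMeasure_area hu.contMDiff
  have hr := extrinsicDiam_pos hu.contMDiff.continuous hγ himg
  have hV0 : 0 ≤ (4 - ε) * Real.pi := by nlinarith
  obtain ⟨q₀, -, -⟩ : γ 0 ∈ u '' ((𝓡∂ 2).boundary M) := himg ▸ mem_range_self _
  have h1 := hu.two_mul_integral_poissonDensity_le hγ hinj himg hdiv (hH.mono_exponent hp.le) hV0 hV
    hr (u q₀)
  have h2 := hγ.integral_coneDefect_nonneg (extrinsicDiam u) (u q₀)
  have h3 := area_le_of_integral_poissonDensity_le hu.contMDiff hr q₀ h1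
  have h4 := integral_norm_sq_le_of_small hu.contMDiff hr hp hH hδ
  set a := (area u).real univ / extrinsicDiam u ^ 2
  set Q := ∫ q, ‖H q‖ ^ 2 ∂(area u)
  have hδ2 : (ε / 4) ^ 2 ≤ 1 / 4 := by nlinarith
  have hV4 : (4 - ε) * Real.pi ≤ 16 := by nlinarith
  -- From a ≤ Q/4 + 32 and, when a ≥ 1, Q ≤ a/4, one gets a ≤ 512/15 < 40.
  have ha : max 1 a ≤ 40 := by
    rcases max_cases 1 a with ⟨h, -⟩ | ⟨h, h'⟩
    · rw [h]; norm_num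
    · rw [h] at h4 ⊢
      have : Q ≤ 1 / 4 * a := h4.trans (by nlinarith)
      linarith
  have h5 : Q ≤ (ε / 4) ^ 2 * 40 := h4.trans (by gcongr)
  nlinarith

lemma eventually_lt_setIntegral_poissonDensity (hu : ContMDiff (𝓡∂ 2) 𝓘(ℝ, Euc n) 1 u) {V : Set M}
    {x : Euc n} {b c : ℝ} (hc : c < b) (hb0 : 0 < b)
    (hb : ENNReal.ofReal b ≤ Filter.liminf (fun s => ∫⁻ q in V,
      ENNReal.ofReal (poissonDensity u s x q) ∂(area u)) (𝓝[>] (0 : ℝ))) :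
    ∀ᶠ s in 𝓝[>] (0 : ℝ), c < ∫ q in V, poissonDensity u s x q ∂(area u) := by
  have h := Filter.eventually_lt_of_lt_liminf
    (((ENNReal.ofReal_lt_ofReal_iff hb0).2 hc).trans_le hb)
  filter_upwards [h, self_mem_nhdsWithin] with s hs hs0
  rw [← ofReal_integral_eq_lintegral_ofReal (integrable_poissonDensity hu hs0 x).restrict
    (ae_of_all _ fun q => poissonDensity_nonneg u s x q)] at hs
  exact (ENNReal.ofReal_lt_ofReal_iff'.1 hs).1

end Surface

/-! ### Counting densities. -/

section Embedding

variable {n : ℕ} {M : Type*} [TopologicalSpace M]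
  [ChartedSpace (EuclideanHalfSpace 2) M]
  [IsManifold (𝓡∂ 2) ∞ M] [MeasurableSpace M] [BorelSpace M] [CompactSpace M]
  {γ : ℝ → Euc n} {u : M → Euc n}

lemma IsBranchedImmersion.eventually_lt_interior (hu : IsBranchedImmersion u) {p : M}
    (hp : (𝓡∂ 2).IsInteriorPoint p) {V : Set M} (hV : IsOpen V) (hpV : p ∈ V) {c : ℝ}
    (hc : c < Real.pi) :
    ∀ᶠ s in 𝓝[>] (0 : ℝ), c < ∫ q in V, poissonDensity u s (u p) q ∂(area u) := by
  obtain ⟨k, -, hk⟩ := hu.exists_interior_density hp hV hpV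
  refine eventually_lt_setIntegral_poissonDensity hu.contMDiff hc Real.pi_pos
    (le_trans (ENNReal.ofReal_le_ofReal ?_) hk)
  nlinarith [Real.pi_pos, (Nat.cast_nonneg k : (0 : ℝ) ≤ k)]

lemma IsBranchedImmersion.eventually_lt_branch (hu : IsBranchedImmersion u) {p : M}
    (hp : (𝓡∂ 2).IsInteriorPoint p) (hdu : ¬ Function.Injective (du u p)) {c : ℝ}
    (hc : c < 2 * Real.pi) :
    ∀ᶠ s in 𝓝[>] (0 : ℝ), c < ∫ q, poissonDensity u s (u p) q ∂(area u) := by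
  obtain ⟨k, hk1, hk⟩ := hu.exists_interior_density hp isOpen_univ (mem_univ p)
  have hk1' : (1 : ℝ) ≤ k := by exact_mod_cast hk1 hdu
  have h := eventually_lt_setIntegral_poissonDensity hu.contMDiff hc Real.two_pi_pos
    (le_trans (ENNReal.ofReal_le_ofReal (by nlinarith [Real.pi_pos])) hk)
  simpa only [setIntegral_univ] using h

lemma IsBranchedImmersion.eventually_lt_boundary (hu : IsBranchedImmersion u) {p : M}
    (hp : (𝓡∂ 2).IsBoundaryPoint p) {V : Set M} (hV : IsOpen V) (hpV : p ∈ V) {c : ℝ}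
    (hc : c < Real.pi / 2) :
    ∀ᶠ s in 𝓝[>] (0 : ℝ), c < ∫ q in V, poissonDensity u s (u p) q ∂(area u) := by
  refine eventually_lt_setIntegral_poissonDensity hu.contMDiff hc (by positivity) ?_
  have h := hu.boundary_density hp hV hpV
  rw [ENNReal.ofReal_div_of_pos two_pos, ENNReal.ofReal_ofNat]
  exact ENNReal.div_le_of_le_mul' h

lemma setIntegral_add_setIntegral_poissonDensity_le (hu : ContMDiff (𝓡∂ 2) 𝓘(ℝ, Euc n) 1 u)
    {V W : Set M} (hW : IsOpen W) (hVW : Disjoint V W) {s : ℝ} (hs : 0 < s) (x : Euc n) :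
    (∫ q in V, poissonDensity u s x q ∂(area u)) + ∫ q in W, poissonDensity u s x q ∂(area u) ≤
      ∫ q, poissonDensity u s x q ∂(area u) := by
  have hi := integrable_poissonDensity hu hs x
  rw [← setIntegral_union hVW hW.measurableSet hi.integrableOn hi.integrableOn]
  exact setIntegral_le_integral hi (ae_of_all _ fun q => poissonDensity_nonneg u s x q)

/-- Each failure puts too much mass at one centre: 2·2π at a branch point, 2(π + π) at a double
point, 2(π + π/2) where the interior meets Γ. The last is excluded only because the defect takes π
off the right-hand side. -/
lemma IsBranchedImmersion.interiorEmbedded [T2Space M] (hu : IsBranchedImmersion u)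
    (hγ : IsC1ClosedCurve γ) (himg : u '' ((𝓡∂ 2).boundary M) = range γ)
    {W : ℝ} (hW : W < 4 * Real.pi)
    (h : ∀ s, 0 < s → ∀ x, 2 * ∫ q, poissonDensity u s x q ∂(area u) ≤
      W - ∫ t in (0 : ℝ)..1, coneDefect γ s x t) :
    InteriorEmbedded u := by
  have hcont := hu.contMDiff.continuous
  have h0 : ∀ s, 0 < s → ∀ x, 2 * ∫ q, poissonDensity u s x q ∂(area u) ≤ W := fun s hs x =>
    (h s hs x).trans (sub_le_self _ (hγ.integral_coneDefect_nonneg s x))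
  have himm : ∀ p ∈ (𝓡∂ 2).interior M, Function.Injective (du u p) := by
    intro p hp
    by_contra hdu
    obtain ⟨s, hs, hs0⟩ := ((hu.eventually_lt_branch hp hdu (c := W / 2) (by linarith)).and
      self_mem_nhdsWithin).exists
    linarith [h0 s hs0 (u p)]
  have hinj : InjOn u ((𝓡∂ 2).interior M) := by
    intro p hp q hq hpq
    by_contra hne
    obtain ⟨A, B, hA, hB, hpA, hqB, hAB⟩ := t2_separation hne
    have h1 := hu.eventually_lt_interior hp hA hpA (c := W / 4) (by linarith)
    have h2 := hu.eventually_lt_interior hq hB hqB (c := W / 4) (by linarith)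
    obtain ⟨s, ⟨hs1, hs2⟩, hs0⟩ := ((h1.and h2).and self_mem_nhdsWithin).exists
    rw [← hpq] at hs2
    linarith [h0 s hs0 (u p),
      setIntegral_add_setIntegral_poissonDensity_le hu.contMDiff hB hAB hs0 (u p)]
  have hdisj : ∀ p ∈ (𝓡∂ 2).interior M, u p ∉ range γ := by
    rintro p hp hpγ
    obtain ⟨t₀, ht₀⟩ := hpγ
    obtain ⟨q, hq, hqp⟩ : γ t₀ ∈ u '' ((𝓡∂ 2).boundary M) := himg ▸ mem_range_self _
    have hne : p ≠ q := by
      rintro rfl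
      rw [← ModelWithCorners.compl_boundary] at hp
      exact hp hq
    obtain ⟨A, B, hA, hB, hpA, hqB, hAB⟩ := t2_separation hne
    -- The three errors enter with total weight 5, so any e below (4π - W)/5 would do.
    set e := (4 * Real.pi - W) / 16 with he
    have he0 : 0 < e := by rw [he]; linarith
    have h1 := hu.eventually_lt_interior hp hA hpA (c := Real.pi - e) (by linarith)
    have h2 := hu.eventually_lt_boundary hq hB hqB (c := Real.pi / 2 - e) (by linarith)
    have h3 := hγ.eventually_le_integral_coneDefect t₀ (c := Real.pi - e) (by linarith)
    obtain ⟨s, ⟨⟨hs1, hs2⟩, hs3⟩, hs0⟩ :=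
      (((h1.and h2).and h3).and self_mem_nhdsWithin).exists
    rw [hqp, ht₀] at hs2
    rw [ht₀] at hs3
    linarith [h s hs0 (u p),
      setIntegral_add_setIntegral_poissonDensity_le hu.contMDiff hB hAB hs0 (u p)]
  refine ⟨himm, ?_⟩
  -- The interior is the full preimage of the complement of Γ, so the restriction of the closed map
  -- `u` is still closed; a continuous closed injection is an embedding.
  have hpre : (𝓡∂ 2).interior M = u ⁻¹' (range γ)ᶜ := by
    ext p
    refine ⟨fun hp => hdisj p hp, fun hp => ?_⟩
    rw [← ModelWithCorners.compl_boundary]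
    exact fun hb => hp (himg ▸ mem_image_of_mem u hb)
  have hres : IsClosedMap ((range γ)ᶜ.restrictPreimage u) := hcont.isClosedMap.restrictPreimage _
  have hemb : IsEmbedding ((range γ)ᶜ.restrictPreimage u) :=
    (IsClosedEmbedding.of_continuous_injective_isClosedMap hcont.restrictPreimage
      (fun a b hab => Subtype.ext (hinj (hpre.ge a.2) (hpre.ge b.2) (congrArg Subtype.val hab)))
      hres).isEmbedding
  rw [hpre]
  exact IsEmbedding.subtypeVal.comp hemb

end Embedding

end BranchedSurface

end

theorem corollary3p3 (ε : ℝ) (hε₀ : 0 < ε) (hε₂ : ε ≤ 2) :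
    ∃ δ : ℝ, 0 < δ ∧ δ < 1 ∧
      ∀ (n : ℕ) (p : ℝ≥0∞) (M : Type*) [TopologicalSpace M] [T2Space M] [CompactSpace M]
        [ChartedSpace (EuclideanHalfSpace 2) M] [IsManifold (𝓡∂ 2) ∞ M]
        [MeasurableSpace M] [BorelSpace M]
        (γ : ℝ → BranchedSurface.Euc n) (u H : M → BranchedSurface.Euc n),
        2 < p →
        BranchedSurface.IsC1ClosedCurve γ →
        BranchedSurface.totalCurvature γ ≤ ENNReal.ofReal ((4 - ε) * Real.pi) →
        BranchedSurface.IsBranchedImmersion u →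
        InjOn u ((𝓡∂ 2).boundary M) →
        u '' ((𝓡∂ 2).boundary M) = range γ →
        BranchedSurface.DivergenceIdentity u H →
        MemLp H p (BranchedSurface.area u) →
        BranchedSurface.constC p * (eLpNorm H p (BranchedSurface.area u)).toReal *
          BranchedSurface.extrinsicDiam u ^ BranchedSurface.expAlpha p < δ →
        BranchedSurface.InteriorEmbedded u := by
  -- With this δ, `energy_lt` makes the curvature term smaller than επ, the margin left between (4 -
  -- ε)π and 4π.
  refine ⟨ε / 4, by linarith, by linarith, ?_⟩
  intro n p M _ _ _ _ _ _ _ γ u H hp hγ hV hu hinj himg hdiv hH hδ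
  have : IsFiniteMeasure (BranchedSurface.area u) :=
    BranchedSurface.isFiniteMeasure_area hu.contMDiff
  have hE := hu.energy_lt hγ hinj himg hdiv hε₀ hε₂ hV hp hH hδ
  refine hu.interiorEmbedded hγ himg (W := (1 / 8) * (∫ q, ‖H q‖ ^ 2 ∂(BranchedSurface.area u)) +
    (4 - ε) * Real.pi) (by linarith) fun s hs x => ?_
  exact hu.two_mul_integral_poissonDensity_le hγ hinj himg hdiv (hH.mono_exponent hp.le)
    (by nlinarith [Real.pi_pos]) hV hs x
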